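/- **Conventions.** Manifolds are smooth, finite-dimensional, Hausdorff and without boundary; submanifolds are embedded. A Calabi–Yau manifold $(M,I,\omega,\Omega)$ of complex dimension $n$ is a complex manifold $(M,I)$ with a Kähler form $\omega$, Kähler metric $g(u,v)=\omega(u,Iv)$, and a holomorphic volume form $\Omega$ such that $$\frac{\omega^n}{n!}=(-1)^{\frac{n(n-1)}2}\Big(\frac{\sqrt{-1}}2\Big)^n\,\Omega\wedge\overline\Omega .$$ An immersion $f:N\to M$ is *Lagrangian* if $\dim N=n$ and $f^*\omega=0$. A (local) *Lagrangian angle* of $f$ is a real function $\theta$ on $N$ with $f^*\Omega=\pm e^{\sqrt{-1}\theta}\,\mathrm{vol}_{f^*g}$ at each point, where the sign depends on the orientation chosen at the point; so $\theta$ is determined modulo $\pi$. A Lagrangian immersion is *special Lagrangian* if it has a constant Lagrangian angle. Let $H$ be a Lie group with Lie algebra $\mathfrak h$, acting smoothly on $M$; write $L_h(p)=hp$ and $\xi^\#_p=\frac{d}{dt}\big|_{t=0}\exp(t\xi)p$. A *moment map* is a smooth map $\mu:M\to\mathfrak h^*$ with $\langle\mu(hp),\xi\rangle=\langle\mu(p),\mathrm{Ad}_{h^{-1}}\xi\rangle$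 and $-\omega(\xi^\#,\cdot)=d\langle\mu,\xi\rangle$ for all $h\in H$, $p\in M$, $\xi\in\mathfrak h$. Put $Z(\mathfrak h^*)=\{c\in\mathfrak h^*: c\circ\mathrm{Ad}_h=c \text{ for all } h\in H\}$. **Corollary 4.8.** Let $(M,I,\omega,\Omega)$ be a connected Calabi–Yau manifold of complex dimension $n$, and let $H$ be a connected Lie group acting smoothly on $M$, preserving $I$, with a moment map $\mu$. Then $L_h^*\Omega=c_h\Omega$ for a Lie group homomorphism $h\mapsto c_h$ from $H$ to $U(1)$; let $a_H=-\sqrt{-1}\,(dc)_e\in\mathfrak h^*$. Let $L\subset M$ be a Lagrangian submanifold with (local) Lagrangian angle $\theta$, let $c\in\mathfrak h^*$, and let $V_c$ be a submanifold of $M$ with $V_c\subset\mu^{-1}(c)\cap L$. Assume: 1. there is a subgroup $K$ of $H$ that is the isotropy subgroup of $H$ at every $p\in V_c$, and $H/K$ carries its standard smooth structure (the one for which $H\to H/K$ is a submersion); 2. $c\in Z(\mathfrak h^*)$; 3. $\dim(H/K)+\dim V_c=n$; 4. for every $p\in V_c$ and $\xi\in\mathfrak h$: (i) $\xi^\#_p\in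 T_p^\perp L\oplus T_pV_c$, where $T_p^\perp L$ is the $g$-orthogonal complement of $T_pL$ in $T_pM$, and (ii) $\xi^\#_p\notin T_pV_c\setminus\{0\}$; 5. $\theta$ is constant on $V_c$ (for example, $L$ is special Lagrangian); 6. $a_H=0$ (equivalently, $H$ preserves $\Omega$). Then the map $$\phi_c:(H/K)\times V_c\to M,\qquad (hK,p)\mapsto hp,$$ is a special Lagrangian immersion. -/

import Mathlib

open scoped Manifold ContDiff Nat

noncomputable section

namespace CalabiYauGeometry

/-! ### Submanifolds, immersions, submersions -/

section Smooth

variable {E₁ H₁ N₁ E₂ H₂ N₂ : Type*}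
  [NormedAddCommGroup E₁] [NormedSpace ℝ E₁] [TopologicalSpace H₁]
  [TopologicalSpace N₁] [ChartedSpace H₁ N₁]
  [NormedAddCommGroup E₂] [NormedSpace ℝ E₂] [TopologicalSpace H₂]
  [TopologicalSpace N₂] [ChartedSpace H₂ N₂]

/-- A smooth map with injective differential at every point (all manifolds below are
finite-dimensional and without boundary). -/
def IsSmoothImmersion (J₁ : ModelWithCorners ℝ E₁ H₁) (J₂ : ModelWithCorners ℝ E₂ H₂)
    (f : N₁ → N₂) : Prop :=
  ContMDiff J₁ J₂ ∞ f ∧ ∀ x, Function.Injective (mfderiv J₁ J₂ f x)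

/-- A smooth map with surjective differential at every point. -/
def IsSmoothSubmersion (J₁ : ModelWithCorners ℝ E₁ H₁) (J₂ : ModelWithCorners ℝ E₂ H₂)
    (f : N₁ → N₂) : Prop :=
  ContMDiff J₁ J₂ ∞ f ∧ ∀ x, Function.Surjective (mfderiv J₁ J₂ f x)

end Smooth

/-! ### Exterior algebra at a point -/

section Wedge

variable {V : Type*} [AddCommGroup V] [Module ℝ V]

/-- The wedge product of complex-valued real-multilinear alternating forms, normalised as a sum over
shuffles, so that `(dx ∧ dy) (∂x, ∂y) = 1`. -/
def wedge {k l : ℕ} (a : V [⋀^Fin k]→ₗ[ℝ] ℂ) (b : V [⋀^Fin l]→ₗ[ℝ] ℂ) :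
    V [⋀^Fin (k + l)]→ₗ[ℝ] ℂ :=
  ((LinearMap.mul' ℝ ℂ).compAlternatingMap (a.domCoprod b)).domDomCongr finSumFinEquiv

/-- The `m`-fold wedge power of a 2-form; the zeroth power is the constant `1`. -/
def wedgePow (a : V [⋀^Fin 2]→ₗ[ℝ] ℂ) : (m : ℕ) → V [⋀^Fin (2 * m)]→ₗ[ℝ] ℂ
  | 0 => AlternatingMap.constOfIsEmpty ℝ V (Fin 0) (1 : ℂ)
  | m + 1 => wedge (wedgePow a m) a

end Wedge

/-! ### Differential forms on a manifold modelled on a vector space -/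

section Forms

variable {E M F : Type*} [NormedAddCommGroup E] [NormedSpace ℝ E]
  [TopologicalSpace M] [ChartedSpace E M] [NormedAddCommGroup F] [NormedSpace ℝ F] {k : ℕ}

/-- The expression of a differential form in the chart around `x`, i.e. its pull-back under the
inverse of that chart (meaningful on the target of the chart, an open subset of `E`). -/
def formInChart (α : ∀ p : M, TangentSpace 𝓘(ℝ, E) p [⋀^Fin k]→L[ℝ] F) (x : M) :
    E → E [⋀^Fin k]→L[ℝ] F := fun y =>
  (α ((extChartAt 𝓘(ℝ, E) x).symm y)).compContinuousLinearMap
    (mfderiv 𝓘(ℝ, E) 𝓘(ℝ, E) (extChartAt 𝓘(ℝ, E) x).symm y)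

/-- A form is smooth if it is smooth in the charts. -/
def IsSmoothForm (α : ∀ p : M, TangentSpace 𝓘(ℝ, E) p [⋀^Fin k]→L[ℝ] F) : Prop :=
  ∀ x : M, ContDiffOn ℝ ∞ (formInChart α x) (extChartAt 𝓘(ℝ, E) x).target

/-- A form is closed if its exterior derivative vanishes in the charts. -/
def IsClosedForm (α : ∀ p : M, TangentSpace 𝓘(ℝ, E) p [⋀^Fin k]→L[ℝ] F) : Prop :=
  ∀ x : M, ∀ y ∈ (extChartAt 𝓘(ℝ, E) x).target, extDeriv (formInChart α x) y = 0

end Forms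

/-! ### Calabi-Yau manifolds -/

section CalabiYau

variable {E M : Type*} [NormedAddCommGroup E] [NormedSpace ℂ E]
  [TopologicalSpace M] [ChartedSpace E M]

/-- The complex structure `I` of a complex manifold on its real tangent spaces. The real tangent
space at `p` is the model space `E`, via the preferred chart at `p`; this chart belongs to the
holomorphic atlas, so `I` is multiplication by `√-1`. -/
def complexStructure (p : M) : TangentSpace 𝓘(ℝ, E) p →L[ℝ] TangentSpace 𝓘(ℝ, E) p :=
  ((Complex.I • ContinuousLinearMap.id ℂ E).restrictScalars ℝ : E →L[ℝ] E)

variable (E M) in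
/-- A Calabi-Yau structure on a complex manifold `M` of complex dimension `n`:
a Kähler form `omega` and a holomorphic volume form `Omega` with
`ω^n / n! = (-1)^{n(n-1)/2} (√-1 / 2)^n Ω ∧ conj Ω`. -/
structure CalabiYau (n : ℕ) where
  finrank_eq : Module.finrank ℂ E = n
  /-- the Kähler form -/
  omega : ∀ p : M, TangentSpace 𝓘(ℝ, E) p [⋀^Fin 2]→L[ℝ] ℝ
  /-- the holomorphic volume form, as a complex-valued form on the real tangent spaces -/
  Omega : ∀ p : M, TangentSpace 𝓘(ℝ, E) p [⋀^Fin n]→L[ℝ] ℂ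
  omega_smooth : IsSmoothForm omega
  omega_closed : IsClosedForm omega
  /-- `ω` is of type `(1,1)` -/
  omega_I_I : ∀ (p : M) (u v : TangentSpace 𝓘(ℝ, E) p),
    omega p ![complexStructure p u, complexStructure p v] = omega p ![u, v]
  /-- `ω` is positive -/
  omega_pos : ∀ (p : M) (v : TangentSpace 𝓘(ℝ, E) p), v ≠ 0 →
    0 < omega p ![v, complexStructure p v]
  /-- `Ω` is of type `(n,0)`, i.e. complex linear in each argument -/
  Omega_type : ∀ (p : M) (v : Fin n → TangentSpace 𝓘(ℝ, E) p) (i : Fin n),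
    Omega p (Function.update v i (complexStructure p (v i))) = Complex.I * Omega p v
  /-- the coefficients of `Ω` in the holomorphic charts are holomorphic -/
  Omega_holomorphic : ∀ (x : M) (w : Fin n → E),
    AnalyticOnNhd ℂ (fun y => formInChart Omega x y w) (extChartAt 𝓘(ℝ, E) x).target
  Omega_ne_zero : ∀ p : M, Omega p ≠ 0
  normalization : ∀ (p : M) (v : Fin (2 * n) → TangentSpace 𝓘(ℝ, E) p),
    wedgePow (Complex.ofRealCLM.toLinearMap.compAlternatingMap (omega p).toAlternatingMap) n v
        / (n ! : ℂ)
      = (-1) ^ (n * (n - 1) / 2) * (Complex.I / 2) ^ n *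
        wedge (Omega p).toAlternatingMap
          (Complex.conjCLE.toContinuousLinearMap.toLinearMap.compAlternatingMap
            (Omega p).toAlternatingMap)
          (fun i => v (Fin.cast (two_mul n).symm i))

variable {n : ℕ} (C : CalabiYau E M n)

/-- The Kähler metric `g(u, v) = ω(u, I v)`, equivalently `ω(u, v) = g(I u, v)`. -/
def CalabiYau.metric (p : M) (u v : TangentSpace 𝓘(ℝ, E) p) : ℝ :=
  C.omega p ![u, complexStructure p v]

/-- The tangent space of a submanifold `S ⊆ M` at `p ∈ S`, as a subspace of that of `M`.
An (embedded) submanifold is a subset with a manifold structure on it, compatible with the subspace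
topology, for which the inclusion is an immersion. -/
def tangentSubspace (ES : Type*) [NormedAddCommGroup ES] [NormedSpace ℝ ES] (S : Set M)
    [ChartedSpace ES S] (p : S) : Submodule ℝ (TangentSpace 𝓘(ℝ, E) (p : M)) :=
  LinearMap.range (mfderiv 𝓘(ℝ, ES) 𝓘(ℝ, E) (Subtype.val : S → M) p).toLinearMap

/-- The normal space of a submanifold with respect to the Kähler metric. -/
def CalabiYau.normalSubspace (ES : Type*) [NormedAddCommGroup ES] [NormedSpace ℝ ES] (S : Set M)
    [ChartedSpace ES S] (p : S) : Submodule ℝ (TangentSpace 𝓘(ℝ, E) (p : M)) where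
  carrier := {u | ∀ w ∈ tangentSubspace ES S p, C.metric p u w = 0}
  zero_mem' := fun w _ => (C.omega (p : M)).map_coord_zero (0 : Fin 2) rfl
  add_mem' := by
    intro a b ha hb w hw
    have h := (C.omega (p : M)).toAlternatingMap.map_vecCons_add
      ![complexStructure (p : M) w] a b
    have h1 := ha w hw
    have h2 := hb w hw
    simp only [CalabiYau.metric] at h1 h2 ⊢
    exact h.trans (by
      rw [show (C.omega (p : M)).toAlternatingMap ![a, complexStructure (p : M) w] = 0 from h1,
        show (C.omega (p : M)).toAlternatingMap ![b, complexStructure (p : M) w] = 0 from h2,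
        add_zero])
  smul_mem' := by
    intro r a ha w hw
    have h := (C.omega (p : M)).toAlternatingMap.map_vecCons_smul
      ![complexStructure (p : M) w] r a
    have h1 := ha w hw
    simp only [CalabiYau.metric] at h1 ⊢
    exact h.trans (by
      rw [show (C.omega (p : M)).toAlternatingMap ![a, complexStructure (p : M) w] = 0 from h1,
        smul_zero])

section Immersed

variable {EN HN N : Type*} [NormedAddCommGroup EN] [NormedSpace ℝ EN] [TopologicalSpace HN]
  [TopologicalSpace N] [ChartedSpace HN N]

/-- An immersion `f : N → M` with `f^* ω = 0` and `dim N = n`. -/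
def CalabiYau.IsLagrangianImmersion (J : ModelWithCorners ℝ EN HN) (f : N → M) : Prop :=
  IsSmoothImmersion J 𝓘(ℝ, E) f ∧ Module.finrank ℝ EN = n ∧
    ∀ (x : N) (u v : TangentSpace J x),
      C.omega (f x) ![mfderiv J 𝓘(ℝ, E) f x u, mfderiv J 𝓘(ℝ, E) f x v] = 0

/-- `θ` is a (local) Lagrangian angle of `f` at `x`: `f^* Ω = e^{√-1 θ} vol_{f^* g}` at `x` for one of
the two orientations of the tangent space of `N` at `x`, i.e. `f^* Ω` takes one of the values
`± e^{√-1 θ}` on each basis that is orthonormal for `f^* g`. -/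
def CalabiYau.IsLagrangianAngleAt (J : ModelWithCorners ℝ EN HN) (f : N → M) (x : N) (θ : ℝ) :
    Prop :=
  ∀ e : Fin n → TangentSpace J x,
    (∀ i j, C.metric (f x) (mfderiv J 𝓘(ℝ, E) f x (e i)) (mfderiv J 𝓘(ℝ, E) f x (e j))
      = if i = j then 1 else 0) →
    C.Omega (f x) (fun i => mfderiv J 𝓘(ℝ, E) f x (e i)) = Complex.exp (Complex.I * θ) ∨
    C.Omega (f x) (fun i => mfderiv J 𝓘(ℝ, E) f x (e i)) = -Complex.exp (Complex.I * θ)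

/-- A Lagrangian immersion whose Lagrangian angle is constant. (Then `e^{-√-1 θ₀} f^* Ω` is a real
nowhere vanishing form; it orients `N`, and it is the volume form of `f^* g` for this
orientation.) -/
def CalabiYau.IsSpecialLagrangianImmersion (J : ModelWithCorners ℝ EN HN) (f : N → M) : Prop :=
  C.IsLagrangianImmersion J f ∧ ∃ θ₀ : ℝ, ∀ x : N, C.IsLagrangianAngleAt J f x θ₀

end Immersed

/-! ### Lie group actions -/

section Action

variable {EH H : Type*} [NormedAddCommGroup EH] [NormedSpace ℝ EH]
  [TopologicalSpace H] [ChartedSpace EH H] [Group H]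

/-- The adjoint action of `h` on the Lie algebra: the differential at `1` of conjugation by `h`
(which maps `1` to `h * 1 * h⁻¹ = 1`). -/
def Ad (h : H) : GroupLieAlgebra 𝓘(ℝ, EH) H →L[ℝ] GroupLieAlgebra 𝓘(ℝ, EH) H :=
  mfderiv 𝓘(ℝ, EH) 𝓘(ℝ, EH) (fun g : H => h * g * h⁻¹) 1

variable (EH H) in
/-- The center of the dual of the Lie algebra: the functionals fixed by the coadjoint action. -/
def coadjointCenter : Set (Module.Dual ℝ (GroupLieAlgebra 𝓘(ℝ, EH) H)) :=
  {c | ∀ (h : H) (ξ : GroupLieAlgebra 𝓘(ℝ, EH) H), c (Ad h ξ) = c ξ}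

variable [MulAction H M]

/-- The value at `p` of the fundamental vector field of `ξ`: the differential at `1` of
`h ↦ h • p`, applied to `ξ`, which is the velocity at `t = 0` of `exp (t ξ) • p`. -/
def fundamentalVector (ξ : GroupLieAlgebra 𝓘(ℝ, EH) H) (p : M) : TangentSpace 𝓘(ℝ, E) p :=
  mfderiv 𝓘(ℝ, EH) 𝓘(ℝ, E) (fun h : H => h • p) 1 ξ

variable (E M H) in
/-- The action preserves the complex structure. -/
def PreservesComplexStructure : Prop :=
  ∀ (h : H) (p : M) (v : TangentSpace 𝓘(ℝ, E) p),
    mfderiv 𝓘(ℝ, E) 𝓘(ℝ, E) (fun q : M => h • q) p (complexStructure p v)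
      = complexStructure (h • p) (mfderiv 𝓘(ℝ, E) 𝓘(ℝ, E) (fun q : M => h • q) p v)

/-- A moment map: a smooth map to the dual of the Lie algebra, equivariant for the coadjoint action
`c ↦ c ∘ Ad h⁻¹`, with `-ω(ξ^#, ·) = d⟨μ, ξ⟩` for all `ξ`. -/
structure CalabiYau.IsMomentMap (μ : M → Module.Dual ℝ (GroupLieAlgebra 𝓘(ℝ, EH) H)) : Prop where
  smooth : ∀ ξ : GroupLieAlgebra 𝓘(ℝ, EH) H, ContMDiff 𝓘(ℝ, E) 𝓘(ℝ, ℝ) ∞ (fun p => μ p ξ)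
  equivariant : ∀ (h : H) (p : M) (ξ : GroupLieAlgebra 𝓘(ℝ, EH) H),
    μ (h • p) ξ = μ p (Ad h⁻¹ ξ)
  deriv_eq : ∀ (ξ : GroupLieAlgebra 𝓘(ℝ, EH) H) (p : M) (v : TangentSpace 𝓘(ℝ, E) p),
    mfderiv 𝓘(ℝ, E) 𝓘(ℝ, ℝ) (fun q => μ q ξ) p v = -C.omega p ![fundamentalVector ξ p, v]

/-- The number `c_h` with `L_h^* Ω = c_h Ω`. It is unique since `Ω` does not vanish, and exists when
`M` is connected and `L_h` preserves `I` and `ω`. -/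
def CalabiYau.volumeCharacter (h : H) : ℂ :=
  Classical.epsilon fun z : ℂ => ∀ (p : M) (v : Fin n → TangentSpace 𝓘(ℝ, E) p),
    C.Omega (h • p) (fun i => mfderiv 𝓘(ℝ, E) 𝓘(ℝ, E) (fun q : M => h • q) p (v i))
      = z * C.Omega p v

variable (EH H) in
/-- The functional `a_H = -√-1 (dc)_1` on the Lie algebra, where `c : H → U(1)` is the homomorphism
with `L_h^* Ω = c_h Ω`. As `(dc)_1 ξ` is imaginary, `a_H ξ` is its imaginary part. -/
def CalabiYau.phaseFunctional : Module.Dual ℝ (GroupLieAlgebra 𝓘(ℝ, EH) H) :=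
  Complex.imCLM.toLinearMap.comp
    (mfderiv 𝓘(ℝ, EH) 𝓘(ℝ, ℂ) (fun h : H => C.volumeCharacter h) 1).toLinearMap

/-- The map `(H / K) × V → M`, `(hK, p) ↦ h • p`, where `K` is the isotropy subgroup at every point
of `V`. -/
def orbitMap {K : Subgroup H} {V : Set M} (hK : ∀ p ∈ V, MulAction.stabilizer H p = K) :
    (H ⧸ K) × V → M := fun x =>
  Quotient.liftOn' x.1 (fun h : H => h • (x.2 : M)) (by
    intro a b hab
    have h1 : a⁻¹ * b ∈ K := QuotientGroup.leftRel_apply.mp hab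
    rw [← hK x.2 x.2.2, MulAction.mem_stabilizer_iff, mul_smul, inv_smul_eq_iff] at h1
    exact h1.symm)

end Action

end CalabiYau

end CalabiYauGeometry

end

open CalabiYauGeometry

open scoped Topology

/-! At `p ∈ V` let W be the span of the orbit directions ξ^# and T_pV. Since h'h • p = h' • (h • p),
the image of the differential of the orbit map at (hK, p) is the translate of W by h
(`map_orbitTangentSubspace`). If `H` preserves ω, the metric and Ω, everything therefore reduces to
linear algebra on W.

W is isotropic: μ is constant on `V`, so ω(ξ^#, T_pV) = 0; μ is constant on the orbit because `c` is
coadjoint-fixed, so ω(ξ^#, η^#) = 0; and T_pV lies in the Lagrangian space T_pL. It has dimension n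
because the orbit map is an immersion: a relation ξ^# + v = 0 forces ξ^# = 0 and v = 0 by
transversality, and then the integral curves of the left-invariant field of ξ stay in a coset of `K`
(`mfderiv_mk_eq_zero`).

Perpendicularity splits W as T_pV ⊕ N with N normal to L. The map that is 1 on T_pV and -√-1 on N
carries W isometrically onto T_pL and multiplies Ω by (-√-1)^dim N (`exists_frame_of_lagrangian`).
Hence the angle of W is θ + dim(H/K) π/2, which is constant along `V`.

Invariance comes in two steps. Cartan's formula gives L_ξ ω = d(i_ξ ω) + i_ξ dω = -dd⟨μ, ξ⟩ = 0, so
ω is preserved as `H` is connected (`omega_smul`); with I this preserves the metric. For Ω, the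
normalization gives L_h^* Ω = f Ω with |f| = 1, and f is holomorphic, hence constant on the
connected `M` (`exists_norm_eq_one_volume_ratio`). The resulting character of `H` has derivative
zero at 1, since its real part vanishes by |c_h| = 1 and its imaginary part is `a_H = 0`; so it is
trivial (`Omega_smul`). -/

theorem isManifold_real_of_complex {E : Type*} [NormedAddCommGroup E] [NormedSpace ℂ E]
    {M : Type*} [TopologicalSpace M] [ChartedSpace E M] [IsManifold 𝓘(ℂ, E) ω M] :
    IsManifold 𝓘(ℝ, E) ∞ M := by
  apply isManifold_of_contDiffOn
  intro e e' he he'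
  have h := (contDiffGroupoid ω 𝓘(ℂ, E)).compatible he he'
  rw [contDiffGroupoid, mem_groupoid_of_pregroupoid, contDiffPregroupoid] at h
  have h1 : ContDiffOn ℂ ω ((e.symm.trans e' : E → E)) (e.symm.trans e').source := by
    simpa using h.1
  have h2 := (h1.restrict_scalars ℝ).of_le (n := ω) (m := ∞) (by simp)
  simpa using h2

theorem mfderiv_eq_fderiv_extChartAt {E F : Type*} [NormedAddCommGroup E] [NormedSpace ℝ E]
    [NormedAddCommGroup F] [NormedSpace ℝ F]
    {N Q : Type*} [TopologicalSpace N] [ChartedSpace E N] [TopologicalSpace Q] [ChartedSpace F Q]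
    {f : N → Q} {x : N} (hf : MDifferentiableAt 𝓘(ℝ, E) 𝓘(ℝ, F) f x) :
    mfderiv 𝓘(ℝ, E) 𝓘(ℝ, F) f x =
      (fderiv ℝ (extChartAt 𝓘(ℝ, F) (f x) ∘ f ∘ (extChartAt 𝓘(ℝ, E) x).symm)
        (extChartAt 𝓘(ℝ, E) x x) : E →L[ℝ] F) := by
  rw [hf.mfderiv, ModelWithCorners.range_eq_univ, fderivWithin_univ]
  rfl

/-! ### Local sections of submersions and local retractions of immersions -/

section LocalInverses

variable {E F : Type*} [NormedAddCommGroup E] [NormedSpace ℝ E]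
  [NormedAddCommGroup F] [NormedSpace ℝ F] [FiniteDimensional ℝ F]

theorem ContDiffAt.exists_local_section {f : E → F} {x : E} (hf : ContDiffAt ℝ ∞ f x)
    (hs : Function.Surjective (fderiv ℝ f x)) :
    ∃ s : F → E, ContDiffAt ℝ ∞ s (f x) ∧ s (f x) = x ∧ ∀ᶠ y in 𝓝 (f x), f (s y) = y := by
  have : CompleteSpace F := FiniteDimensional.complete ℝ F
  obtain ⟨R, hR⟩ := (fderiv ℝ f x).toLinearMap.exists_rightInverse_of_surjective
    (LinearMap.range_eq_top.2 hs)
  set R' : F →L[ℝ] E := LinearMap.toContinuousLinearMap R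
  have hRR : ∀ y, fderiv ℝ f x (R' y) = y := fun y => LinearMap.congr_fun hR y
  -- An affine slice through `x` in the directions of a right inverse of the differential: `f ∘ a`
  -- then has the identity as derivative, and the inverse function theorem applies to it.
  set a : F → E := fun y => x + R' (y - f x)
  have ha : ContDiff ℝ ∞ a := by fun_prop
  have hax : a (f x) = x := by simp [a]
  have hg : ContDiffAt ℝ ∞ (f ∘ a) (f x) := by
    apply ContDiffAt.comp
    · rwa [hax]
    · exact ha.contDiffAt
  have ha' : HasFDerivAt a R' (f x) := by
    have h : HasFDerivAt (fun y => R' (y - f x)) R' (f x) := by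
      exact R'.hasFDerivAt.comp (f x) ((hasFDerivAt_id (f x)).sub_const (f x))
    exact h.const_add x
  have hg' : HasFDerivAt (f ∘ a) ((ContinuousLinearEquiv.refl ℝ F : F ≃L[ℝ] F) : F →L[ℝ] F)
      (f x) := by
    have h1 : HasFDerivAt f (fderiv ℝ f x) (a (f x)) := by
      rw [hax]; exact (hf.differentiableAt (by simp)).hasFDerivAt
    have h2 := h1.comp (f x) ha'
    convert h2 using 1
    ext y
    simp [hRR]
  have hn : (∞ : WithTop ℕ∞) ≠ 0 := by simp
  have hst := hg.hasStrictFDerivAt' hg' hn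
  have hga : (f ∘ a) (f x) = f x := by simp [hax]
  refine ⟨a ∘ hg.localInverse hg' hn, ?_, ?_, ?_⟩
  · have h := hg.to_localInverse hg' hn
    rw [hga] at h
    exact ha.contDiffAt.comp _ h
  · have h := hg.localInverse_apply_image hg' hn
    rw [hga] at h
    simp [h, hax]
  · have h := hst.eventually_right_inverse
    rw [hga] at h
    exact h

/-- Composing `f` with a linear left inverse of its differential gives a map with identity
derivative, so the inverse function theorem supplies the retraction. -/
theorem ContDiffAt.exists_local_retraction [FiniteDimensional ℝ E] {f : E → F} {x : E}
    (hf : ContDiffAt ℝ ∞ f x)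
    (hs : Function.Injective (fderiv ℝ f x)) :
    ∃ r : F → E, ContDiffAt ℝ ∞ r (f x) ∧ ∀ᶠ y in 𝓝 x, r (f y) = y := by
  have : CompleteSpace E := FiniteDimensional.complete ℝ E
  obtain ⟨A, hA⟩ := (fderiv ℝ f x).toLinearMap.exists_leftInverse_of_injective
    (LinearMap.ker_eq_bot.2 hs)
  set A' : F →L[ℝ] E := LinearMap.toContinuousLinearMap A
  have hAA : ∀ y, A' (fderiv ℝ f x y) = y := fun y => LinearMap.congr_fun hA y
  have hg : ContDiffAt ℝ ∞ (A' ∘ f) x := A'.contDiff.contDiffAt.comp x hf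
  have hg' : HasFDerivAt (A' ∘ f) ((ContinuousLinearEquiv.refl ℝ E : E ≃L[ℝ] E) : E →L[ℝ] E)
      x := by
    have h2 := A'.hasFDerivAt.comp x (hf.differentiableAt (by simp)).hasFDerivAt
    convert h2 using 1
    ext y
    simp [hAA]
  have hn : (∞ : WithTop ℕ∞) ≠ 0 := by simp
  have hst := hg.hasStrictFDerivAt' hg' hn
  refine ⟨hg.localInverse hg' hn ∘ A', ?_, ?_⟩
  · exact (hg.to_localInverse hg' hn).comp (f x) A'.contDiff.contDiffAt
  · exact hst.eventually_left_inverse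

variable {N Q : Type*} [TopologicalSpace N] [ChartedSpace E N] [IsManifold 𝓘(ℝ, E) ∞ N]
  [TopologicalSpace Q] [ChartedSpace F Q]

theorem ContMDiffAt.exists_local_section {f : N → Q} {x : N}
    (hf : ContMDiffAt 𝓘(ℝ, E) 𝓘(ℝ, F) ∞ f x)
    (hs : Function.Surjective (mfderiv 𝓘(ℝ, E) 𝓘(ℝ, F) f x)) :
    ∃ s : Q → N, ContMDiffAt 𝓘(ℝ, F) 𝓘(ℝ, E) ∞ s (f x) ∧ s (f x) = x ∧
      ∀ᶠ y in 𝓝 (f x), f (s y) = y := by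
  have hd := hf.mdifferentiableAt (by simp)
  rw [mfderiv_eq_fderiv_extChartAt hd] at hs
  have hf1 := (contMDiffAt_iff.1 hf).2
  simp only [ModelWithCorners.range_eq_univ, contDiffWithinAt_univ] at hf1
  obtain ⟨s, hs1, hs2, hs3⟩ := ContDiffAt.exists_local_section hf1 hs
  set ψ := extChartAt 𝓘(ℝ, E) x
  set χ := extChartAt 𝓘(ℝ, F) (f x)
  have hx : (χ ∘ f ∘ ψ.symm) (ψ x) = χ (f x) := by simp [ψ]
  rw [hx] at hs1 hs2 hs3
  have hχ : ContMDiffAt 𝓘(ℝ, F) 𝓘(ℝ, F) ∞ χ (f x) := contMDiffAt_extChartAt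
  have hψ : ContMDiffAt 𝓘(ℝ, E) 𝓘(ℝ, E) ∞ ψ.symm (ψ x) :=
    (contMDiffOn_extChartAt_symm x).contMDiffAt (extChartAt_target_mem_nhds x)
  refine ⟨ψ.symm ∘ s ∘ χ, ?_, ?_, ?_⟩
  · refine ContMDiffAt.comp (f x) (I' := 𝓘(ℝ, E)) ?_ (ContMDiffAt.comp (f x) hs1.contMDiffAt hχ)
    simpa [hs2] using hψ
  · simp [hs2, ψ]
  · have hsψ : ContinuousAt (ψ.symm ∘ s) (χ (f x)) := by
      refine ContinuousAt.comp ?_ hs1.continuousAt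
      rw [hs2]; exact hψ.continuousAt
    have hfs : ContinuousAt (f ∘ ψ.symm ∘ s ∘ χ) (f x) := by
      refine ContinuousAt.comp ?_ (hsψ.comp hχ.continuousAt)
      simpa [hs2, ψ] using hf.continuousAt
    have h1 : ∀ᶠ y in 𝓝 (f x), (f ∘ ψ.symm ∘ s ∘ χ) y ∈ χ.source := by
      apply hfs.eventually_mem
      simp only [Function.comp_apply, hs2]
      simpa [ψ, χ] using extChartAt_source_mem_nhds (I := 𝓘(ℝ, F)) (f x)
    filter_upwards [hχ.continuousAt.eventually hs3, h1,
      extChartAt_source_mem_nhds (I := 𝓘(ℝ, F)) (f x)] with y hy1 hy2 hy3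
    exact χ.injOn hy2 hy3 hy1

theorem ContMDiffAt.exists_local_retraction [FiniteDimensional ℝ E] {f : N → Q} {x : N}
    (hf : ContMDiffAt 𝓘(ℝ, E) 𝓘(ℝ, F) ∞ f x)
    (hs : Function.Injective (mfderiv 𝓘(ℝ, E) 𝓘(ℝ, F) f x)) :
    ∃ r : Q → N, ContMDiffAt 𝓘(ℝ, F) 𝓘(ℝ, E) ∞ r (f x) ∧ ∀ᶠ y in 𝓝 x, r (f y) = y := by
  have hd := hf.mdifferentiableAt (by simp)
  rw [mfderiv_eq_fderiv_extChartAt hd] at hs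
  have hf1 := (contMDiffAt_iff.1 hf).2
  simp only [ModelWithCorners.range_eq_univ, contDiffWithinAt_univ] at hf1
  obtain ⟨s, hs1, hs3⟩ := ContDiffAt.exists_local_retraction hf1 hs
  set ψ := extChartAt 𝓘(ℝ, E) x
  set χ := extChartAt 𝓘(ℝ, F) (f x)
  have hx : (χ ∘ f ∘ ψ.symm) (ψ x) = χ (f x) := by simp [ψ]
  rw [hx] at hs1
  have hsx : s (χ (f x)) = ψ x := by
    have := hs3.self_of_nhds
    rwa [← hx]
  have hχ : ContMDiffAt 𝓘(ℝ, F) 𝓘(ℝ, F) ∞ χ (f x) := contMDiffAt_extChartAt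
  have hψ : ContMDiffAt 𝓘(ℝ, E) 𝓘(ℝ, E) ∞ ψ.symm (ψ x) :=
    (contMDiffOn_extChartAt_symm x).contMDiffAt (extChartAt_target_mem_nhds x)
  refine ⟨ψ.symm ∘ s ∘ χ, ?_, ?_⟩
  · refine ContMDiffAt.comp (f x) (I' := 𝓘(ℝ, E)) ?_ (ContMDiffAt.comp (f x) hs1.contMDiffAt hχ)
    simpa [hsx] using hψ
  · filter_upwards [(continuousAt_extChartAt (I := 𝓘(ℝ, E)) x).eventually hs3,
      extChartAt_source_mem_nhds (I := 𝓘(ℝ, E)) x] with y hy1 hy2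
    have : ψ.symm (ψ y) = y := ψ.left_inv hy2
    simp only [Function.comp_apply] at hy1 ⊢
    change s (χ (f (ψ.symm (ψ y)))) = ψ y at hy1
    rw [this] at hy1
    rw [hy1, this]

end LocalInverses

/-! ### Maps with vanishing derivative are locally constant -/

section Constant

variable {E F : Type*} [NormedAddCommGroup E] [NormedSpace ℝ E]
  [NormedAddCommGroup F] [NormedSpace ℝ F]
  {N : Type*} [TopologicalSpace N] [ChartedSpace E N] [IsManifold 𝓘(ℝ, E) ∞ N]

/-- Read in a chart, a ball around the point is convex, so the mean value inequality applies there.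
-/
theorem eventually_const_of_hasMFDerivAt_zero {f : N → F} {x : N}
    (hf : ∀ᶠ y in 𝓝 x, HasMFDerivAt 𝓘(ℝ, E) 𝓘(ℝ, F) f y 0) : ∀ᶠ y in 𝓝 x, f y = f x := by
  set ψ := extChartAt 𝓘(ℝ, E) x
  have hψ : ContinuousAt ψ.symm (ψ x) := continuousAt_extChartAt_symm x
  have hψx : ψ.symm (ψ x) = x := by simp [ψ]
  have h1 : ∀ᶠ z in 𝓝 (ψ x), HasMFDerivAt 𝓘(ℝ, E) 𝓘(ℝ, F) f (ψ.symm z) 0 ∧ z ∈ ψ.target := by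
    refine Filter.Eventually.and ?_ (extChartAt_target_mem_nhds x)
    apply hψ.eventually (p := fun y => HasMFDerivAt 𝓘(ℝ, E) 𝓘(ℝ, F) f y 0)
    rwa [hψx]
  obtain ⟨ε, hε, hb⟩ := Metric.eventually_nhds_iff_ball.1 h1
  have hd : ∀ z ∈ Metric.ball (ψ x) ε, HasFDerivAt (f ∘ ψ.symm) (0 : E →L[ℝ] F) z := by
    intro z hz
    obtain ⟨h2, h3⟩ := hb z hz
    have h4 : MDifferentiableAt 𝓘(ℝ, E) 𝓘(ℝ, E) ψ.symm z :=
      ((contMDiffOn_extChartAt_symm (n := ∞) x).contMDiffAt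
        ((isOpen_extChartAt_target x).mem_nhds h3)).mdifferentiableAt (by simp)
    have h5 := h2.comp z h4.hasMFDerivAt
    have h6 := hasMFDerivAt_iff_hasFDerivAt.1 h5
    convert! h6 using 1
  have hc : ∀ z ∈ Metric.ball (ψ x) ε, (f ∘ ψ.symm) z = (f ∘ ψ.symm) (ψ x) := by
    intro z hz
    refine (convex_ball (ψ x) ε).is_const_of_fderivWithin_eq_zero (𝕜 := ℝ)
      (fun w hw => (hd w hw).differentiableAt.differentiableWithinAt) ?_ hz
      (Metric.mem_ball_self hε)
    intro w hw
    rw [fderivWithin_of_isOpen Metric.isOpen_ball hw]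
    exact (hd w hw).fderiv
  filter_upwards [(continuousAt_extChartAt (I := 𝓘(ℝ, E)) x).eventually
    (Metric.ball_mem_nhds _ hε), extChartAt_source_mem_nhds (I := 𝓘(ℝ, E)) x] with y hy1 hy2
  have := hc _ hy1
  simp only [Function.comp_apply] at this
  rwa [hψx, show ψ.symm (ψ y) = y from ψ.left_inv hy2] at this

theorem eq_of_hasMFDerivAt_zero [PreconnectedSpace N] {f : N → F}
    (hf : ∀ y, HasMFDerivAt 𝓘(ℝ, E) 𝓘(ℝ, F) f y 0) (x y : N) : f x = f y := by
  have h : IsLocallyConstant f := (IsLocallyConstant.iff_eventually_eq f).2 fun x =>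
    eventually_const_of_hasMFDerivAt_zero (Filter.Eventually.of_forall hf)
  exact h.apply_eq_of_preconnectedSpace x y

theorem curve_eventually_const {γ : ℝ → N} {t₀ : ℝ}
    (hγ : ∀ᶠ t in 𝓝 t₀, HasMFDerivAt 𝓘(ℝ, ℝ) 𝓘(ℝ, E) γ t 0) : ∀ᶠ t in 𝓝 t₀, γ t = γ t₀ := by
  have hc : ContinuousAt γ t₀ := hγ.self_of_nhds.continuousAt
  set ψ := extChartAt 𝓘(ℝ, E) (γ t₀)
  have hs : ∀ᶠ t in 𝓝 t₀, γ t ∈ ψ.source := hc.eventually_mem (extChartAt_source_mem_nhds _)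
  have h1 : ∀ᶠ t in 𝓝 t₀, HasMFDerivAt 𝓘(ℝ, ℝ) 𝓘(ℝ, E) (ψ ∘ γ) t 0 := by
    filter_upwards [hγ, hs] with t ht1 ht2
    have h2 : MDifferentiableAt 𝓘(ℝ, E) 𝓘(ℝ, E) ψ (γ t) :=
      mdifferentiableAt_extChartAt (by simpa [ψ] using ht2)
    have h5 := h2.hasMFDerivAt.comp t ht1
    convert! h5 using 1
    symm
    exact ContinuousLinearMap.comp_zero _
  filter_upwards [eventually_const_of_hasMFDerivAt_zero h1, hs] with t ht1 ht2
  exact ψ.injOn ht2 (mem_extChartAt_source (I := 𝓘(ℝ, E)) (γ t₀)) ht1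

end Constant

theorem comp_smulRight_one_eq_zero_iff {E F : Type*} [NormedAddCommGroup E] [NormedSpace ℝ E]
    [NormedAddCommGroup F] [NormedSpace ℝ F] (A : E →L[ℝ] F) (v : E) :
    A ∘L ((1 : ℝ →L[ℝ] ℝ).smulRight v) = 0 ↔ A v = 0 := by
  refine ⟨fun h => ?_, fun h => ?_⟩
  · simpa using DFunLike.congr_fun h (1 : ℝ)
  · ext
    simp [h]

/-! ### Derivatives of the action -/

section Action

variable {E : Type*} [NormedAddCommGroup E] [NormedSpace ℂ E]
  {M : Type*} [TopologicalSpace M] [ChartedSpace E M]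
  {H : Type*} [Group H] [MulAction H M]

theorem mfderiv_one_smul_action (p : M) (v : TangentSpace 𝓘(ℝ, E) p) :
    mfderiv 𝓘(ℝ, E) 𝓘(ℝ, E) (fun q : M => (1 : H) • q) p v = v := by
  have h1 : (fun q : M => (1 : H) • q) = id := by ext q; simp
  rw [h1, mfderiv_id]
  rfl

variable [TopologicalSpace H]

theorem contMDiff_smul_left (EH : Type*) [NormedAddCommGroup EH] [NormedSpace ℝ EH]
    [ChartedSpace EH H] [ContMDiffSMul 𝓘(ℝ, EH) 𝓘(ℝ, E) ∞ H M]
    (h : H) : ContMDiff 𝓘(ℝ, E) 𝓘(ℝ, E) ∞ (fun q : M => h • q) :=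
  ContMDiffSMul.contMDiff_const_smul (I := 𝓘(ℝ, EH)) h

theorem mdifferentiableAt_smul_left (EH : Type*) [NormedAddCommGroup EH] [NormedSpace ℝ EH]
    [ChartedSpace EH H] [ContMDiffSMul 𝓘(ℝ, EH) 𝓘(ℝ, E) ∞ H M]
    (h : H) (p : M) :
    MDifferentiableAt 𝓘(ℝ, E) 𝓘(ℝ, E) (fun q : M => h • q) p :=
  (contMDiff_smul_left EH h).mdifferentiableAt (by simp)

theorem mfderiv_smul_mul (EH : Type*) [NormedAddCommGroup EH] [NormedSpace ℝ EH]
    [ChartedSpace EH H] [ContMDiffSMul 𝓘(ℝ, EH) 𝓘(ℝ, E) ∞ H M]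
    (g h : H) (p : M) (v : TangentSpace 𝓘(ℝ, E) p) :
    mfderiv 𝓘(ℝ, E) 𝓘(ℝ, E) (fun q : M => (g * h) • q) p v =
      mfderiv 𝓘(ℝ, E) 𝓘(ℝ, E) (fun q : M => g • q) (h • p)
        (mfderiv 𝓘(ℝ, E) 𝓘(ℝ, E) (fun q : M => h • q) p v) := by
  have h1 : (fun q : M => (g * h) • q) = (fun q : M => g • q) ∘ (fun q : M => h • q) := by
    ext q; simp [mul_smul]
  rw [h1]
  exact mfderiv_comp_apply p (mdifferentiableAt_smul_left EH g (h • p))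
    (mdifferentiableAt_smul_left EH h p) v

theorem mfderiv_inv_smul (EH : Type*) [NormedAddCommGroup EH] [NormedSpace ℝ EH]
    [ChartedSpace EH H] [ContMDiffSMul 𝓘(ℝ, EH) 𝓘(ℝ, E) ∞ H M]
    (h : H) (p : M) (v : TangentSpace 𝓘(ℝ, E) p) :
    (mfderiv 𝓘(ℝ, E) 𝓘(ℝ, E) (fun q : M => h⁻¹ • q) (h • p)
      (mfderiv 𝓘(ℝ, E) 𝓘(ℝ, E) (fun q : M => h • q) p v) : E) = v := by
  have h1 := mfderiv_smul_mul EH h⁻¹ h p v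
  rw [← h1, inv_mul_cancel]
  exact mfderiv_one_smul_action p v

theorem mfderiv_smul_injective (EH : Type*) [NormedAddCommGroup EH] [NormedSpace ℝ EH]
    [ChartedSpace EH H] [ContMDiffSMul 𝓘(ℝ, EH) 𝓘(ℝ, E) ∞ H M]
    (h : H) (p : M) :
    Function.Injective (mfderiv 𝓘(ℝ, E) 𝓘(ℝ, E) (fun q : M => h • q) p) := by
  intro v w hvw
  have h1 := mfderiv_inv_smul EH h p v
  have h2 := mfderiv_inv_smul EH h p w
  rw [hvw] at h1
  exact h1.symm.trans h2

variable {EH : Type*} [NormedAddCommGroup EH] [NormedSpace ℝ EH] [ChartedSpace EH H]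

theorem contMDiff_orbit [ContMDiffSMul 𝓘(ℝ, EH) 𝓘(ℝ, E) ∞ H M] (p : M) : ContMDiff 𝓘(ℝ, EH) 𝓘(ℝ, E) ∞ (fun g : H => g • p) :=
  (contMDiff_smul (I := 𝓘(ℝ, EH)) (I' := 𝓘(ℝ, E)) (n := ∞)).comp
    (contMDiff_id.prodMk contMDiff_const)

theorem mdifferentiableAt_orbit [ContMDiffSMul 𝓘(ℝ, EH) 𝓘(ℝ, E) ∞ H M] (h : H) (p : M) :
    MDifferentiableAt 𝓘(ℝ, EH) 𝓘(ℝ, E) (fun g : H => g • p) h :=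
  (contMDiff_orbit p).mdifferentiableAt (by simp)

variable [LieGroup 𝓘(ℝ, EH) ∞ H]

theorem mdifferentiableAt_mul_left_lie (h g : H) :
    MDifferentiableAt 𝓘(ℝ, EH) 𝓘(ℝ, EH) (fun g : H => h * g) g :=
  (contMDiff_mul_left (I := 𝓘(ℝ, EH)) (n := ∞) (a := h)).mdifferentiableAt (by simp)

/-- Left translation by `h⁻¹` brings `X` back to the identity. This lets every tangent vector of `H`
be handled through the Lie algebra. -/
theorem mulInvariantVectorField_surjective (h : H) (X : TangentSpace 𝓘(ℝ, EH) h) :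
    ∃ ξ : GroupLieAlgebra 𝓘(ℝ, EH) H, mulInvariantVectorField ξ h = X := by
  refine ⟨(mfderiv 𝓘(ℝ, EH) 𝓘(ℝ, EH) (fun g : H => h⁻¹ * g) h X : EH), ?_⟩
  have h1 : (fun g : H => h * g) ∘ (fun g : H => h⁻¹ * g) = id := by ext g; simp
  have h2 := mfderiv_comp_apply_of_eq (x := h) (y := (1 : H))
    (mdifferentiableAt_mul_left_lie (EH := EH) h 1)
    (mdifferentiableAt_mul_left_lie (EH := EH) h⁻¹ h) (by simp) X
  rw [h1, mfderiv_id] at h2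
  exact h2.symm

/-- Differentiate (h g) • p = h • (g • p) in g at 1. -/
theorem mfderiv_orbit [ContMDiffSMul 𝓘(ℝ, EH) 𝓘(ℝ, E) ∞ H M] (h : H) (p : M) (ξ : GroupLieAlgebra 𝓘(ℝ, EH) H) :
    mfderiv 𝓘(ℝ, EH) 𝓘(ℝ, E) (fun g : H => g • p) h (mulInvariantVectorField ξ h) =
      (mfderiv 𝓘(ℝ, E) 𝓘(ℝ, E) (fun q : M => h • q) p (fundamentalVector ξ p) : E) := by
  have h1 : (fun g : H => g • p) ∘ (fun g : H => h * g) =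
      (fun q : M => h • q) ∘ (fun g : H => g • p) := by ext g; simp [mul_smul]
  have h2 := mfderiv_comp_apply_of_eq (x := (1 : H)) (y := h)
    (mdifferentiableAt_orbit (E := E) (EH := EH) h p)
    (mdifferentiableAt_mul_left_lie (EH := EH) h 1) (by simp) ξ
  have h3 := mfderiv_comp_apply_of_eq (x := (1 : H)) (y := p)
    (mdifferentiableAt_smul_left EH h p)
    (mdifferentiableAt_orbit (E := E) (EH := EH) (1 : H) p) (by simp) ξ
  rw [h1] at h2
  exact h2.symm.trans h3

/-! ### The orbit map on the homogeneous space -/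

section Quotient

variable [ContMDiffSMul 𝓘(ℝ, EH) 𝓘(ℝ, E) ∞ H M]
  {EV : Type*} [NormedAddCommGroup EV] [NormedSpace ℝ EV]
  {V : Set M} [ChartedSpace EV V]
  {K : Subgroup H} (hK : ∀ p ∈ V, MulAction.stabilizer H p = K)
  {EQ : Type*} [NormedAddCommGroup EQ] [NormedSpace ℝ EQ]
  [ChartedSpace EQ (H ⧸ K)]

/-- An integral curve γ of the left-invariant field of ξ through `h` has γ(t) • p of zero velocity,
so it stays in the coset h K and its projection is constant near 0. No description of the Lie
algebra of `K` is needed. -/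
theorem mfderiv_mk_eq_zero [IsManifold 𝓘(ℝ, E) ∞ M] [CompleteSpace EH] {p : M} (hp : MulAction.stabilizer H p = K) (h : H)
    (hq : MDifferentiableAt 𝓘(ℝ, EH) 𝓘(ℝ, EQ) (QuotientGroup.mk : H → H ⧸ K) h)
    {ξ : GroupLieAlgebra 𝓘(ℝ, EH) H} (hξ : fundamentalVector (E := E) ξ p = 0) :
    mfderiv 𝓘(ℝ, EH) 𝓘(ℝ, EQ) (QuotientGroup.mk : H → H ⧸ K) h
      (mulInvariantVectorField ξ h) = 0 := by
  -- The regularity under which invariant vector fields are known to be differentiable; C¹ fields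
  -- suffice for integral curves.
  have : LieGroup 𝓘(ℝ, EH) (minSmoothness ℝ 3) H := LieGroup.of_le (n := ∞) (by
    simpa using ENat.LEInfty.out)
  have : LieGroup 𝓘(ℝ, EH) 1 H := LieGroup.of_le (n := ∞) (by simp)
  have hs : ContMDiffAt 𝓘(ℝ, EH) 𝓘(ℝ, EH).tangent 1
      (fun g : H => (⟨g, mulInvariantVectorField ξ g⟩ : TangentBundle 𝓘(ℝ, EH) H)) h :=
    (contMDiffAt_mulInvariantVectorField ξ).of_le (by simp)
  obtain ⟨γ, hγ0, hγ⟩ := exists_isMIntegralCurveAt_of_contMDiffAt_boundaryless (0 : ℝ) hs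
  have h1 : ∀ᶠ t in 𝓝 (0 : ℝ), HasMFDerivAt 𝓘(ℝ, ℝ) 𝓘(ℝ, E) (fun t => γ t • p) t 0 := by
    filter_upwards [eventually_mem_nhds_iff.2 hγ] with t ht
    have ht' : HasMFDerivAt 𝓘(ℝ, ℝ) 𝓘(ℝ, EH) γ t
      ((1 : ℝ →L[ℝ] ℝ).smulRight <| mulInvariantVectorField ξ (γ t)) :=
        IsMIntegralCurveAt.hasMFDerivAt ht
    have h2 := (mdifferentiableAt_orbit (E := E) (EH := EH) (γ t) p).hasMFDerivAt.comp t ht'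
    convert! h2 using 1
    have h3 := mfderiv_orbit (E := E) (γ t) p ξ
    rw [hξ] at h3
    have h4 := h3.trans (map_zero _)
    exact ((comp_smulRight_one_eq_zero_iff (E := EH) (F := E)
      (mfderiv 𝓘(ℝ, EH) 𝓘(ℝ, E) (fun g : H => g • p) (γ t)) _).2 h4).symm
  have h2 := curve_eventually_const h1
  have h3 : ∀ᶠ t in 𝓝 (0 : ℝ), ((QuotientGroup.mk : H → H ⧸ K) ∘ γ) t = QuotientGroup.mk h := by
    filter_upwards [h2] with t ht
    rw [Function.comp_apply, eq_comm, QuotientGroup.eq, ← hp, MulAction.mem_stabilizer_iff,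
      mul_smul, inv_smul_eq_iff, ht, hγ0]
  have h4 : HasMFDerivAt 𝓘(ℝ, ℝ) 𝓘(ℝ, EH) γ 0
      ((1 : ℝ →L[ℝ] ℝ).smulRight <| mulInvariantVectorField ξ (γ 0)) :=
        IsMIntegralCurveAt.hasMFDerivAt hγ
  rw [hγ0] at h4
  have h5 := HasMFDerivAt.comp (g := (QuotientGroup.mk : H → H ⧸ K)) 0
    (by rw [hγ0]; exact hq.hasMFDerivAt) h4
  have h6 : HasMFDerivAt 𝓘(ℝ, ℝ) 𝓘(ℝ, EQ) ((QuotientGroup.mk : H → H ⧸ K) ∘ γ) 0 0 :=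
    (hasMFDerivAt_const (QuotientGroup.mk h : H ⧸ K) (0 : ℝ)).congr_of_eventuallyEq h3
  have h7 := hasMFDerivAt_unique h5 h6
  have h8 := (comp_smulRight_one_eq_zero_iff (E := EH) (F := EQ)
      (mfderiv 𝓘(ℝ, EH) 𝓘(ℝ, EQ) (QuotientGroup.mk : H → H ⧸ K) h) _).1 h7
  exact h8

/-- With a local section s of the projection `H → H ⧸ K`, the orbit map is (x, p) ↦ s(x) • p near
the given point. -/
theorem contMDiff_orbitMap [FiniteDimensional ℝ EQ]
    (hV : ContMDiff 𝓘(ℝ, EV) 𝓘(ℝ, E) ∞ (Subtype.val : V → M))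
    (hQ : IsSmoothSubmersion 𝓘(ℝ, EH) 𝓘(ℝ, EQ) (QuotientGroup.mk : H → H ⧸ K)) :
    ContMDiff (𝓘(ℝ, EQ).prod 𝓘(ℝ, EV)) 𝓘(ℝ, E) ∞ (orbitMap hK) := by
  rintro ⟨x, p⟩
  obtain ⟨h, rfl⟩ := QuotientGroup.mk_surjective x
  obtain ⟨s, hs, hsx, hsy⟩ := (hQ.1 h).exists_local_section (hQ.2 h)
  have h1 : ContMDiffAt (𝓘(ℝ, EQ).prod 𝓘(ℝ, EV)) 𝓘(ℝ, E) ∞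
      (fun z : (H ⧸ K) × V => s z.1 • (z.2 : M)) ((QuotientGroup.mk h : H ⧸ K), p) := by
    refine ContMDiffAt.smul (I := 𝓘(ℝ, EH)) (f := fun z : (H ⧸ K) × V => s z.1)
      (g := fun z : (H ⧸ K) × V => (z.2 : M)) ?_ ?_
    · exact hs.comp ((QuotientGroup.mk h : H ⧸ K), p) contMDiffAt_fst
    · exact (hV p).comp ((QuotientGroup.mk h : H ⧸ K), p) contMDiffAt_snd
  refine h1.congr_of_eventuallyEq ?_
  have h2 : ∀ᶠ z : (H ⧸ K) × V in 𝓝 ((QuotientGroup.mk h : H ⧸ K), p),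
      QuotientGroup.mk (s z.1) = z.1 :=
    (continuous_fst.tendsto ((QuotientGroup.mk h : H ⧸ K), p)).eventually hsy
  filter_upwards [h2] with z hz
  conv_lhs => rw [show z = (QuotientGroup.mk (s z.1), z.2) from Prod.ext hz.symm rfl]
  rfl

/-- Split the derivative into its two partial derivatives: the first factor composed with the
projection is the orbit map g ↦ g • p, the second is p ↦ h • p on `V`. Both are translates by h of
derivatives at 1. -/
theorem mfderiv_orbitMap [FiniteDimensional ℝ EQ]
    (hV : ContMDiff 𝓘(ℝ, EV) 𝓘(ℝ, E) ∞ (Subtype.val : V → M))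
    (hQ : IsSmoothSubmersion 𝓘(ℝ, EH) 𝓘(ℝ, EQ) (QuotientGroup.mk : H → H ⧸ K))
    (h : H) (p : V) (ξ : GroupLieAlgebra 𝓘(ℝ, EH) H) (v : TangentSpace 𝓘(ℝ, EV) p) :
    mfderiv (𝓘(ℝ, EQ).prod 𝓘(ℝ, EV)) 𝓘(ℝ, E) (orbitMap hK) ((QuotientGroup.mk h : H ⧸ K), p)
      (mfderiv 𝓘(ℝ, EH) 𝓘(ℝ, EQ) (QuotientGroup.mk : H → H ⧸ K) h
        (mulInvariantVectorField ξ h), v) =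
      mfderiv 𝓘(ℝ, E) 𝓘(ℝ, E) (fun q : M => h • q) (p : M)
        (fundamentalVector ξ (p : M) +
          mfderiv 𝓘(ℝ, EV) 𝓘(ℝ, E) (Subtype.val : V → M) p v) := by
  have hsm := contMDiff_orbitMap hK hV hQ
  have hd := hsm.mdifferentiableAt (x := ((QuotientGroup.mk h : H ⧸ K), p)) (by simp)
  have hq : MDifferentiableAt 𝓘(ℝ, EH) 𝓘(ℝ, EQ) (QuotientGroup.mk : H → H ⧸ K) h :=
    hQ.1.mdifferentiableAt (by simp)
  have hv : MDifferentiableAt 𝓘(ℝ, EV) 𝓘(ℝ, E) (Subtype.val : V → M) p :=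
    hV.mdifferentiableAt (by simp)
  have h1 : MDifferentiableAt 𝓘(ℝ, EQ) 𝓘(ℝ, E) (fun x : H ⧸ K => orbitMap hK (x, p))
      (QuotientGroup.mk h) := hd.comp (QuotientGroup.mk h : H ⧸ K)
        (mdifferentiableAt_id.prodMk mdifferentiableAt_const)
  have h2 := mfderiv_comp_apply h h1 hq (mulInvariantVectorField ξ h)
  have h3 := mfderiv_comp_apply p (mdifferentiableAt_smul_left EH h (p : M)) hv v
  refine (mfderiv_prod_eq_add_apply hd).trans ?_
  exact (congrArg₂ (fun a b : E => a + b) (h2.symm.trans (mfderiv_orbit h (p : M) ξ)) h3).trans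
    (map_add (mfderiv 𝓘(ℝ, E) 𝓘(ℝ, E) (fun q : M => h • q) (p : M)) _ _).symm

end Quotient

end Action

/-! ### Cartan's formula in a vector space -/

section FlatCalculus

variable {P E G : Type*} [NormedAddCommGroup P] [NormedSpace ℝ P]
  [NormedAddCommGroup E] [NormedSpace ℝ E] [NormedAddCommGroup G] [NormedSpace ℝ G]
  {F : P × E → E} {s₀ : P} {x₀ : E}

theorem differentiableAt_pullback_family {k : ℕ} {α : E → E [⋀^Fin k]→L[ℝ] G}
    (hF : ContDiffAt ℝ 2 F (s₀, x₀)) (hα : DifferentiableAt ℝ α (F (s₀, x₀))) (u : Fin k → E) :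
    DifferentiableAt ℝ (fun s => α (F (s, x₀)) (fun i => fderiv ℝ F (s, x₀) (0, u i))) s₀ := by
  have hi : DifferentiableAt ℝ (fun s : P => (s, x₀)) s₀ := by fun_prop
  have hD : DifferentiableAt ℝ (fderiv ℝ F) (s₀, x₀) :=
    (hF.fderiv_right (m := 1) (by norm_num)).differentiableAt (by simp)
  refine DifferentiableAt.continuousAlternatingMap_apply (f := fun s => α (F (s, x₀)))
    (g := fun i s => fderiv ℝ F (s, x₀) (0, u i)) ?_ ?_
  · exact hα.comp s₀ ((hF.differentiableAt (by simp)).comp s₀ hi)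
  · intro i
    exact (hD.comp s₀ hi).clm_apply (differentiableAt_const _)

/-- With X(y) the derivative of F in the parameter direction σ, this is L_X α = d(i_X α) + i_X dα =
-ddm + 0 at the parameter `s₀`, where F is the identity. It is proved by expanding both sides and
using the symmetry of the second derivatives of F and m. F need not come from a flow, only its
first-order variation matters. -/
theorem fderiv_pullback_two_form_eq_zero {α : E → E [⋀^Fin 2]→L[ℝ] ℝ} {m : E → ℝ} {σ : P}
    (hF : ContDiffAt ℝ 2 F (s₀, x₀)) (hF₀ : ∀ᶠ y in 𝓝 x₀, F (s₀, y) = y)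
    (hα : DifferentiableAt ℝ α x₀) (hcl : extDeriv α x₀ = 0) (hm : ContDiffAt ℝ 2 m x₀)
    (hmα : ∀ᶠ y in 𝓝 x₀, ∀ v, fderiv ℝ m y v = -α y ![fderiv ℝ F (s₀, y) (σ, 0), v])
    (u : Fin 2 → E) :
    fderiv ℝ (fun s => α (F (s, x₀)) (fun i => fderiv ℝ F (s, x₀) (0, u i))) s₀ σ = 0 := by
  have hFx : F (s₀, x₀) = x₀ := hF₀.self_of_nhds
  have hd : DifferentiableAt ℝ F (s₀, x₀) := hF.differentiableAt (by simp)
  have hi : HasFDerivAt (fun s : P => (s, x₀)) (ContinuousLinearMap.inl ℝ P E) s₀ :=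
    hasFDerivAt_prodMk_left s₀ x₀
  have hj : HasFDerivAt (fun y : E => (s₀, y)) (ContinuousLinearMap.inr ℝ P E) x₀ :=
    hasFDerivAt_prodMk_right s₀ x₀
  have hD : DifferentiableAt ℝ (fderiv ℝ F) (s₀, x₀) :=
    (hF.fderiv_right (m := 1) (by norm_num)).differentiableAt (by simp)
  set D := fderiv ℝ F (s₀, x₀)
  set D2 := fderiv ℝ (fderiv ℝ F) (s₀, x₀)
  have hsymm : ∀ v w, D2 v w = D2 w v := fun v w =>
    (hF.isSymmSndFDerivAt (by simp)).eq v w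
  set a := D (σ, 0)
  have hDu : ∀ v, D (0, v) = v := by
    intro v
    have h1 : HasFDerivAt (fun y => F (s₀, y)) (D ∘L ContinuousLinearMap.inr ℝ P E) x₀ :=
      hd.hasFDerivAt.comp x₀ hj
    have h2 : HasFDerivAt (fun y => F (s₀, y)) (ContinuousLinearMap.id ℝ E) x₀ :=
      (hasFDerivAt_id x₀).congr_of_eventuallyEq hF₀
    simpa using DFunLike.congr_fun (h1.unique h2) v
  have hαF : DifferentiableAt ℝ α (F (s₀, x₀)) := by rwa [hFx]
  have hf : HasFDerivAt (fun s => α (F (s, x₀)))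
      (fderiv ℝ α x₀ ∘L (D ∘L ContinuousLinearMap.inl ℝ P E)) s₀ := by
    have := hαF.hasFDerivAt.comp s₀ (hd.hasFDerivAt.comp s₀ hi)
    rwa [hFx] at this
  have hg : ∀ w : P × E, HasFDerivAt (fun s => fderiv ℝ F (s, x₀) w)
      ((D2 ∘L ContinuousLinearMap.inl ℝ P E).flip w) s₀ := by
    intro w
    have := (hD.hasFDerivAt.comp s₀ hi).clm_apply (hasFDerivAt_const w s₀)
    simpa using this
  have hg' : ∀ w : P × E, HasFDerivAt (fun y => fderiv ℝ F (s₀, y) w)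
      ((D2 ∘L ContinuousLinearMap.inr ℝ P E).flip w) x₀ := by
    intro w
    have := (hD.hasFDerivAt.comp x₀ hj).clm_apply (hasFDerivAt_const w x₀)
    simpa using this
  set b : E → E := fun w => D2 (σ, 0) (0, w)
  have hLHS : fderiv ℝ (fun s => α (F (s, x₀)) (fun i => fderiv ℝ F (s, x₀) (0, u i))) s₀ σ =
      fderiv ℝ α x₀ a ![u 0, u 1] + α x₀ ![b (u 0), u 1] + α x₀ ![u 0, b (u 1)] := by
    rw [fderiv_continuousAlternatingMap_apply_apply (f := fun s => α (F (s, x₀)))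
      (g := fun i s => fderiv ℝ F (s, x₀) (0, u i)) hf.differentiableAt
      (fun i => (hg _).differentiableAt), hf.fderiv, Fin.sum_univ_two, ← add_assoc]
    have e1 : (fun i => D (0, u i)) = ![u 0, u 1] := by
      ext i; fin_cases i <;> simp [hDu]
    have e2 : Function.update ![u 0, u 1] 0 (b (u 0)) = ![b (u 0), u 1] := by
      ext i; fin_cases i <;> simp
    have e3 : Function.update ![u 0, u 1] 1 (b (u 1)) = ![u 0, b (u 1)] := by
      ext i; fin_cases i <;> simp
    rw [(hg (0, u 0)).fderiv, (hg (0, u 1)).fderiv]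
    change fderiv ℝ α x₀ a (fun i => D (0, u i)) +
      α (F (s₀, x₀)) (Function.update (fun i => D (0, u i)) 0 (b (u 0))) +
      α (F (s₀, x₀)) (Function.update (fun i => D (0, u i)) 1 (b (u 1))) = _
    rw [e1, e2, e3, hFx]
  -- Differentiate the equation dm = -α(X, ·). The derivative of X along w is the mixed derivative
  -- `b w` by `hsymm`, the same term that arises in `hLHS` from varying the differential of F.
  have hN : ∀ w v, fderiv ℝ (fderiv ℝ m) x₀ w v =
      -(fderiv ℝ α x₀ w ![a, v] + α x₀ ![b w, v]) := by
    intro w v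
    have hdm : DifferentiableAt ℝ (fderiv ℝ m) x₀ :=
      (hm.fderiv_right (m := 1) (by norm_num)).differentiableAt (by simp)
    have h1 : HasFDerivAt (fun y => fderiv ℝ m y v) ((fderiv ℝ (fderiv ℝ m) x₀).flip v) x₀ := by
      have := hdm.hasFDerivAt.clm_apply (hasFDerivAt_const v x₀)
      simpa using this
    set g : Fin 2 → E → E := fun i y => ![fderiv ℝ F (s₀, y) (σ, 0), v] i
    have hgd : ∀ i, DifferentiableAt ℝ (g i) x₀ := by
      intro i
      fin_cases i
      · exact (hg' (σ, 0)).differentiableAt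
      · exact differentiableAt_const v
    have h2 : (fun y => fderiv ℝ m y v) =ᶠ[𝓝 x₀] fun y => -(α y (fun i => g i y)) := by
      filter_upwards [hmα] with y hy
      rw [hy v]
    have h3 := h2.fderiv_eq (𝕜 := ℝ)
    rw [h1.fderiv, fderiv_fun_neg] at h3
    have h4 : fderiv ℝ (fderiv ℝ m) x₀ w v = -(fderiv ℝ (fun y => α y (fun i => g i y)) x₀ w) :=
      DFunLike.congr_fun h3 w
    rw [fderiv_continuousAlternatingMap_apply_apply (f := α) (g := g) hα hgd, Fin.sum_univ_two] at h4
    have e0 : fderiv ℝ (g 0) x₀ w = b w := by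
      change fderiv ℝ (fun y => fderiv ℝ F (s₀, y) (σ, 0)) x₀ w = _
      rw [(hg' (σ, 0)).fderiv]
      exact hsymm _ _
    have e1 : fderiv ℝ (g 1) x₀ w = 0 := by
      change fderiv ℝ (fun y => v) x₀ w = _
      simp
    have e2 : (fun i => g i x₀) = ![a, v] := rfl
    have e3 : Function.update ![a, v] 0 (b w) = ![b w, v] := by
      ext i; fin_cases i <;> simp
    have e4 : α x₀ (Function.update ![a, v] 1 (0 : E)) = 0 :=
      (α x₀).map_coord_zero (m := Function.update ![a, v] 1 (0 : E)) (1 : Fin 2) (by simp)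
    rw [e0, e1, e2, e3, e4, add_zero] at h4
    exact h4
  have hNs : fderiv ℝ (fderiv ℝ m) x₀ (u 0) (u 1) = fderiv ℝ (fderiv ℝ m) x₀ (u 1) (u 0) :=
    (hm.isSymmSndFDerivAt (by simp)).eq _ _
  have hc : fderiv ℝ α x₀ a ![u 0, u 1] - fderiv ℝ α x₀ (u 0) ![a, u 1] +
      fderiv ℝ α x₀ (u 1) ![a, u 0] = 0 := by
    have h1 := extDeriv_apply hα ![a, u 0, u 1]
    rw [hcl, Fin.sum_univ_three] at h1
    have e0 : Fin.removeNth 0 ![a, u 0, u 1] = ![u 0, u 1] := by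
      ext i; fin_cases i <;> rfl
    have e1 : Fin.removeNth 1 ![a, u 0, u 1] = ![a, u 1] := by
      ext i; fin_cases i <;> rfl
    have e2 : Fin.removeNth 2 ![a, u 0, u 1] = ![a, u 0] := by
      ext i; fin_cases i <;> rfl
    have e3 : ∀ v w, fderiv ℝ (fun y => α y v) x₀ w = fderiv ℝ α x₀ w v := fun v w => by
      have := ((ContinuousAlternatingMap.apply ℝ E ℝ v).hasFDerivAt.comp x₀ hα.hasFDerivAt).fderiv
      exact DFunLike.congr_fun this w
    rw [e0, e1, e2] at h1
    simp [e3] at h1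
    linarith
  have hsw : α x₀ ![u 0, b (u 1)] = -α x₀ ![b (u 1), u 0] := by
    have h1 := (α x₀).toAlternatingMap.map_swap ![b (u 1), u 0] (i := 0) (j := 1) (by simp)
    rw [← show α x₀ (![b (u 1), u 0] ∘ Equiv.swap 0 1) = -α x₀ ![b (u 1), u 0] from h1]
    congr 1
    ext i; fin_cases i <;> simp
  -- Symmetry of the Hessian of m relates the `b` terms to derivatives of α along `u 0` and `u 1`;
  -- closedness `hc` trades these for the derivative along `a`. What remains is `hLHS`.
  rw [hN, hN] at hNs
  rw [hLHS, hsw]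
  linarith

end FlatCalculus

/-! ### Differential forms and derivatives in fixed charts -/

section ChartCalculus

variable {E : Type*} [NormedAddCommGroup E] [NormedSpace ℝ E]
  {M : Type*} [TopologicalSpace M] [ChartedSpace E M]
  {G : Type*} [NormedAddCommGroup G] [NormedSpace ℝ G]

/-- All tangent spaces are the model space `E`, so vectors at propositionally equal base points can
be compared directly; this replaces dependent rewriting of the base point. -/
theorem form_congr_point {k : ℕ} (α : ∀ p : M, TangentSpace 𝓘(ℝ, E) p [⋀^Fin k]→L[ℝ] G)
    {a b : M} (hab : a = b) {v w : Fin k → E} (hvw : ∀ i, v i = w i) :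
    (α a : E [⋀^Fin k]→L[ℝ] G) v = (α b : E [⋀^Fin k]→L[ℝ] G) w := by
  subst hab
  rw [show v = w from funext hvw]

variable [IsManifold 𝓘(ℝ, E) ∞ M]

theorem mdifferentiableAt_extChartAt_symm_of_mem {x : M} {y : E}
    (hy : y ∈ (extChartAt 𝓘(ℝ, E) x).target) :
    MDifferentiableAt 𝓘(ℝ, E) 𝓘(ℝ, E) (extChartAt 𝓘(ℝ, E) x).symm y :=
  ((contMDiffOn_extChartAt_symm (n := ∞) x).contMDiffAt
    ((isOpen_extChartAt_target x).mem_nhds hy)).mdifferentiableAt (by simp)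

theorem mdifferentiableAt_extChartAt_of_mem {x q : M}
    (hq : q ∈ (extChartAt 𝓘(ℝ, E) x).source) :
    MDifferentiableAt 𝓘(ℝ, E) 𝓘(ℝ, E) (extChartAt 𝓘(ℝ, E) x) q :=
  mdifferentiableAt_extChartAt (by simpa using hq)

/-- The manifold derivative at `q` uses the preferred charts at `q` and `L q`, which vary with `q`.
Near `q` the map factors through the fixed charts at `x` and `x'`, and the chain rule moves the
computation there. -/
theorem mfderiv_eq_conj_chart {L : M → M} {q x x' : M}
    (hL : MDifferentiableAt 𝓘(ℝ, E) 𝓘(ℝ, E) L q)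
    (hq : q ∈ (extChartAt 𝓘(ℝ, E) x).source) (hLq : L q ∈ (extChartAt 𝓘(ℝ, E) x').source)
    (v : TangentSpace 𝓘(ℝ, E) q) :
    (mfderiv 𝓘(ℝ, E) 𝓘(ℝ, E) L q v : E) =
      mfderiv 𝓘(ℝ, E) 𝓘(ℝ, E) (extChartAt 𝓘(ℝ, E) x').symm (extChartAt 𝓘(ℝ, E) x' (L q))
        (fderiv ℝ (extChartAt 𝓘(ℝ, E) x' ∘ L ∘ (extChartAt 𝓘(ℝ, E) x).symm)
          (extChartAt 𝓘(ℝ, E) x q)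
          (mfderiv 𝓘(ℝ, E) 𝓘(ℝ, E) (extChartAt 𝓘(ℝ, E) x) q v)) := by
  set ψ := extChartAt 𝓘(ℝ, E) x
  set χ := extChartAt 𝓘(ℝ, E) x'
  have h1 : MDifferentiableAt 𝓘(ℝ, E) 𝓘(ℝ, E) ψ q := mdifferentiableAt_extChartAt_of_mem hq
  have hψq : ψ.symm (ψ q) = q := ψ.left_inv hq
  have h2 : MDifferentiableAt 𝓘(ℝ, E) 𝓘(ℝ, E) (χ ∘ L ∘ ψ.symm) (ψ q) := by
    have a1 : MDifferentiableAt 𝓘(ℝ, E) 𝓘(ℝ, E) ψ.symm (ψ q) :=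
      mdifferentiableAt_extChartAt_symm_of_mem (ψ.map_source hq)
    have a2 : MDifferentiableAt 𝓘(ℝ, E) 𝓘(ℝ, E) (L ∘ ψ.symm) (ψ q) :=
      MDifferentiableAt.comp_of_eq _ hL a1 hψq
    exact MDifferentiableAt.comp_of_eq (y := L q) _
      (mdifferentiableAt_extChartAt_of_mem hLq) a2 (by simp [hψq])
  have h3 : MDifferentiableAt 𝓘(ℝ, E) 𝓘(ℝ, E) χ.symm (χ (L q)) :=
    mdifferentiableAt_extChartAt_symm_of_mem (χ.map_source hLq)
  have hev : L =ᶠ[𝓝 q] χ.symm ∘ ((χ ∘ L ∘ ψ.symm) ∘ ψ) := by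
    filter_upwards [extChartAt_source_mem_nhds' hq,
      hL.continuousAt.eventually_mem (extChartAt_source_mem_nhds' hLq)] with z hz1 hz2
    simp only [Function.comp_apply]
    rw [show ψ.symm (ψ z) = z from ψ.left_inv hz1, χ.left_inv hz2]
  have h4 : ((χ ∘ L ∘ ψ.symm) ∘ ψ) q = χ (L q) := by simp [hψq]
  have h5 := mfderiv_comp_apply_of_eq (x := q) (y := χ (L q)) h3 (h2.comp q h1) h4 v
  have h6 := mfderiv_comp_apply q h2 h1 v
  rw [mfderiv_eq_fderiv] at h6
  rw [hev.mfderiv_eq]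
  refine h5.trans ?_
  exact congrArg (mfderiv 𝓘(ℝ, E) 𝓘(ℝ, E) χ.symm (χ (L q))) h6

theorem form_mfderiv_eq_formInChart {k : ℕ}
    (α : ∀ p : M, TangentSpace 𝓘(ℝ, E) p [⋀^Fin k]→L[ℝ] G) {L : M → M} {q x x' : M}
    (hL : MDifferentiableAt 𝓘(ℝ, E) 𝓘(ℝ, E) L q)
    (hq : q ∈ (extChartAt 𝓘(ℝ, E) x).source) (hLq : L q ∈ (extChartAt 𝓘(ℝ, E) x').source)
    (v : Fin k → TangentSpace 𝓘(ℝ, E) q) :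
    α (L q) (fun i => mfderiv 𝓘(ℝ, E) 𝓘(ℝ, E) L q (v i)) =
      formInChart α x' (extChartAt 𝓘(ℝ, E) x' (L q)) (fun i =>
        fderiv ℝ (extChartAt 𝓘(ℝ, E) x' ∘ L ∘ (extChartAt 𝓘(ℝ, E) x).symm)
          (extChartAt 𝓘(ℝ, E) x q)
          (mfderiv 𝓘(ℝ, E) 𝓘(ℝ, E) (extChartAt 𝓘(ℝ, E) x) q (v i))) := by
  refine form_congr_point α ((extChartAt 𝓘(ℝ, E) x').left_inv hLq).symm (fun i => ?_)
  exact mfderiv_eq_conj_chart hL hq hLq (v i)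

end ChartCalculus

/-! ### The action and pulled-back forms in charts -/

section ActionChart

variable {E : Type*} [NormedAddCommGroup E] [NormedSpace ℂ E]
  {M : Type*} [TopologicalSpace M] [ChartedSpace E M]
  {G : Type*} [NormedAddCommGroup G] [NormedSpace ℝ G]
  {EH : Type*} [NormedAddCommGroup EH] [NormedSpace ℝ EH]
  {H : Type*} [TopologicalSpace H] [ChartedSpace EH H] [Group H] [MulAction H M]

variable (E EH H) in
/-- The action in the charts around `1` and `p`. -/
noncomputable def actionInChart (p : M) : EH × E → E := fun z =>
  extChartAt 𝓘(ℝ, E) p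
    ((extChartAt 𝓘(ℝ, EH) (1 : H)).symm z.1 • (extChartAt 𝓘(ℝ, E) p).symm z.2)

theorem differentiableAt_formInChart {k : ℕ}
    {α : ∀ p : M, TangentSpace 𝓘(ℝ, E) p [⋀^Fin k]→L[ℝ] G} (hα : IsSmoothForm α) (p : M)
    {y : E} (hy : y ∈ (extChartAt 𝓘(ℝ, E) p).target) :
    DifferentiableAt ℝ (formInChart α p) y :=
  ((hα p).contDiffAt ((isOpen_extChartAt_target p).mem_nhds hy)).differentiableAt (by simp)

theorem actionInChart_one (p : M) {y : E} (hy : y ∈ (extChartAt 𝓘(ℝ, E) p).target) :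
    actionInChart E EH H p (extChartAt 𝓘(ℝ, EH) (1 : H) 1, y) = y := by
  have h1 : (extChartAt 𝓘(ℝ, EH) (1 : H)).symm (extChartAt 𝓘(ℝ, EH) (1 : H) 1) = 1 := by simp
  simp only [actionInChart]
  rw [h1, one_smul, (extChartAt 𝓘(ℝ, E) p).right_inv hy]

variable [IsManifold 𝓘(ℝ, E) ∞ M] [LieGroup 𝓘(ℝ, EH) ∞ H]
  [ContMDiffSMul 𝓘(ℝ, EH) 𝓘(ℝ, E) ∞ H M]

theorem contDiffAt_actionInChart (p : M) :
    ContDiffAt ℝ ∞ (actionInChart E EH H p)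
      (extChartAt 𝓘(ℝ, EH) (1 : H) 1, extChartAt 𝓘(ℝ, E) p p) := by
  set κ := extChartAt 𝓘(ℝ, EH) (1 : H)
  set ψ := extChartAt 𝓘(ℝ, E) p
  have h1 : κ.symm (κ 1) = 1 := by simp [κ]
  have h2 : ψ.symm (ψ p) = p := by simp [ψ]
  rw [← contMDiffAt_iff_contDiffAt]
  refine ContMDiffAt.comp (I' := 𝓘(ℝ, E)) (g := ψ)
    (f := fun z : EH × E => κ.symm z.1 • ψ.symm z.2) (κ 1, ψ p) ?_ ?_
  · simp only [h1, h2, one_smul]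
    exact contMDiffAt_extChartAt
  · refine ContMDiffAt.smul (I := 𝓘(ℝ, EH)) (f := fun z : EH × E => κ.symm z.1)
      (g := fun z : EH × E => ψ.symm z.2) ?_ ?_
    · refine ContMDiffAt.comp (I' := 𝓘(ℝ, EH)) (g := κ.symm) (f := Prod.fst) (κ 1, ψ p) ?_
        contDiffAt_fst.contMDiffAt
      exact (contMDiffOn_extChartAt_symm (I := 𝓘(ℝ, EH)) (n := ∞) (1 : H)).contMDiffAt
        (extChartAt_target_mem_nhds (I := 𝓘(ℝ, EH)) (1 : H))
    · refine ContMDiffAt.comp (I' := 𝓘(ℝ, E)) (g := ψ.symm) (f := Prod.snd) (κ 1, ψ p) ?_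
        contDiffAt_snd.contMDiffAt
      exact (contMDiffOn_extChartAt_symm (I := 𝓘(ℝ, E)) (n := ∞) p).contMDiffAt
        (extChartAt_target_mem_nhds (I := 𝓘(ℝ, E)) p)

/-- For h near 1 the pull-back by h, evaluated at `p`, becomes a pull-back by a family of maps of a
vector space, to which the flat calculus applies. -/
theorem eventually_form_smul_eq {k : ℕ}
    (α : ∀ p : M, TangentSpace 𝓘(ℝ, E) p [⋀^Fin k]→L[ℝ] G) (p : M)
    (v : Fin k → TangentSpace 𝓘(ℝ, E) p) :
    ∀ᶠ h : H in 𝓝 1, α (h • p) (fun i => mfderiv 𝓘(ℝ, E) 𝓘(ℝ, E) (fun q : M => h • q) p (v i)) =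
      formInChart α p (actionInChart E EH H p
          (extChartAt 𝓘(ℝ, EH) (1 : H) h, extChartAt 𝓘(ℝ, E) p p))
        (fun i => fderiv ℝ (actionInChart E EH H p)
          (extChartAt 𝓘(ℝ, EH) (1 : H) h, extChartAt 𝓘(ℝ, E) p p)
          (0, mfderiv 𝓘(ℝ, E) 𝓘(ℝ, E) (extChartAt 𝓘(ℝ, E) p) p (v i))) := by
  set κ := extChartAt 𝓘(ℝ, EH) (1 : H)
  set ψ := extChartAt 𝓘(ℝ, E) p
  have h1 : ∀ᶠ z in 𝓝 (κ 1, ψ p), DifferentiableAt ℝ (actionInChart E EH H p) z :=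
    ((contDiffAt_actionInChart (EH := EH) (H := H) p).of_le
      (m := 1) (by simp)).eventually (by simp) |>.mono fun z hz => hz.differentiableAt (by simp)
  have h2 : ContinuousAt (fun h : H => (κ h, ψ p)) 1 :=
    (continuousAt_extChartAt (I := 𝓘(ℝ, EH)) (1 : H)).prodMk continuousAt_const
  have h3 : ContinuousAt (fun h : H => h • p) 1 := (contMDiff_orbit (EH := EH) (E := E) p).continuous.continuousAt
  filter_upwards [h2.eventually h1, extChartAt_source_mem_nhds (I := 𝓘(ℝ, EH)) (1 : H),
    h3.eventually_mem (by rw [one_smul]; exact extChartAt_source_mem_nhds (I := 𝓘(ℝ, E)) p)]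
    with h hd hs hp
  have hκ : κ.symm (κ h) = h := κ.left_inv hs
  have hψ : ψ.symm (ψ p) = p := by simp [ψ]
  refine (form_mfderiv_eq_formInChart α (L := fun q : M => h • q) (q := p) (x := p) (x' := p)
    (mdifferentiableAt_smul_left EH h p) (mem_extChartAt_source p) hp v).trans ?_
  have h4 : actionInChart E EH H p (κ h, ψ p) = ψ (h • p) := by
    simp only [actionInChart]
    rw [hκ, hψ]
  have h5 : (ψ ∘ (fun q : M => h • q) ∘ ψ.symm) =
      fun y => actionInChart E EH H p (κ h, y) := by
    ext y
    simp only [actionInChart, Function.comp_apply]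
    rw [hκ]
  have h6 : ∀ w, fderiv ℝ (fun y => actionInChart E EH H p (κ h, y)) (ψ p) w =
      fderiv ℝ (actionInChart E EH H p) (κ h, ψ p) (0, w) := by
    intro w
    have := hd.hasFDerivAt.comp (ψ p) (hasFDerivAt_prodMk_right (κ h) (ψ p))
    exact DFunLike.congr_fun this.fderiv w
  rw [h4]
  refine congrArg (formInChart α p (ψ (h • p)) : (Fin k → E) → G) (funext fun i => ?_)
  refine Eq.trans ?_ (h6 (mfderiv 𝓘(ℝ, E) 𝓘(ℝ, E) ψ p (v i)))
  rw [← h5]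

theorem mdifferentiableAt_form_smul {k : ℕ}
    {α : ∀ p : M, TangentSpace 𝓘(ℝ, E) p [⋀^Fin k]→L[ℝ] G}
    (hα : ∀ p : M, DifferentiableAt ℝ (formInChart α p) (extChartAt 𝓘(ℝ, E) p p)) (p : M)
    (v : Fin k → TangentSpace 𝓘(ℝ, E) p) :
    MDifferentiableAt 𝓘(ℝ, EH) 𝓘(ℝ, G) (fun h : H => α (h • p)
      (fun i => mfderiv 𝓘(ℝ, E) 𝓘(ℝ, E) (fun q : M => h • q) p (v i))) 1 := by
  have hF : actionInChart E EH H p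
      (extChartAt 𝓘(ℝ, EH) (1 : H) 1, extChartAt 𝓘(ℝ, E) p p) = extChartAt 𝓘(ℝ, E) p p := by
    simp [actionInChart]
  have h1 := differentiableAt_pullback_family (α := formInChart α p)
    ((contDiffAt_actionInChart (EH := EH) (H := H) p).of_le ENat.LEInfty.out) (by rw [hF]; exact hα p)
    (fun i => mfderiv 𝓘(ℝ, E) 𝓘(ℝ, E) (extChartAt 𝓘(ℝ, E) p) p (v i))
  have h2 : MDifferentiableAt 𝓘(ℝ, EH) 𝓘(ℝ, EH) (extChartAt 𝓘(ℝ, EH) (1 : H)) 1 :=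
    mdifferentiableAt_extChartAt_of_mem (mem_extChartAt_source 1)
  have h3 := h1.mdifferentiableAt.comp (1 : H) h2
  exact h3.congr_of_eventuallyEq (eventually_form_smul_eq α p v)

end ActionChart

/-! ### Invariance of the Kähler form -/

section Invariance

variable {E : Type*} [NormedAddCommGroup E] [NormedSpace ℂ E]
  {M : Type*} [TopologicalSpace M] [ChartedSpace E M] [IsManifold 𝓘(ℝ, E) ∞ M]
  {EH : Type*} [NormedAddCommGroup EH] [NormedSpace ℝ EH]
  {H : Type*} [TopologicalSpace H] [ChartedSpace EH H] [Group H]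
  [LieGroup 𝓘(ℝ, EH) ∞ H] [MulAction H M] [ContMDiffSMul 𝓘(ℝ, EH) 𝓘(ℝ, E) ∞ H M]

/-- The fundamental field is needed in the chart on a whole neighbourhood, not only at `p`, because
the moment map equation is differentiated once more. -/
theorem eventually_fundamentalVector_eq (p : M) (ξ : GroupLieAlgebra 𝓘(ℝ, EH) H) :
    ∀ᶠ y in 𝓝 (extChartAt 𝓘(ℝ, E) p p),
      (fundamentalVector ξ ((extChartAt 𝓘(ℝ, E) p).symm y) : E) =
        mfderiv 𝓘(ℝ, E) 𝓘(ℝ, E) (extChartAt 𝓘(ℝ, E) p).symm y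
          (fderiv ℝ (actionInChart E EH H p) (extChartAt 𝓘(ℝ, EH) (1 : H) 1, y)
            (mfderiv 𝓘(ℝ, EH) 𝓘(ℝ, EH) (extChartAt 𝓘(ℝ, EH) (1 : H)) 1 ξ, 0)) := by
  set κ := extChartAt 𝓘(ℝ, EH) (1 : H)
  set ψ := extChartAt 𝓘(ℝ, E) p
  have h1 : ∀ᶠ z in 𝓝 (κ 1, ψ p), DifferentiableAt ℝ (actionInChart E EH H p) z :=
    ((contDiffAt_actionInChart (EH := EH) (H := H) p).of_le
      (m := 1) (by simp)).eventually (by simp) |>.mono fun z hz => hz.differentiableAt (by simp)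
  have h2 : ContinuousAt (fun y : E => (κ 1, y)) (ψ p) := by fun_prop
  filter_upwards [h2.eventually h1, extChartAt_target_mem_nhds (I := 𝓘(ℝ, E)) p] with y hd hy
  have hκ : MDifferentiableAt 𝓘(ℝ, EH) 𝓘(ℝ, EH) κ 1 :=
    mdifferentiableAt_extChartAt_of_mem (mem_extChartAt_source 1)
  have hF : actionInChart E EH H p (κ 1, y) = y := actionInChart_one p hy
  have hψ : MDifferentiableAt 𝓘(ℝ, E) 𝓘(ℝ, E) ψ.symm y :=
    mdifferentiableAt_extChartAt_symm_of_mem hy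
  have h3 : HasFDerivAt (fun s => actionInChart E EH H p (s, y))
      (fderiv ℝ (actionInChart E EH H p) (κ 1, y) ∘L ContinuousLinearMap.inl ℝ EH E) (κ 1) :=
    HasFDerivAt.comp (g := actionInChart E EH H p) (κ 1) (DifferentiableAt.hasFDerivAt hd)
      (hasFDerivAt_prodMk_left (𝕜 := ℝ) (κ 1) y)
  have h4 : (fun h : H => h • ψ.symm y) =ᶠ[𝓝 1]
      ψ.symm ∘ ((fun s => actionInChart E EH H p (s, y)) ∘ κ) := by
    have hc : ContinuousAt (fun h : H => h • ψ.symm y) 1 :=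
      (contMDiff_orbit (EH := EH) (E := E) (ψ.symm y)).continuous.continuousAt
    filter_upwards [extChartAt_source_mem_nhds (I := 𝓘(ℝ, EH)) (1 : H),
      hc.eventually_mem (by
        rw [one_smul]
        exact extChartAt_source_mem_nhds' (I := 𝓘(ℝ, E)) (ψ.map_target hy))] with h hs hp
    simp only [Function.comp_apply, actionInChart]
    rw [show κ.symm (κ h) = h from κ.left_inv hs]
    exact (ψ.left_inv hp).symm
  have h5 := mfderiv_comp_apply_of_eq (x := (1 : H)) (y := y) hψ
    (h3.differentiableAt.mdifferentiableAt.comp (1 : H) hκ) hF ξ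
  have h6 := mfderiv_comp_apply (1 : H) h3.differentiableAt.mdifferentiableAt hκ ξ
  rw [mfderiv_eq_fderiv, h3.fderiv] at h6
  rw [fundamentalVector, h4.mfderiv_eq]
  exact h5.trans (congrArg (mfderiv 𝓘(ℝ, E) 𝓘(ℝ, E) ψ.symm y) h6)

variable {n : ℕ} (C : CalabiYau E M n)
  {μ : M → Module.Dual ℝ (GroupLieAlgebra 𝓘(ℝ, EH) H)}

theorem hasMFDerivAt_omega_smul_one (hμ : C.IsMomentMap μ) (p : M)
    (v : Fin 2 → TangentSpace 𝓘(ℝ, E) p) :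
    HasMFDerivAt 𝓘(ℝ, EH) 𝓘(ℝ, ℝ) (fun h : H => C.omega (h • p)
      (fun i => mfderiv 𝓘(ℝ, E) 𝓘(ℝ, E) (fun q : M => h • q) p (v i))) 1 0 := by
  set κ := extChartAt 𝓘(ℝ, EH) (1 : H) with hκdef
  set ψ := extChartAt 𝓘(ℝ, E) p with hψdef
  have hdα : DifferentiableAt ℝ (formInChart C.omega p) (ψ p) :=
    differentiableAt_formInChart C.omega_smooth p (mem_extChartAt_target p)
  have hF2 : ContDiffAt ℝ 2 (actionInChart E EH H p) (κ 1, ψ p) :=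
    (contDiffAt_actionInChart p).of_le ENat.LEInfty.out
  set g : EH → ℝ := fun s => formInChart C.omega p (actionInChart E EH H p (s, ψ p))
    (fun i => fderiv ℝ (actionInChart E EH H p) (s, ψ p)
      (0, mfderiv 𝓘(ℝ, E) 𝓘(ℝ, E) ψ p (v i))) with hg
  have hF1 : actionInChart E EH H p (κ 1, ψ p) = ψ p :=
    actionInChart_one p (mem_extChartAt_target p)
  have hgd : DifferentiableAt ℝ g (κ 1) :=
    differentiableAt_pullback_family hF2 (by rw [hF1]; exact hdα) _
  have hκ : MDifferentiableAt 𝓘(ℝ, EH) 𝓘(ℝ, EH) κ 1 :=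
    mdifferentiableAt_extChartAt_of_mem (mem_extChartAt_source 1)
  have h1 := hgd.mdifferentiableAt.hasMFDerivAt.comp (1 : H) hκ.hasMFDerivAt
  have h2 := h1.congr_of_eventuallyEq (eventually_form_smul_eq C.omega p v)
  refine h2.congr_mfderiv (ContinuousLinearMap.ext fun ξ => ?_)
  rw [mfderiv_eq_fderiv]
  change fderiv ℝ g (κ 1) (mfderiv 𝓘(ℝ, EH) 𝓘(ℝ, EH) κ 1 ξ) = 0
  refine fderiv_pullback_two_form_eq_zero (P := EH) (E := E) (σ := mfderiv 𝓘(ℝ, EH) 𝓘(ℝ, EH) κ 1 ξ)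
    (m := fun y => μ (ψ.symm y) ξ) hF2 ?_ hdα (C.omega_closed p _ (mem_extChartAt_target p)) ?_ ?_ _
  · filter_upwards [extChartAt_target_mem_nhds (I := 𝓘(ℝ, E)) p] with y hy
    exact actionInChart_one p hy
  · have h3 : ContMDiffAt 𝓘(ℝ, E) 𝓘(ℝ, ℝ) ∞ (fun y => μ (ψ.symm y) ξ) (ψ p) :=
      ((hμ.smooth ξ).contMDiffAt).comp (ψ p)
        ((contMDiffOn_extChartAt_symm (I := 𝓘(ℝ, E)) (n := ∞) p).contMDiffAt
          (extChartAt_target_mem_nhds (I := 𝓘(ℝ, E)) p))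
    exact h3.contDiffAt.of_le ENat.LEInfty.out
  · filter_upwards [eventually_fundamentalVector_eq (EH := EH) p ξ,
      extChartAt_target_mem_nhds (I := 𝓘(ℝ, E)) p] with y hy1 hy2 w
    have h3 : MDifferentiableAt 𝓘(ℝ, E) 𝓘(ℝ, ℝ) (fun q => μ q ξ) (ψ.symm y) :=
      (hμ.smooth ξ).mdifferentiableAt (by simp)
    have h4 := mfderiv_comp_apply y h3 (mdifferentiableAt_extChartAt_symm_of_mem hy2) w
    rw [mfderiv_eq_fderiv] at h4
    refine h4.trans ((hμ.deriv_eq ξ _ _).trans (congrArg Neg.neg ?_))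
    refine form_congr_point C.omega rfl fun i => ?_
    fin_cases i
    · exact hy1
    · rfl

theorem omega_smul [PreconnectedSpace H] (hμ : C.IsMomentMap μ) (h : H) (p : M)
    (v : Fin 2 → TangentSpace 𝓘(ℝ, E) p) :
    C.omega (h • p) (fun i => mfderiv 𝓘(ℝ, E) 𝓘(ℝ, E) (fun q : M => h • q) p (v i)) =
      C.omega p v := by
  set Φ : H → ℝ := fun h => C.omega (h • p)
    (fun i => mfderiv 𝓘(ℝ, E) 𝓘(ℝ, E) (fun q : M => h • q) p (v i))
  have h1 : ∀ h, HasMFDerivAt 𝓘(ℝ, EH) 𝓘(ℝ, ℝ) Φ h 0 := by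
    intro h
    have h2 := hasMFDerivAt_omega_smul_one C hμ (h • p)
      (fun i => mfderiv 𝓘(ℝ, E) 𝓘(ℝ, E) (fun q : M => h • q) p (v i))
    have h3 : MDifferentiableAt 𝓘(ℝ, EH) 𝓘(ℝ, EH) (fun g : H => g * h⁻¹) h :=
      (contMDiff_mul_right (I := 𝓘(ℝ, EH)) (n := ∞) (a := h⁻¹)).mdifferentiableAt (by simp)
    -- Writing g = (g h⁻¹) h turns the derivative at `h` into a derivative at 1, with base point h •
    -- p and translated vectors.
    have h4 : Φ = (fun g : H => C.omega (g • h • p)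
        (fun i => mfderiv 𝓘(ℝ, E) 𝓘(ℝ, E) (fun q : M => g • q) (h • p)
          (mfderiv 𝓘(ℝ, E) 𝓘(ℝ, E) (fun q : M => h • q) p (v i)))) ∘ fun g : H => g * h⁻¹ := by
      ext g
      refine form_congr_point C.omega (by simp [smul_smul]) fun i => ?_
      have := mfderiv_smul_mul EH (g * h⁻¹) h p (v i)
      rwa [inv_mul_cancel_right] at this
    have h5 := HasMFDerivAt.comp h (by rw [mul_inv_cancel]; exact h2) h3.hasMFDerivAt
    rw [h4]
    exact h5.congr_mfderiv (ContinuousLinearMap.zero_comp _)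
  have h6 := eq_of_hasMFDerivAt_zero h1 h 1
  refine h6.trans (form_congr_point C.omega (one_smul H p) fun i => mfderiv_one_smul_action p (v i))

end Invariance

/-! ### Wedge products under pull-back and scaling -/

section Wedge

variable {V W : Type*} [AddCommGroup V] [Module ℝ V] [AddCommGroup W] [Module ℝ W]

theorem wedge_compLinearMap {k l : ℕ} (a : V [⋀^Fin k]→ₗ[ℝ] ℂ) (b : V [⋀^Fin l]→ₗ[ℝ] ℂ)
    (f : W →ₗ[ℝ] V) :
    wedge (a.compLinearMap f) (b.compLinearMap f) = (wedge a b).compLinearMap f := by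
  ext v
  simp only [wedge, AlternatingMap.domDomCongr_apply, LinearMap.compAlternatingMap_apply,
    AlternatingMap.compLinearMap_apply]
  congr 1
  change (a.compLinearMap f).domCoprod (b.compLinearMap f) _ = a.domCoprod b _
  simp only [AlternatingMap.domCoprod_apply, sum_apply]
  refine Finset.sum_congr rfl fun σ _ => ?_
  induction σ using Quotient.inductionOn' with | _ σ
  rfl

theorem wedgePow_compLinearMap (a : V [⋀^Fin 2]→ₗ[ℝ] ℂ) (f : W →ₗ[ℝ] V) (m : ℕ) :
    wedgePow (a.compLinearMap f) m = (wedgePow a m).compLinearMap f := by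
  induction m with
  | zero => ext v; rfl
  | succ m ih =>
    change wedge (wedgePow (a.compLinearMap f) m) (a.compLinearMap f) = _
    rw [ih, wedge_compLinearMap]
    rfl

theorem wedge_smul_smul {k l : ℕ} (a : V [⋀^Fin k]→ₗ[ℝ] ℂ) (b : V [⋀^Fin l]→ₗ[ℝ] ℂ)
    (z w : ℂ) : wedge (z • a) (w • b) = (z * w) • wedge a b := by
  ext v
  simp only [wedge, AlternatingMap.domDomCongr_apply, LinearMap.compAlternatingMap_apply,
    AlternatingMap.smul_apply, AlternatingMap.domCoprod_apply, sum_apply, map_sum,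
    Finset.smul_sum]
  refine Finset.sum_congr rfl fun σ _ => ?_
  induction σ using Quotient.inductionOn' with | _ σ
  simp only [AlternatingMap.domCoprod.summand_mk'', _root_.smul_apply,
    MultilinearMap.domDomCongr_apply, MultilinearMap.domCoprod_apply]
  simp only [Units.smul_def, map_zsmul]
  simp only [LinearMap.mul'_apply, zsmul_eq_mul, smul_eq_mul,
    AlternatingMap.coe_multilinearMap, AlternatingMap.smul_apply]
  ring

/-- Each shuffle class contains k! l! permutations with equal contributions; the sum over the full
symmetric group is easier to compute with than the sum over the quotient. -/
theorem factorial_smul_wedge_apply {k l : ℕ} (a : V [⋀^Fin k]→ₗ[ℝ] ℂ) (b : V [⋀^Fin l]→ₗ[ℝ] ℂ)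
    (v : Fin k ⊕ Fin l → V) :
    (k ! * l ! : ℂ) * wedge a b (v ∘ finSumFinEquiv.symm) =
      ∑ σ : Equiv.Perm (Fin k ⊕ Fin l), ((σ.sign : ℤ) : ℂ) *
        (a (fun i => v (σ (Sum.inl i))) * b (fun i => v (σ (Sum.inr i)))) := by
  have h := MultilinearMap.domCoprod_alternization_eq a b
  have h1 := congrArg (LinearMap.mul' ℝ ℂ) (DFunLike.congr_fun h v)
  rw [MultilinearMap.alternatization_apply, map_sum] at h1
  have h2 : wedge a b (v ∘ finSumFinEquiv.symm) = LinearMap.mul' ℝ ℂ (a.domCoprod b v) := by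
    simp only [wedge, AlternatingMap.domDomCongr_apply, LinearMap.compAlternatingMap_apply]
    congr 2
    ext i
    simp
  rw [h2]
  rw [AlternatingMap.smul_apply, map_nsmul, nsmul_eq_mul, Fintype.card_fin, Fintype.card_fin] at h1
  push_cast at h1
  rw [← h1]
  refine Finset.sum_congr rfl fun σ _ => ?_
  rw [Units.smul_def, map_zsmul, zsmul_eq_mul]
  simp [MultilinearMap.domCoprod_apply]

end Wedge

/-! ### The real volume form of a complex volume form -/

section ComplexForms

variable {V : Type*} [AddCommGroup V] [Module ℂ V]

theorem exists_complex_alternatingMap {n : ℕ} (a : V [⋀^Fin n]→ₗ[ℝ] ℂ)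
    (ha : ∀ (v : Fin n → V) (i : Fin n),
      a (Function.update v i (Complex.I • v i)) = Complex.I * a v) :
    ∃ b : V [⋀^Fin n]→ₗ[ℂ] ℂ, ∀ v, b v = a v := by
  refine ⟨{ toFun := a, map_update_add' := ?_, map_update_smul' := ?_,
            map_eq_zero_of_eq' := ?_ }, fun v => rfl⟩
  · intro inst v i x y
    exact a.map_update_add v i x y
  · intro inst v i z x
    obtain rfl : inst = instDecidableEqFin n := Subsingleton.elim _ _
    have h1 := ha (Function.update v i x) i
    simp only [Function.update_idem, Function.update_self] at h1
    have h2 : z • x = z.re • x + z.im • (Complex.I • x) := by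
      conv_lhs => rw [← Complex.re_add_im z, add_smul, mul_smul]
      simp
    rw [h2, a.map_update_add, a.map_update_smul, a.map_update_smul, h1]
    conv_rhs => rw [← Complex.re_add_im z]
    simp only [Complex.real_smul, smul_eq_mul]
    ring
  · intro v i j h hij
    exact a.map_eq_zero_of_eq v h hij

/-- Morally, evaluate on the (1,0)-parts of a frame e and the (0,1)-parts of a second copy of it:
only a(e) conj(a(e)) survives. Without complexifying V, the same evaluation is expanded as a
weighted sum over the subsets of slots whose vector is multiplied by √-1. -/
theorem wedge_conj_ne_zero {n : ℕ} {a : V [⋀^Fin n]→ₗ[ℝ] ℂ}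
    (ha : ∀ (v : Fin n → V) (i : Fin n),
      a (Function.update v i (Complex.I • v i)) = Complex.I * a v) (h0 : a ≠ 0) :
    wedge a (Complex.conjCLE.toContinuousLinearMap.toLinearMap.compAlternatingMap a) ≠ 0 := by
  obtain ⟨b, hb⟩ := exists_complex_alternatingMap a ha
  obtain ⟨e, he⟩ : ∃ e, b e ≠ 0 := by
    by_contra! h
    exact h0 (AlternatingMap.ext fun v => by rw [← hb, h v]; rfl)
  intro hw
  set ι := Fin n ⊕ Fin n
  set cj : ℂ → ℂ := fun z => (starRingEnd ℂ) z
  have hS : ∀ v : ι → V, ∑ σ : Equiv.Perm ι, ((σ.sign : ℤ) : ℂ) *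
      (b (fun i => v (σ (Sum.inl i))) * cj (b (fun i => v (σ (Sum.inr i))))) = 0 := by
    intro v
    have h1 := factorial_smul_wedge_apply a
      (Complex.conjCLE.toContinuousLinearMap.toLinearMap.compAlternatingMap a) v
    rw [hw] at h1
    simp only [AlternatingMap.zero_apply, mul_zero] at h1
    rw [h1]
    refine Finset.sum_congr rfl fun σ _ => ?_
    rw [hb, hb]
    rfl
  set v0 : ι → V := Sum.elim e e
  -- The weights of v - √-1 ⊗ √-1 v and v + √-1 ⊗ √-1 v, for the first and second copy of the frame.
  set κ : ι → ℂ := Sum.elim (fun _ => -Complex.I) (fun _ => Complex.I)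
  set t : Finset ι → ι → ℂ := fun s i => if i ∈ s then Complex.I else 1
  set B : Equiv.Perm ι → ℂ := fun σ =>
    b (fun i => v0 (σ (Sum.inl i))) * cj (b (fun i => v0 (σ (Sum.inr i))))
  -- the factor contributed by the slot `i`
  set δ : Equiv.Perm ι → ι → ℂ := fun σ i => Sum.elim (fun _ => Complex.I)
    (fun _ => -Complex.I) (σ.symm i)
  have hterm : ∀ (s : Finset ι) (σ : Equiv.Perm ι),
      b (fun i => t s (σ (Sum.inl i)) • v0 (σ (Sum.inl i))) *
        cj (b (fun i => t s (σ (Sum.inr i)) • v0 (σ (Sum.inr i)))) =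
      (∏ i ∈ s, δ σ i) * B σ := by
    intro s σ
    rw [b.map_smul_univ, b.map_smul_univ]
    have h1 : ∏ i ∈ s, δ σ i = (∏ i, t s (σ (Sum.inl i))) * cj (∏ i, t s (σ (Sum.inr i))) := by
      have h2 : ∏ i ∈ s, δ σ i = ∏ i, if i ∈ s then δ σ i else 1 := by
        simp [Finset.prod_ite_mem]
      rw [h2, ← Equiv.prod_comp σ, Fintype.prod_sum_type]
      congr 1
      · refine Finset.prod_congr rfl fun i _ => ?_
        simp [t, δ]
      · simp only [cj, map_prod]
        refine Finset.prod_congr rfl fun i _ => ?_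
        by_cases h : σ (Sum.inr i) ∈ s <;> simp [t, δ, h]
    rw [h1]
    simp only [smul_eq_mul, cj, map_mul, B]
    ring
  -- Expanding the product over subsets gives a combination of values of the wedge, each zero by
  -- assumption. A factor is 2 when a slot sits in its own half and 0 otherwise.
  have hsum : ∑ σ : Equiv.Perm ι, ((σ.sign : ℤ) : ℂ) * B σ * ∏ i, (1 + κ i * δ σ i) = 0 := by
    have h1 : ∑ s : Finset ι, (∏ i ∈ s, κ i) * ∑ σ : Equiv.Perm ι, ((σ.sign : ℤ) : ℂ) *
      (b (fun i => t s (σ (Sum.inl i)) • v0 (σ (Sum.inl i))) *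
        cj (b (fun i => t s (σ (Sum.inr i)) • v0 (σ (Sum.inr i))))) = 0 :=
      Finset.sum_eq_zero fun s _ => by rw [hS (fun i => t s i • v0 i), mul_zero]
    rw [← h1]
    simp only [Finset.mul_sum]
    rw [Finset.sum_comm]
    refine Finset.sum_congr rfl fun σ _ => ?_
    rw [Finset.prod_one_add, Finset.mul_sum, Finset.powerset_univ]
    refine Finset.sum_congr rfl fun s _ => ?_
    rw [hterm, Finset.prod_mul_distrib]
    ring
  have hval : ∀ σ₁ σ₂ : Equiv.Perm (Fin n),
      ((Equiv.Perm.sign (Equiv.Perm.sumCongrHom (Fin n) (Fin n) (σ₁, σ₂)) : ℤ) : ℂ) *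
        B (Equiv.Perm.sumCongrHom (Fin n) (Fin n) (σ₁, σ₂)) *
        ∏ i, (1 + κ i * δ (Equiv.Perm.sumCongrHom (Fin n) (Fin n) (σ₁, σ₂)) i) =
      ((Complex.normSq (b e) * 2 ^ Fintype.card ι : ℝ) : ℂ) := by
    intro σ₁ σ₂
    have h1 : B (Equiv.Perm.sumCongrHom (Fin n) (Fin n) (σ₁, σ₂)) =
        ((σ₁.sign : ℤ) : ℂ) * ((σ₂.sign : ℤ) : ℂ) * (b e * cj (b e)) := by
      have h2 := b.map_perm e σ₁
      have h3 := b.map_perm e σ₂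
      have h4 : B (Equiv.Perm.sumCongrHom (Fin n) (Fin n) (σ₁, σ₂)) =
        b (e ∘ σ₁) * cj (b (e ∘ σ₂)) := rfl
      rw [h4, h2, h3]
      simp only [Units.smul_def, zsmul_eq_mul, cj, map_mul, map_intCast]
      ring
    have h5 : ∀ i, 1 + κ i * δ (Equiv.Perm.sumCongrHom (Fin n) (Fin n) (σ₁, σ₂)) i = 2 := by
      rintro (i | i)
      · change 1 + -Complex.I * Complex.I = 2
        rw [neg_mul, Complex.I_mul_I]; norm_num
      · change 1 + Complex.I * -Complex.I = 2
        rw [mul_neg, Complex.I_mul_I]; norm_num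
    have h6 : (Equiv.Perm.sign (Equiv.Perm.sumCongrHom (Fin n) (Fin n) (σ₁, σ₂)) : ℤ) =
        (σ₁.sign : ℤ) * (σ₂.sign : ℤ) := by
      simp [Equiv.Perm.sumCongrHom, Equiv.Perm.sign_sumCongr]
    have h7 : ∀ τ : Equiv.Perm (Fin n), ((τ.sign : ℤ) : ℂ) * ((τ.sign : ℤ) : ℂ) = 1 := by
      intro τ
      rw [← Int.cast_mul, ← Units.val_mul, Int.units_mul_self]; simp
    rw [h1, h6, Finset.prod_congr rfl fun i _ => h5 i]
    have h8 : b e * cj (b e) = ((Complex.normSq (b e) : ℝ) : ℂ) := Complex.mul_conj _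
    rw [h8]
    have h9 : ((((σ₁.sign : ℤ) * (σ₂.sign : ℤ) : ℤ) : ℂ) *
        (((σ₁.sign : ℤ) : ℂ) * ((σ₂.sign : ℤ) : ℂ) * ((Complex.normSq (b e) : ℝ) : ℂ)) *
        ∏ i : ι, (2 : ℂ)) = ((Complex.normSq (b e) * 2 ^ Fintype.card ι : ℝ) : ℂ) := by
      push_cast
      rw [Finset.prod_const, Finset.card_univ]
      linear_combination (((Complex.normSq (b e) : ℝ) : ℂ) * 2 ^ Fintype.card ι) *
        (((σ₂.sign : ℤ) : ℂ) * ((σ₂.sign : ℤ) : ℂ)) * h7 σ₁ +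
        (((Complex.normSq (b e) : ℝ) : ℂ) * 2 ^ Fintype.card ι) * h7 σ₂
    exact h9
  have hre : ∀ σ : Equiv.Perm ι, 0 ≤ (((σ.sign : ℤ) : ℂ) * B σ * ∏ i, (1 + κ i * δ σ i)).re := by
    intro σ
    by_cases hσ : ∀ i : Fin n, ∃ j : Fin n, σ (Sum.inl i) = Sum.inl j
    · have hmem : σ ∈ (Equiv.Perm.sumCongrHom (Fin n) (Fin n)).range := by
        apply Equiv.Perm.mem_sumCongrHom_range_of_perm_mapsTo_inl
        rintro _ ⟨i, rfl⟩
        obtain ⟨j, hj⟩ := hσ i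
        exact ⟨j, hj.symm⟩
      obtain ⟨⟨σ₁, σ₂⟩, rfl⟩ := hmem
      rw [hval, Complex.ofReal_re]
      exact mul_nonneg (Complex.normSq_nonneg _) (by positivity)
    · push Not at hσ
      obtain ⟨i, hi⟩ := hσ
      obtain ⟨j, hj⟩ : ∃ j : Fin n, σ (Sum.inl i) = Sum.inr j := by
        rcases h : σ (Sum.inl i) with j | j
        · exact absurd h (hi j)
        · exact ⟨j, rfl⟩
      -- The slot `Sum.inr j` is fed to the complex linear factor, so its factor is 1 + √-1 · √-1.
      have h1 : ∏ i, (1 + κ i * δ σ i) = 0 := by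
        refine Finset.prod_eq_zero (Finset.mem_univ (Sum.inr j)) ?_
        have h2 : σ.symm (Sum.inr j) = Sum.inl i := by rw [← hj, Equiv.symm_apply_apply]
        simp [κ, δ, h2]
      rw [h1, mul_zero, Complex.zero_re]
  -- All terms have nonnegative real part, so each vanishes; but the identity permutation
  -- contributes a positive number.
  have h1 := congrArg Complex.re hsum
  rw [Complex.re_sum, Complex.zero_re, Finset.sum_eq_zero_iff_of_nonneg fun σ _ => hre σ] at h1
  have h2 := h1 (Equiv.Perm.sumCongrHom (Fin n) (Fin n) (1, 1)) (Finset.mem_univ _)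
  rw [hval, Complex.ofReal_re] at h2
  have h3 : 0 < Complex.normSq (b e) := Complex.normSq_pos.2 he
  have h4 : 0 < Complex.normSq (b e) * 2 ^ Fintype.card ι := by positivity
  exact h4.ne' h2

end ComplexForms

/-! ### Comparing two volume forms at a point -/

section PointwiseRatio

variable {V : Type*} [AddCommGroup V] [Module ℂ V]

/-- Both forms are complex multilinear of top degree, hence multiples of the determinant in a basis.
-/
theorem exists_smul_of_complex_form {n : ℕ} [FiniteDimensional ℂ V]
    (hn : Module.finrank ℂ V = n) {a b : V [⋀^Fin n]→ₗ[ℝ] ℂ}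
    (ha : ∀ (v : Fin n → V) (i : Fin n),
      a (Function.update v i (Complex.I • v i)) = Complex.I * a v)
    (hb : ∀ (v : Fin n → V) (i : Fin n),
      b (Function.update v i (Complex.I • v i)) = Complex.I * b v) (ha0 : a ≠ 0) :
    ∃ z : ℂ, ∀ v, b v = z * a v := by
  obtain ⟨a', ha'⟩ := exists_complex_alternatingMap a ha
  obtain ⟨b', hb'⟩ := exists_complex_alternatingMap b hb
  set e := Module.finBasisOfFinrankEq ℂ V hn
  have h1 := a'.eq_smul_basis_det e
  have h2 := b'.eq_smul_basis_det e
  have hae : a' e ≠ 0 := by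
    intro h
    rw [h, zero_smul] at h1
    refine ha0 (AlternatingMap.ext fun v => ?_)
    rw [← ha', h1]
    rfl
  refine ⟨b' e / a' e, fun v => ?_⟩
  rw [← ha', ← hb', h1, h2]
  simp only [AlternatingMap.smul_apply, smul_eq_mul, Module.Basis.det_self, mul_one]
  field_simp

/-- Pulling the second normalization back by T leaves the power of ω unchanged and multiplies the
wedge of Ω with its conjugate by |z|². That wedge is nonzero, so |z|² = 1. -/
theorem norm_eq_one_of_normalization {n : ℕ} {ω₁ ω₂ : V [⋀^Fin 2]→ₗ[ℝ] ℝ}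
    {a₁ a₂ : V [⋀^Fin n]→ₗ[ℝ] ℂ} {T : V →ₗ[ℝ] V} {z : ℂ} {k : ℂ} (hk : k ≠ 0)
    (hω : ∀ v : Fin 2 → V, ω₂ (fun i => T (v i)) = ω₁ v)
    (ha : ∀ v : Fin n → V, a₂ (fun i => T (v i)) = z * a₁ v)
    (hI : ∀ (v : Fin n → V) (i : Fin n),
      a₁ (Function.update v i (Complex.I • v i)) = Complex.I * a₁ v) (h0 : a₁ ≠ 0)
    (h₁ : ∀ v : Fin (2 * n) → V,
      wedgePow (Complex.ofRealCLM.toLinearMap.compAlternatingMap ω₁) n v / (n ! : ℂ) =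
        k * wedge a₁ (Complex.conjCLE.toContinuousLinearMap.toLinearMap.compAlternatingMap a₁)
          (fun i => v (Fin.cast (two_mul n).symm i)))
    (h₂ : ∀ v : Fin (2 * n) → V,
      wedgePow (Complex.ofRealCLM.toLinearMap.compAlternatingMap ω₂) n v / (n ! : ℂ) =
        k * wedge a₂ (Complex.conjCLE.toContinuousLinearMap.toLinearMap.compAlternatingMap a₂)
          (fun i => v (Fin.cast (two_mul n).symm i))) : ‖z‖ = 1 := by
  set cj := Complex.conjCLE.toContinuousLinearMap.toLinearMap
  obtain ⟨v, hv⟩ : ∃ v, wedge a₁ (cj.compAlternatingMap a₁) v ≠ 0 := by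
    by_contra! h
    exact wedge_conj_ne_zero hI h0 (AlternatingMap.ext h)
  set v' : Fin (2 * n) → V := fun i => v (Fin.cast (two_mul n) i)
  have e1 : (Complex.ofRealCLM.toLinearMap.compAlternatingMap ω₁) =
      (Complex.ofRealCLM.toLinearMap.compAlternatingMap ω₂).compLinearMap T := by
    ext w
    exact congrArg (fun r : ℝ => (r : ℂ)) (hω w).symm
  have e2 : a₂.compLinearMap T = z • a₁ := by
    ext w
    exact ha w
  have e3 : (cj.compAlternatingMap a₂).compLinearMap T =
      (starRingEnd ℂ z) • (cj.compAlternatingMap a₁) := by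
    ext w
    refine (congrArg (starRingEnd ℂ) (ha w)).trans ?_
    rw [map_mul]
    rfl
  have e4 := h₁ v'
  have e5 := h₂ (fun i => T (v' i))
  rw [e1, wedgePow_compLinearMap] at e4
  have e6 := e4.symm.trans e5
  have e7 : wedge a₂ (cj.compAlternatingMap a₂) (fun i => T (v i)) =
      z * starRingEnd ℂ z * wedge a₁ (cj.compAlternatingMap a₁) v := by
    have := wedge_compLinearMap a₂ (cj.compAlternatingMap a₂) T
    rw [e2, e3, wedge_smul_smul] at this
    exact (DFunLike.congr_fun this v).symm
  have e8 : wedge a₁ (cj.compAlternatingMap a₁) v =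
      z * starRingEnd ℂ z * wedge a₁ (cj.compAlternatingMap a₁) v := by
    rw [← e7]
    exact mul_left_cancel₀ hk e6
  have e9 : z * starRingEnd ℂ z = 1 := by
    have : (z * starRingEnd ℂ z - 1) * wedge a₁ (cj.compAlternatingMap a₁) v = 0 := by
      linear_combination -e8
    rcases mul_eq_zero.1 this with h | h
    · linear_combination h
    · exact absurd h hv
  rw [Complex.mul_conj] at e9
  have e10 : Complex.normSq z = 1 := by exact_mod_cast e9
  rw [Complex.normSq_eq_norm_sq] at e10
  nlinarith [norm_nonneg z]

end PointwiseRatio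

/-! ### Holomorphy in a vector space -/

section FlatHolomorphy

variable {E : Type*} [NormedAddCommGroup E] [NormedSpace ℂ E]

/-- Evaluation on tuples of basis vectors embeds the forms linearly in a finite power of `G`; a
linear left inverse of it is continuous and recovers α from its coefficients. -/
theorem differentiableAt_of_forall_apply {E G : Type*} [NormedAddCommGroup E] [NormedSpace ℝ E]
    [FiniteDimensional ℝ E] [NormedAddCommGroup G] [NormedSpace ℝ G] [FiniteDimensional ℝ G]
    {F : Type*} [NormedAddCommGroup F] [NormedSpace ℝ F] {k : ℕ}
    {α : F → E [⋀^Fin k]→L[ℝ] G} {x : F}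
    (h : ∀ w, DifferentiableAt ℝ (fun y => α y w) x) : DifferentiableAt ℝ α x := by
  set e := Module.finBasis ℝ E
  let Λ : (E [⋀^Fin k]→L[ℝ] G) →ₗ[ℝ] ((Fin k → Fin (Module.finrank ℝ E)) → G) :=
    { toFun := fun a i => a (fun j => e (i j))
      map_add' := fun _ _ => rfl
      map_smul' := fun _ _ => rfl }
  have hΛ : Function.Injective Λ := by
    intro a b hab
    apply ContinuousAlternatingMap.toAlternatingMap_injective
    refine Module.Basis.ext_alternating e fun i _ => ?_
    exact congrFun hab i
  obtain ⟨R, hR⟩ := Λ.exists_leftInverse_of_injective (LinearMap.ker_eq_bot.2 hΛ)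
  have h1 : α = fun y => LinearMap.toContinuousLinearMap R (Λ (α y)) := by
    ext1 y
    exact (LinearMap.congr_fun hR (α y)).symm
  rw [h1]
  refine (ContinuousLinearMap.differentiableAt _).comp x ?_
  rw [differentiableAt_pi]
  exact fun i => h _

/-- A map to the unit circle with complex linear derivative has vanishing derivative. -/
theorem fderiv_eq_zero_of_norm_eq_one {g : E → ℂ} {x : E} (hg : DifferentiableAt ℝ g x)
    (hI : ∀ u, fderiv ℝ g x (Complex.I • u) = Complex.I * fderiv ℝ g x u)
    (h1 : ∀ᶠ y in 𝓝 x, ‖g y‖ = 1) : fderiv ℝ g x = 0 := by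
  have h2 : HasFDerivAt (fun y => inner ℝ (g y) (g y)) (0 : E →L[ℝ] ℝ) x := by
    refine (hasFDerivAt_const (1 : ℝ) x).congr_of_eventuallyEq ?_
    filter_upwards [h1] with y hy
    rw [real_inner_self_eq_norm_sq, hy, one_pow]
  have h3 := (hg.hasFDerivAt.inner ℝ hg.hasFDerivAt).unique h2
  have h4 : ∀ u, (fderiv ℝ g x u).re * (g x).re + (fderiv ℝ g x u).im * (g x).im = 0 := by
    intro u
    have := DFunLike.congr_fun h3 u
    simpa [fderivInnerCLM_apply, real_inner_comm] using this
  ext u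
  have h5 := h4 u
  have h6 := h4 (Complex.I • u)
  rw [hI] at h6
  have h7 : ‖g x‖ = 1 := h1.self_of_nhds
  -- Constancy of |g|² kills the real part; applied to √-1 u it kills the imaginary part.
  have h8 : starRingEnd ℂ (g x) * fderiv ℝ g x u = 0 := by
    apply Complex.ext
    · simp
      linarith
    · simp at h6 ⊢
      linarith
  rcases mul_eq_zero.1 h8 with h | h
  · rw [map_eq_zero] at h
    rw [h, norm_zero] at h7
    exact absurd h7 zero_ne_one
  · exact h

/-- The second derivative of a map with complex linear first derivative is complex linear. -/
theorem fderiv_fderiv_smul_I {f : E → E} {x : E} (hf : ContDiffAt ℝ 2 f x)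
    (hI : ∀ᶠ y in 𝓝 x, ∀ v, fderiv ℝ f y (Complex.I • v) = Complex.I • fderiv ℝ f y v) (u v : E) :
    fderiv ℝ (fun y => fderiv ℝ f y v) x (Complex.I • u) =
      Complex.I • fderiv ℝ (fun y => fderiv ℝ f y v) x u := by
  have hD : DifferentiableAt ℝ (fderiv ℝ f) x :=
    (hf.fderiv_right (m := 1) (by norm_num)).differentiableAt (by simp)
  have hg : ∀ w, HasFDerivAt (fun y => fderiv ℝ f y w) ((fderiv ℝ (fderiv ℝ f) x).flip w) x := by
    intro w
    have := hD.hasFDerivAt.clm_apply (hasFDerivAt_const w x)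
    simpa using this
  have hs : ∀ v w, fderiv ℝ (fderiv ℝ f) x v w = fderiv ℝ (fderiv ℝ f) x w v := fun v w =>
    (hf.isSymmSndFDerivAt (by simp)).eq v w
  -- Complex linearity in the evaluated vector survives differentiation in y; symmetry of the second
  -- derivative transfers it to the direction of differentiation.
  have h1 : HasFDerivAt (fun y => fderiv ℝ f y (Complex.I • u))
      (Complex.I • (fderiv ℝ (fderiv ℝ f) x).flip u) x :=
    ((hg u).const_smul Complex.I).congr_of_eventuallyEq (hI.mono fun y hy => hy u)
  have h2 := DFunLike.congr_fun ((hg (Complex.I • u)).unique h1) v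
  rw [(hg v).fderiv]
  simp only [ContinuousLinearMap.flip_apply, _root_.smul_apply] at h2 ⊢
  rw [hs, h2, hs]

/-- A coefficient of the pull-back of a holomorphic form by a holomorphic map satisfies the
Cauchy–Riemann equations: in the product rule every term is complex linear in the direction, by
holomorphy of the coefficients of α, by `fderiv_fderiv_smul_I`, and by complex linearity of α in
each argument. -/
theorem fderiv_pullback_smul_I {k : ℕ} {f : E → E} {x : E} (hf : ContDiffAt ℝ 2 f x)
    (hI : ∀ᶠ y in 𝓝 x, ∀ v, fderiv ℝ f y (Complex.I • v) = Complex.I • fderiv ℝ f y v)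
    {α : E → E [⋀^Fin k]→L[ℝ] ℂ} (hα : DifferentiableAt ℝ α (f x))
    (hαI : ∀ w, DifferentiableAt ℂ (fun y => α y w) (f x))
    (hlin : ∀ (v : Fin k → E) (i : Fin k),
      α (f x) (Function.update v i (Complex.I • v i)) = Complex.I * α (f x) v)
    (e : Fin k → E) :
    DifferentiableAt ℝ (fun y => α (f y) (fun i => fderiv ℝ f y (e i))) x ∧
    ∀ u, fderiv ℝ (fun y => α (f y) (fun i => fderiv ℝ f y (e i))) x (Complex.I • u) =
      Complex.I * fderiv ℝ (fun y => α (f y) (fun i => fderiv ℝ f y (e i))) x u := by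
  have hfd : DifferentiableAt ℝ f x := hf.differentiableAt (by simp)
  have hD : DifferentiableAt ℝ (fderiv ℝ f) x :=
    (hf.fderiv_right (m := 1) (by norm_num)).differentiableAt (by simp)
  have hg : ∀ i, DifferentiableAt ℝ (fun y => fderiv ℝ f y (e i)) x := fun i =>
    hD.clm_apply (differentiableAt_const _)
  have ha : DifferentiableAt ℝ (fun y => α (f y)) x := hα.comp x hfd
  refine ⟨ha.continuousAlternatingMap_apply (g := fun i y => fderiv ℝ f y (e i)) hg, fun u => ?_⟩
  rw [fderiv_continuousAlternatingMap_apply_apply (f := fun y => α (f y))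
      (g := fun i y => fderiv ℝ f y (e i)) ha hg,
    fderiv_continuousAlternatingMap_apply_apply (f := fun y => α (f y))
      (g := fun i y => fderiv ℝ f y (e i)) ha hg, mul_add, Finset.mul_sum]
  have hc : fderiv ℝ (fun y => α (f y)) x = fderiv ℝ α (f x) ∘L fderiv ℝ f x :=
    (hα.hasFDerivAt.comp x hfd.hasFDerivAt).fderiv
  have hw : ∀ w u, fderiv ℝ α (f x) (Complex.I • u) w = Complex.I * fderiv ℝ α (f x) u w := by
    intro w u
    have h1 := ((ContinuousAlternatingMap.apply ℝ E ℂ w).hasFDerivAt.comp (f x) hα.hasFDerivAt)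
    have h2 := (hαI w).hasFDerivAt.restrictScalars ℝ
    have h3 := h1.unique h2
    have h4 : ∀ v, fderiv ℝ α (f x) v w = fderiv ℂ (fun y => α y w) (f x) v :=
      fun v => DFunLike.congr_fun h3 v
    rw [h4, h4, map_smul, smul_eq_mul]
  congr 1
  · rw [hc]
    simp only [ContinuousLinearMap.comp_apply]
    rw [hI.self_of_nhds, hw]
  · refine Finset.sum_congr rfl fun i _ => ?_
    rw [fderiv_fderiv_smul_I hf hI]
    have := hlin (Function.update (fun i => fderiv ℝ f x (e i)) i
      (fderiv ℝ (fun y => fderiv ℝ f y (e i)) x u)) i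
    simpa using this

end FlatHolomorphy

/-! ### The complex structure and the volume form in charts -/

section ComplexCharts

variable {E : Type*} [NormedAddCommGroup E] [NormedSpace ℂ E]
  {M : Type*} [TopologicalSpace M] [ChartedSpace E M]

/-- In the preferred charts the real derivative is the complex one with scalars restricted. -/
theorem mfderiv_complexStructure {N Q : Type*} [TopologicalSpace N] [ChartedSpace E N]
    [TopologicalSpace Q] [ChartedSpace E Q] {f : N → Q} {x : N}
    (hf : MDifferentiableAt 𝓘(ℂ, E) 𝓘(ℂ, E) f x) (v : TangentSpace 𝓘(ℝ, E) x) :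
    mfderiv 𝓘(ℝ, E) 𝓘(ℝ, E) f x (complexStructure x v) =
      complexStructure (f x) (mfderiv 𝓘(ℝ, E) 𝓘(ℝ, E) f x v) := by
  have h1 := hf.differentiableWithinAt_writtenInExtChartAt
  rw [ModelWithCorners.range_eq_univ, differentiableWithinAt_univ] at h1
  have h2 := h1.hasFDerivAt.restrictScalars ℝ
  have h3 : MDifferentiableAt 𝓘(ℝ, E) 𝓘(ℝ, E) f x :=
    mdifferentiableAt_iff _ _ |>.2 ⟨hf.continuousAt, h2.differentiableAt.differentiableWithinAt⟩
  rw [mfderiv_eq_fderiv_extChartAt h3]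
  have h4 := h2.fderiv
  have h5 : ∀ w : E, fderiv ℝ (extChartAt 𝓘(ℝ, E) (f x) ∘ f ∘ (extChartAt 𝓘(ℝ, E) x).symm)
      (extChartAt 𝓘(ℝ, E) x x) w =
      fderiv ℂ (writtenInExtChartAt 𝓘(ℂ, E) 𝓘(ℂ, E) x f) (extChartAt 𝓘(ℂ, E) x x) w :=
    fun w => DFunLike.congr_fun h4 w
  have h6 : ∀ w : E, fderiv ℂ (writtenInExtChartAt 𝓘(ℂ, E) 𝓘(ℂ, E) x f)
      (extChartAt 𝓘(ℂ, E) x x) (Complex.I • w) =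
      Complex.I • fderiv ℂ (writtenInExtChartAt 𝓘(ℂ, E) 𝓘(ℂ, E) x f)
      (extChartAt 𝓘(ℂ, E) x x) w := fun w => map_smul _ Complex.I w
  exact ((h5 _).trans (h6 v)).trans (congrArg (fun w : E => Complex.I • w) (h5 v).symm)

variable {n : ℕ} (C : CalabiYau E M n)

theorem Omega_update_smul_I (p : M) (v : Fin n → E) (i : Fin n) :
    (C.Omega p : E [⋀^Fin n]→L[ℝ] ℂ) (Function.update v i (Complex.I • v i)) =
      Complex.I * (C.Omega p : E [⋀^Fin n]→L[ℝ] ℂ) v :=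
  C.Omega_type p v i

theorem apply_basis_ne_zero {a : E [⋀^Fin n]→L[ℝ] ℂ}
    (ha : ∀ (v : Fin n → E) (i : Fin n),
      a (Function.update v i (Complex.I • v i)) = Complex.I * a v) (h0 : a ≠ 0)
    (e : Module.Basis (Fin n) ℂ E) : a e ≠ 0 := by
  obtain ⟨b, hb⟩ := exists_complex_alternatingMap a.toAlternatingMap ha
  intro h
  have h1 := b.eq_smul_basis_det e
  have h2 : b e = 0 := (hb e).trans h
  rw [h2, zero_smul] at h1
  refine h0 (ContinuousAlternatingMap.ext fun v => ?_)
  refine (hb v).symm.trans ?_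
  rw [h1]
  rfl

theorem differentiableAt_formInChart_Omega [FiniteDimensional ℂ E] {x : M} {y : E}
    (hy : y ∈ (extChartAt 𝓘(ℝ, E) x).target) :
    DifferentiableAt ℝ (formInChart C.Omega x) y := by
  have : FiniteDimensional ℝ E := FiniteDimensional.complexToReal E
  refine differentiableAt_of_forall_apply fun w => ?_
  exact (C.Omega_holomorphic x w y hy).differentiableAt.restrictScalars ℝ

section

variable [IsManifold 𝓘(ℝ, E) ∞ M]

theorem mfderiv_extChartAt_symm_apply {x : M} {y : E}
    (hy : y ∈ (extChartAt 𝓘(ℝ, E) x).target) (v : E) :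
    (mfderiv 𝓘(ℝ, E) 𝓘(ℝ, E) (extChartAt 𝓘(ℝ, E) x) ((extChartAt 𝓘(ℝ, E) x).symm y)
      (mfderiv 𝓘(ℝ, E) 𝓘(ℝ, E) (extChartAt 𝓘(ℝ, E) x).symm y v) : E) = v := by
  have h1 := mfderiv_comp_apply y
    (mdifferentiableAt_extChartAt_of_mem ((extChartAt 𝓘(ℝ, E) x).map_target hy))
    (mdifferentiableAt_extChartAt_symm_of_mem hy) v
  have h2 : (extChartAt 𝓘(ℝ, E) x ∘ (extChartAt 𝓘(ℝ, E) x).symm) =ᶠ[𝓝 y] id := by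
    filter_upwards [(isOpen_extChartAt_target x).mem_nhds hy] with z hz
    exact (extChartAt 𝓘(ℝ, E) x).right_inv hz
  rw [h2.mfderiv_eq, mfderiv_id] at h1
  exact h1.symm

theorem mfderiv_symm_extChartAt_apply {x : M} {y : E}
    (hy : y ∈ (extChartAt 𝓘(ℝ, E) x).target)
    (v : TangentSpace 𝓘(ℝ, E) ((extChartAt 𝓘(ℝ, E) x).symm y)) :
    (mfderiv 𝓘(ℝ, E) 𝓘(ℝ, E) (extChartAt 𝓘(ℝ, E) x).symm y
      (mfderiv 𝓘(ℝ, E) 𝓘(ℝ, E) (extChartAt 𝓘(ℝ, E) x) ((extChartAt 𝓘(ℝ, E) x).symm y) v) : E)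
      = v := by
  have hs := (extChartAt 𝓘(ℝ, E) x).map_target hy
  have h1 := mfderiv_comp_apply_of_eq (x := (extChartAt 𝓘(ℝ, E) x).symm y) (y := y)
    (mdifferentiableAt_extChartAt_symm_of_mem hy)
    (mdifferentiableAt_extChartAt_of_mem hs) ((extChartAt 𝓘(ℝ, E) x).right_inv hy) v
  have h2 : ((extChartAt 𝓘(ℝ, E) x).symm ∘ extChartAt 𝓘(ℝ, E) x)
      =ᶠ[𝓝 ((extChartAt 𝓘(ℝ, E) x).symm y)] id := by
    filter_upwards [(isOpen_extChartAt_source x).mem_nhds hs] with z hz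
    exact (extChartAt 𝓘(ℝ, E) x).left_inv hz
  rw [h2.mfderiv_eq, mfderiv_id] at h1
  exact h1.symm

theorem formInChart_Omega_ne_zero {x : M} {y : E}
    (hy : y ∈ (extChartAt 𝓘(ℝ, E) x).target) : formInChart C.Omega x y ≠ 0 := by
  intro h
  refine C.Omega_ne_zero ((extChartAt 𝓘(ℝ, E) x).symm y) (ContinuousAlternatingMap.ext fun v => ?_)
  have h1 := DFunLike.congr_fun h (fun i => (mfderiv 𝓘(ℝ, E) 𝓘(ℝ, E) (extChartAt 𝓘(ℝ, E) x)
    ((extChartAt 𝓘(ℝ, E) x).symm y) (v i) : E))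
  refine Eq.trans ?_ h1
  exact form_congr_point C.Omega rfl fun j => (mfderiv_symm_extChartAt_apply hy (v j)).symm

end

variable [IsManifold 𝓘(ℂ, E) ω M]

theorem mfderiv_extChartAt_complexStructure {x q : M} (hq : q ∈ (extChartAt 𝓘(ℝ, E) x).source)
    (v : TangentSpace 𝓘(ℝ, E) q) :
    mfderiv 𝓘(ℝ, E) 𝓘(ℝ, E) (extChartAt 𝓘(ℝ, E) x) q (complexStructure q v) =
      complexStructure (extChartAt 𝓘(ℝ, E) x q)
        (mfderiv 𝓘(ℝ, E) 𝓘(ℝ, E) (extChartAt 𝓘(ℝ, E) x) q v) := by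
  have : IsManifold 𝓘(ℂ, E) 1 M := IsManifold.of_le (n := ω) le_top
  have h : MDifferentiableAt 𝓘(ℂ, E) 𝓘(ℂ, E) (extChartAt 𝓘(ℂ, E) x) q :=
    mdifferentiableAt_extChartAt (by simpa using hq)
  exact mfderiv_complexStructure h v

theorem mfderiv_extChartAt_symm_complexStructure {x : M} {y : E}
    (hy : y ∈ (extChartAt 𝓘(ℝ, E) x).target) (v : TangentSpace 𝓘(ℝ, E) y) :
    mfderiv 𝓘(ℝ, E) 𝓘(ℝ, E) (extChartAt 𝓘(ℝ, E) x).symm y (complexStructure y v) =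
      complexStructure ((extChartAt 𝓘(ℝ, E) x).symm y)
        (mfderiv 𝓘(ℝ, E) 𝓘(ℝ, E) (extChartAt 𝓘(ℝ, E) x).symm y v) := by
  have h1 : ContMDiffAt 𝓘(ℂ, E) 𝓘(ℂ, E) ω (extChartAt 𝓘(ℂ, E) x).symm y :=
    (contMDiffOn_extChartAt_symm (n := ω) x).contMDiffAt
      ((isOpen_extChartAt_target (I := 𝓘(ℂ, E)) x).mem_nhds hy)
  exact mfderiv_complexStructure (h1.mdifferentiableAt (by simp)) v

theorem formInChart_Omega_update_smul_I {x : M} {y : E}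
    (hy : y ∈ (extChartAt 𝓘(ℝ, E) x).target) (v : Fin n → E) (i : Fin n) :
    formInChart C.Omega x y (Function.update v i (Complex.I • v i)) =
      Complex.I * formInChart C.Omega x y v := by
  set A : E → E := fun w => mfderiv 𝓘(ℝ, E) 𝓘(ℝ, E) (extChartAt 𝓘(ℝ, E) x).symm y w
  have h1 := Omega_update_smul_I C ((extChartAt 𝓘(ℝ, E) x).symm y) (fun j => A (v j)) i
  refine Eq.trans ?_ h1
  refine form_congr_point C.Omega rfl fun j => ?_
  rcases eq_or_ne j i with rfl | hj
  · exact (congrArg A (Function.update_self j _ v)).trans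
      ((mfderiv_extChartAt_symm_complexStructure hy (v j)).trans (Function.update_self (β := fun _ => E) j (Complex.I • A (v j))
          (fun j => A (v j))).symm)
  · exact (congrArg A (Function.update_of_ne hj _ v)).trans
      (Function.update_of_ne (β := fun _ => E) hj (Complex.I • A (v i)) (fun j => A (v j))).symm

end ComplexCharts

/-! ### The ratio of a pulled-back volume form to the original -/

section VolumeRatio

variable {E : Type*} [NormedAddCommGroup E] [NormedSpace ℂ E] [FiniteDimensional ℂ E]
  {M : Type*} [TopologicalSpace M] [ChartedSpace E M] [IsManifold 𝓘(ℂ, E) ω M]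
  [IsManifold 𝓘(ℝ, E) ∞ M] {n : ℕ} (C : CalabiYau E M n)

/-- A holomorphic map that multiplies the holomorphic volume form by a function of absolute value
one multiplies it by a locally constant function. -/
theorem hasMFDerivAt_volume_ratio {L : M → M} (hL : ContMDiff 𝓘(ℝ, E) 𝓘(ℝ, E) ∞ L)
    (hLI : ∀ (p : M) (v : TangentSpace 𝓘(ℝ, E) p),
      mfderiv 𝓘(ℝ, E) 𝓘(ℝ, E) L p (complexStructure p v) =
        complexStructure (L p) (mfderiv 𝓘(ℝ, E) 𝓘(ℝ, E) L p v))
    {f : M → ℂ} (hf1 : ∀ p, ‖f p‖ = 1)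
    (hf : ∀ (p : M) (v : Fin n → TangentSpace 𝓘(ℝ, E) p),
      C.Omega (L p) (fun i => mfderiv 𝓘(ℝ, E) 𝓘(ℝ, E) L p (v i)) = f p * C.Omega p v) (x : M) :
    HasMFDerivAt 𝓘(ℝ, E) 𝓘(ℝ, ℂ) f x 0 := by
  set ψ := extChartAt 𝓘(ℝ, E) x with hψdef
  set χ := extChartAt 𝓘(ℝ, E) (L x) with hχdef
  set F : E → E := χ ∘ L ∘ ψ.symm with hFdef
  have hψx : ψ.symm (ψ x) = x := ψ.left_inv (mem_extChartAt_source x)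
  have hFx : F (ψ x) = χ (L x) := by simp [hFdef, hψx]
  have hF : ContDiffAt ℝ ∞ F (ψ x) := by
    rw [← contMDiffAt_iff_contDiffAt]
    refine ContMDiffAt.comp (I' := 𝓘(ℝ, E)) (g := χ) (f := L ∘ ψ.symm) (ψ x) ?_ ?_
    · simp only [Function.comp_apply, hψx]
      exact contMDiffAt_extChartAt
    · exact (hL _).comp (ψ x) ((contMDiffOn_extChartAt_symm (n := ∞) x).contMDiffAt
        (extChartAt_target_mem_nhds x))
  have hmem : ∀ᶠ y in 𝓝 (ψ x), y ∈ ψ.target ∧ L (ψ.symm y) ∈ χ.source := by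
    refine Filter.Eventually.and (extChartAt_target_mem_nhds x) ?_
    have hc : ContinuousAt (L ∘ ψ.symm) (ψ x) :=
      hL.continuous.continuousAt.comp (continuousAt_extChartAt_symm x)
    refine hc.eventually_mem ?_
    simp only [Function.comp_apply, hψx]
    exact extChartAt_source_mem_nhds (L x)
  have hFI : ∀ᶠ y in 𝓝 (ψ x), ∀ v, fderiv ℝ F y (Complex.I • v) = Complex.I • fderiv ℝ F y v := by
    filter_upwards [hmem] with y ⟨hy1, hy2⟩
    have hs := mdifferentiableAt_extChartAt_symm_of_mem hy1
    have hm := hL.mdifferentiableAt (x := ψ.symm y) (by simp)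
    have ht := mdifferentiableAt_extChartAt_of_mem hy2
    have hd : ∀ v : E, fderiv ℝ F y v = mfderiv 𝓘(ℝ, E) 𝓘(ℝ, E) χ (L (ψ.symm y))
        (mfderiv 𝓘(ℝ, E) 𝓘(ℝ, E) L (ψ.symm y) (mfderiv 𝓘(ℝ, E) 𝓘(ℝ, E) ψ.symm y v)) := by
      intro v
      rw [← mfderiv_eq_fderiv]
      refine (mfderiv_comp_apply y ht (hm.comp y hs) v).trans ?_
      exact congrArg (mfderiv 𝓘(ℝ, E) 𝓘(ℝ, E) χ (L (ψ.symm y)))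
        (mfderiv_comp_apply y hm hs v)
    intro v
    refine (hd _).trans (Eq.trans ?_ (congrArg (fun w : E => Complex.I • w) (hd v).symm))
    refine Eq.trans ?_ (mfderiv_extChartAt_complexStructure hy2 _)
    refine congrArg (mfderiv 𝓘(ℝ, E) 𝓘(ℝ, E) χ (L (ψ.symm y))) ?_
    refine Eq.trans ?_ (hLI _ _)
    exact congrArg (mfderiv 𝓘(ℝ, E) 𝓘(ℝ, E) L (ψ.symm y))
      (mfderiv_extChartAt_symm_complexStructure hy1 v)
  obtain ⟨e⟩ : Nonempty (Module.Basis (Fin n) ℂ E) :=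
    ⟨Module.finBasisOfFinrankEq ℂ E C.finrank_eq⟩
  -- `N` and `D` are the coefficients of L^* Ω and Ω on a fixed frame, so the ratio f is N / D in
  -- the chart. No regularity of f is assumed; it is read off from this quotient.
  set N : E → ℂ := fun y => formInChart C.Omega (L x) (F y) (fun i => fderiv ℝ F y (e i)) with hN
  set D : E → ℂ := fun y => formInChart C.Omega x y e with hD
  have hD0 : ∀ y ∈ ψ.target, D y ≠ 0 := fun y hy =>
    apply_basis_ne_zero (formInChart_Omega_update_smul_I C hy) (formInChart_Omega_ne_zero C hy) e
  have hND : ∀ᶠ y in 𝓝 (ψ x), N y = f (ψ.symm y) * D y := by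
    filter_upwards [hmem] with y ⟨hy1, hy2⟩
    have h1 := form_mfderiv_eq_formInChart C.Omega (L := L) (q := ψ.symm y) (x := x) (x' := L x)
      (hL.mdifferentiableAt (by simp)) (ψ.map_target hy1) hy2
      (fun i => mfderiv 𝓘(ℝ, E) 𝓘(ℝ, E) ψ.symm y (e i))
    have h2 := (hf (ψ.symm y) (fun i => mfderiv 𝓘(ℝ, E) 𝓘(ℝ, E) ψ.symm y (e i))).symm.trans h1
    refine Eq.trans ?_ h2.symm
    refine congrArg (formInChart C.Omega (L x) (F y) : (Fin n → E) → ℂ) (funext fun i => ?_)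
    have h3 : ψ (ψ.symm y) = y := ψ.right_inv hy1
    have h4 : (mfderiv 𝓘(ℝ, E) 𝓘(ℝ, E) ψ (ψ.symm y)
      (mfderiv 𝓘(ℝ, E) 𝓘(ℝ, E) ψ.symm y (e i)) : E) = e i := mfderiv_extChartAt_symm_apply hy1 (e i)
    exact (congrArg₂ (fun (a : E) (b : E) => fderiv ℝ F a b) h3 h4).symm
  have hDc : DifferentiableAt ℂ D (ψ x) :=
    (C.Omega_holomorphic x e _ (mem_extChartAt_target x)).differentiableAt
  have hDi : DifferentiableAt ℂ (fun y => (D y)⁻¹) (ψ x) :=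
    hDc.inv (hD0 _ (mem_extChartAt_target x))
  have hDr := hDi.hasFDerivAt.restrictScalars ℝ
  obtain ⟨hNd, hNI⟩ := fderiv_pullback_smul_I (α := formInChart C.Omega (L x))
    (hF.of_le ENat.LEInfty.out) hFI
    (by rw [hFx]; exact differentiableAt_formInChart_Omega C (mem_extChartAt_target (L x)))
    (by
      rw [hFx]
      exact fun w => (C.Omega_holomorphic (L x) w _ (mem_extChartAt_target (L x))).differentiableAt)
    (by
      rw [hFx]
      exact fun v i => formInChart_Omega_update_smul_I C (mem_extChartAt_target (L x)) v i) e
  have hg : HasFDerivAt (fun y => N y * (D y)⁻¹) (N (ψ x) •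
      (fderiv ℂ (fun y => (D y)⁻¹) (ψ x)).restrictScalars ℝ + (D (ψ x))⁻¹ • fderiv ℝ N (ψ x))
      (ψ x) := hNd.hasFDerivAt.mul hDr
  have hgf : ∀ᶠ y in 𝓝 (ψ x), N y * (D y)⁻¹ = f (ψ.symm y) := by
    filter_upwards [hND, hmem] with y hy1 hy2
    rw [hy1, mul_inv_cancel_right₀ (hD0 y hy2.1)]
  have hz : fderiv ℝ (fun y => N y * (D y)⁻¹) (ψ x) = 0 := by
    refine fderiv_eq_zero_of_norm_eq_one hg.differentiableAt (fun u => ?_)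
      (hgf.mono fun y hy => by rw [hy, hf1])
    rw [hg.fderiv]
    simp only [_root_.add_apply, _root_.smul_apply, smul_eq_mul,
      ContinuousLinearMap.coe_restrictScalars', map_smul]
    rw [show fderiv ℝ N (ψ x) (Complex.I • u) = Complex.I * fderiv ℝ N (ψ x) u from hNI u]
    ring
  have hg0 : HasFDerivAt (fun y => N y * (D y)⁻¹) (0 : E →L[ℝ] ℂ) (ψ x) := by
    rw [← hz]
    exact hg.differentiableAt.hasFDerivAt
  have h1 := hg0.hasMFDerivAt.comp x
    (mdifferentiableAt_extChartAt_of_mem (mem_extChartAt_source x)).hasMFDerivAt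
  have h2 : f =ᶠ[𝓝 x] (fun y => N y * (D y)⁻¹) ∘ ψ := by
    filter_upwards [(continuousAt_extChartAt (I := 𝓘(ℝ, E)) x).eventually hgf,
      extChartAt_source_mem_nhds (I := 𝓘(ℝ, E)) x] with y hy1 hy2
    rw [Function.comp_apply]
    refine Eq.trans ?_ hy1.symm
    rw [ψ.left_inv hy2]
  exact (h1.congr_of_eventuallyEq h2).congr_mfderiv (ContinuousLinearMap.zero_comp _)

/-- At each point L^* Ω is again of type (n,0), so it is a multiple of Ω, of modulus one by the
normalization. The multiple has zero derivative, and `M` is connected. -/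
theorem exists_norm_eq_one_volume_ratio [PreconnectedSpace M] [Nonempty M]
    {L : M → M} (hL : ContMDiff 𝓘(ℝ, E) 𝓘(ℝ, E) ∞ L)
    (hLI : ∀ (p : M) (v : TangentSpace 𝓘(ℝ, E) p),
      mfderiv 𝓘(ℝ, E) 𝓘(ℝ, E) L p (complexStructure p v) =
        complexStructure (L p) (mfderiv 𝓘(ℝ, E) 𝓘(ℝ, E) L p v))
    (hω : ∀ (p : M) (v : Fin 2 → TangentSpace 𝓘(ℝ, E) p),
      C.omega (L p) (fun i => mfderiv 𝓘(ℝ, E) 𝓘(ℝ, E) L p (v i)) = C.omega p v) :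
    ∃ z : ℂ, ‖z‖ = 1 ∧ ∀ (p : M) (v : Fin n → TangentSpace 𝓘(ℝ, E) p),
      C.Omega (L p) (fun i => mfderiv 𝓘(ℝ, E) 𝓘(ℝ, E) L p (v i)) = z * C.Omega p v := by
  have h1 : ∀ p : M, ∃ z : ℂ, ‖z‖ = 1 ∧ ∀ v : Fin n → TangentSpace 𝓘(ℝ, E) p,
      C.Omega (L p) (fun i => mfderiv 𝓘(ℝ, E) 𝓘(ℝ, E) L p (v i)) = z * C.Omega p v := by
    intro p
    let T : E →ₗ[ℝ] E := (mfderiv 𝓘(ℝ, E) 𝓘(ℝ, E) L p).toLinearMap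
    let a₁ : E [⋀^Fin n]→ₗ[ℝ] ℂ := (C.Omega p).toAlternatingMap
    let a₂ : E [⋀^Fin n]→ₗ[ℝ] ℂ := (C.Omega (L p)).toAlternatingMap
    have h0 : a₁ ≠ 0 := fun h => C.Omega_ne_zero p
      (ContinuousAlternatingMap.ext fun v => DFunLike.congr_fun h v)
    have e1 : ∀ (v : Fin n → E) (i : Fin n),
      a₁ (Function.update v i (Complex.I • v i)) = Complex.I * a₁ v := C.Omega_type p
    have e2 : ∀ (v : Fin n → E) (i : Fin n), a₂.compLinearMap T
      (Function.update v i (Complex.I • v i)) = Complex.I * a₂.compLinearMap T v := by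
      intro v i
      refine Eq.trans ?_ (C.Omega_type (L p) (fun j => T (v j)) i)
      refine form_congr_point C.Omega rfl fun j => ?_
      rcases eq_or_ne j i with rfl | hj
      · exact (congrArg T (Function.update_self j _ v)).trans ((hLI p (v j)).trans
          (Function.update_self (β := fun _ => E) j _ (fun j => T (v j))).symm)
      · exact (congrArg T (Function.update_of_ne hj _ v)).trans
          (Function.update_of_ne (β := fun _ => E) hj _ (fun j => T (v j))).symm
    obtain ⟨z, hz⟩ := exists_smul_of_complex_form (V := E) (a := a₁)
      (b := a₂.compLinearMap T) C.finrank_eq e1 e2 h0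
    refine ⟨z, ?_, hz⟩
    refine norm_eq_one_of_normalization (V := E) (T := T) (a₁ := a₁) (a₂ := a₂)
      (ω₁ := (C.omega p).toAlternatingMap) (ω₂ := (C.omega (L p)).toAlternatingMap)
      (k := (-1) ^ (n * (n - 1) / 2) * (Complex.I / 2) ^ n) ?_ (hω p) hz e1 h0
      (C.normalization p) (C.normalization (L p))
    simp
  choose f hf1 hf using h1
  have h2 := eq_of_hasMFDerivAt_zero (hasMFDerivAt_volume_ratio C hL hLI hf1 hf)
  obtain ⟨x⟩ := ‹Nonempty M›
  exact ⟨f x, hf1 x, fun p v => by rw [hf, h2 p x]⟩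

end VolumeRatio

theorem exists_Omega_apply_ne_zero {E : Type*} [NormedAddCommGroup E] [NormedSpace ℂ E]
    {M : Type*} [TopologicalSpace M] [ChartedSpace E M] {n : ℕ} (C : CalabiYau E M n) (p : M) :
    ∃ v : Fin n → TangentSpace 𝓘(ℝ, E) p, C.Omega p v ≠ 0 := by
  by_contra! h
  exact C.Omega_ne_zero p (ContinuousAlternatingMap.ext h)

/-! ### The character of the group on the volume form -/

section VolumeCharacter

variable {E : Type*} [NormedAddCommGroup E] [NormedSpace ℂ E] [FiniteDimensional ℂ E]
  {M : Type*} [TopologicalSpace M] [ConnectedSpace M] [ChartedSpace E M]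
  [IsManifold 𝓘(ℂ, E) ω M] [IsManifold 𝓘(ℝ, E) ∞ M] {n : ℕ} (C : CalabiYau E M n)
  {EH : Type*} [NormedAddCommGroup EH] [NormedSpace ℝ EH]
  {H : Type*} [TopologicalSpace H] [ConnectedSpace H] [ChartedSpace EH H] [Group H]
  [LieGroup 𝓘(ℝ, EH) ∞ H] [MulAction H M] [ContMDiffSMul 𝓘(ℝ, EH) 𝓘(ℝ, E) ∞ H M]
  {μ : M → Module.Dual ℝ (GroupLieAlgebra 𝓘(ℝ, EH) H)}

theorem norm_volumeCharacter_and_Omega_smul (hI : PreservesComplexStructure E M H)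
    (hμ : C.IsMomentMap μ) (h : H) :
    ‖C.volumeCharacter h‖ = 1 ∧ ∀ (p : M) (v : Fin n → TangentSpace 𝓘(ℝ, E) p),
      C.Omega (h • p) (fun i => mfderiv 𝓘(ℝ, E) 𝓘(ℝ, E) (fun q : M => h • q) p (v i)) =
        C.volumeCharacter h * C.Omega p v := by
  obtain ⟨z, hz, hzΩ⟩ := exists_norm_eq_one_volume_ratio C (contMDiff_smul_left EH h) (hI h)
    (omega_smul C hμ h)
  have h1 : ∀ (p : M) (v : Fin n → TangentSpace 𝓘(ℝ, E) p),
      C.Omega (h • p) (fun i => mfderiv 𝓘(ℝ, E) 𝓘(ℝ, E) (fun q : M => h • q) p (v i)) =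
        C.volumeCharacter h * C.Omega p v :=
    Classical.epsilon_spec (p := fun z : ℂ => ∀ (p : M) (v : Fin n → TangentSpace 𝓘(ℝ, E) p),
      C.Omega (h • p) (fun i => mfderiv 𝓘(ℝ, E) 𝓘(ℝ, E) (fun q : M => h • q) p (v i)) =
        z * C.Omega p v) ⟨z, hzΩ⟩
  refine ⟨?_, h1⟩
  obtain ⟨p⟩ : Nonempty M := inferInstance
  obtain ⟨v, hv⟩ := exists_Omega_apply_ne_zero C p
  rwa [← mul_right_cancel₀ hv ((hzΩ p v).symm.trans (h1 p v))]

theorem volumeCharacter_mul (hI : PreservesComplexStructure E M H)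
    (hμ : C.IsMomentMap μ) (g h : H) :
    C.volumeCharacter (g * h) = C.volumeCharacter g * C.volumeCharacter h := by
  obtain ⟨p⟩ : Nonempty M := inferInstance
  obtain ⟨v, hv⟩ := exists_Omega_apply_ne_zero C p
  refine mul_right_cancel₀ hv ?_
  rw [mul_assoc, ← (norm_volumeCharacter_and_Omega_smul C hI hμ h).2 p v,
    ← (norm_volumeCharacter_and_Omega_smul C hI hμ g).2,
    ← (norm_volumeCharacter_and_Omega_smul C hI hμ (g * h)).2]
  exact form_congr_point C.Omega (mul_smul g h p) fun i => mfderiv_smul_mul EH g h p (v i)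

/-- The character is the quotient of L_h^* Ω by Ω on one fixed tuple where Ω does not vanish, and
the numerator is differentiable in h. -/
theorem mdifferentiableAt_volumeCharacter_one (hI : PreservesComplexStructure E M H)
    (hμ : C.IsMomentMap μ) :
    MDifferentiableAt 𝓘(ℝ, EH) 𝓘(ℝ, ℂ) (fun h : H => C.volumeCharacter h) 1 := by
  obtain ⟨p⟩ : Nonempty M := inferInstance
  obtain ⟨v, hv⟩ := exists_Omega_apply_ne_zero C p
  have h1 := mdifferentiableAt_form_smul (EH := EH) (H := H) (α := C.Omega)
    (fun p => differentiableAt_formInChart_Omega C (mem_extChartAt_target p)) p v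
  have h2 : DifferentiableAt ℝ (fun z : ℂ => z * (C.Omega p v)⁻¹)
      (C.Omega ((1 : H) • p) (fun i => mfderiv 𝓘(ℝ, E) 𝓘(ℝ, E)
        (fun q : M => (1 : H) • q) p (v i))) := by fun_prop
  have h3 := h2.mdifferentiableAt.comp (1 : H) h1
  refine h3.congr_of_eventuallyEq (Filter.Eventually.of_forall fun h => ?_)
  simp only [Function.comp_apply]
  rw [(norm_volumeCharacter_and_Omega_smul C hI hμ h).2 p v, mul_inv_cancel_right₀ hv]

theorem volumeCharacter_one (hI : PreservesComplexStructure E M H) (hμ : C.IsMomentMap μ) :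
    C.volumeCharacter (1 : H) = 1 := by
  have h1 := volumeCharacter_mul C hI hμ 1 1
  have h2 : C.volumeCharacter (1 : H) ≠ 0 := fun h => by
    simpa [h] using (norm_volumeCharacter_and_Omega_smul C hI hμ 1).1
  rw [mul_one] at h1
  exact (mul_eq_left₀ h2).1 h1.symm

/-- The phase functional only records the imaginary part of the derivative. The real part vanishes
because the character has modulus one and equals 1 at the identity. -/
theorem hasMFDerivAt_volumeCharacter_one (hI : PreservesComplexStructure E M H)
    (hμ : C.IsMomentMap μ) (ha : C.phaseFunctional EH H = 0) :
    HasMFDerivAt 𝓘(ℝ, EH) 𝓘(ℝ, ℂ) (fun h : H => C.volumeCharacter h) 1 0 := by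
  have hd := (mdifferentiableAt_volumeCharacter_one C hI hμ).hasMFDerivAt
  refine hd.congr_mfderiv (ContinuousLinearMap.ext fun ξ => ?_)
  have h1 : (mfderiv 𝓘(ℝ, EH) 𝓘(ℝ, ℂ) (fun h : H => C.volumeCharacter h) 1 ξ : ℂ).im = 0 :=
    DFunLike.congr_fun ha ξ
  have h2 := (hasStrictFDerivAt_norm_sq (C.volumeCharacter (1 : H))).hasFDerivAt.hasMFDerivAt.comp
    (1 : H) hd
  have h3 : HasMFDerivAt 𝓘(ℝ, EH) 𝓘(ℝ, ℝ)
      ((fun z : ℂ => ‖z‖ ^ 2) ∘ fun h : H => C.volumeCharacter h) 1 0 := by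
    refine (hasMFDerivAt_const (1 : ℝ) (1 : H)).congr_of_eventuallyEq
      (Filter.Eventually.of_forall fun h => ?_)
    simp [(norm_volumeCharacter_and_Omega_smul C hI hμ h).1]
  have h4 := DFunLike.congr_fun (hasMFDerivAt_unique h2 h3) ξ
  obtain ⟨w, hw⟩ : ∃ w : ℂ, w = mfderiv 𝓘(ℝ, EH) 𝓘(ℝ, ℂ) (fun h : H => C.volumeCharacter h) 1 ξ :=
    ⟨_, rfl⟩
  have h5 : (2 • innerSL ℝ (C.volumeCharacter (1 : H))) w = 0 := by
    rw [hw]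
    exact h4
  rw [volumeCharacter_one C hI hμ] at h5
  rw [← hw] at h1 ⊢
  have h6 : w = 0 := Complex.ext (by simpa [Complex.inner] using h5) h1
  exact h6

theorem volumeCharacter_eq_one (hI : PreservesComplexStructure E M H)
    (hμ : C.IsMomentMap μ) (ha : C.phaseFunctional EH H = 0) (h : H) :
    C.volumeCharacter h = 1 := by
  have h1 : ∀ h : H, HasMFDerivAt 𝓘(ℝ, EH) 𝓘(ℝ, ℂ) (fun h : H => C.volumeCharacter h) h 0 := by
    intro h
    have h3 : MDifferentiableAt 𝓘(ℝ, EH) 𝓘(ℝ, EH) (fun g : H => g * h⁻¹) h :=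
      (contMDiff_mul_right (I := 𝓘(ℝ, EH)) (n := ∞) (a := h⁻¹)).mdifferentiableAt (by simp)
    have h5 := HasMFDerivAt.comp h
      (by rw [mul_inv_cancel]; exact hasMFDerivAt_volumeCharacter_one C hI hμ ha) h3.hasMFDerivAt
    have h6 : HasFDerivAt (fun z : ℂ => z * C.volumeCharacter h)
        (((ContinuousLinearMap.mul ℝ ℂ).flip (C.volumeCharacter h)))
        (C.volumeCharacter (h * h⁻¹)) :=
      ((ContinuousLinearMap.mul ℝ ℂ).flip (C.volumeCharacter h)).hasFDerivAt
    have h7 := h6.hasMFDerivAt.comp h h5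
    refine (h7.congr_of_eventuallyEq (Filter.Eventually.of_forall fun g => ?_)).congr_mfderiv ?_
    · simp only [Function.comp_apply]
      rw [← volumeCharacter_mul C hI hμ, inv_mul_cancel_right]
    · exact ContinuousLinearMap.ext fun ξ =>
        map_zero ((ContinuousLinearMap.mul ℝ ℂ).flip (C.volumeCharacter h))
  exact (eq_of_hasMFDerivAt_zero h1 h 1).trans (volumeCharacter_one C hI hμ)

theorem Omega_smul (hI : PreservesComplexStructure E M H)
    (hμ : C.IsMomentMap μ) (ha : C.phaseFunctional EH H = 0) (h : H) (p : M)
    (v : Fin n → TangentSpace 𝓘(ℝ, E) p) :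
    C.Omega (h • p) (fun i => mfderiv 𝓘(ℝ, E) 𝓘(ℝ, E) (fun q : M => h • q) p (v i)) =
      C.Omega p v := by
  rw [(norm_volumeCharacter_and_Omega_smul C hI hμ h).2, volumeCharacter_eq_one C hI hμ ha,
    one_mul]

end VolumeCharacter

/-! ### Linear algebra of Lagrangian subspaces -/

section LagrangianLinearAlgebra

variable {V : Type*} [NormedAddCommGroup V] [NormedSpace ℂ V]

/-- The bilinear form of an alternating form of degree two. -/
noncomputable def bilinOfTwoForm (σ : V [⋀^Fin 2]→ₗ[ℝ] ℝ) : V →ₗ[ℝ] V →ₗ[ℝ] ℝ :=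
  LinearMap.mk₂ ℝ (fun u v => σ ![u, v])
    (fun a b v => σ.map_vecCons_add ![v] a b)
    (fun r a v => σ.map_vecCons_smul ![v] r a)
    (fun u a b => by
      have h : ∀ x, Function.update ![u, a] 1 x = ![u, x] := fun x => by
        ext i; fin_cases i <;> rfl
      have h1 := σ.map_update_add ![u, a] 1 a b
      rwa [h, h, h] at h1)
    (fun r u a => by
      have h : ∀ x, Function.update ![u, a] 1 x = ![u, x] := fun x => by
        ext i; fin_cases i <;> rfl
      have h1 := σ.map_update_smul ![u, a] 1 r a
      rwa [h, h] at h1)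

theorem bilinOfTwoForm_self (σ : V [⋀^Fin 2]→ₗ[ℝ] ℝ) (u : V) : bilinOfTwoForm σ u u = 0 :=
  σ.map_eq_zero_of_eq ![u, u] (i := 0) (j := 1) rfl (by decide)

/-- Positivity makes B nondegenerate, so the B-orthogonal of L has half the real dimension. It
contains the isotropic L, which has the same dimension, so the two coincide. -/
theorem mem_of_isotropic_of_finrank [FiniteDimensional ℂ V] {B : V →ₗ[ℝ] V →ₗ[ℝ] ℝ} (hB : B.IsAlt)
    (hpos : ∀ v, v ≠ 0 → 0 < B v (Complex.I • v)) {L : Submodule ℝ V}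
    (hL : ∀ u ∈ L, ∀ v ∈ L, B u v = 0) (hfin : Module.finrank ℝ L = Module.finrank ℂ V) {u : V}
    (hu : ∀ v ∈ L, B u v = 0) : u ∈ L := by
  have : FiniteDimensional ℝ V := FiniteDimensional.complexToReal V
  have hnd : LinearMap.BilinForm.Nondegenerate B := by
    refine ⟨fun v hv => ?_, fun v hv => ?_⟩ <;> by_contra h
    · exact (hpos v h).ne' (hv _)
    · refine (hpos v h).ne' ?_
      rw [← hB.neg, hv, neg_zero]
  have h1 : LinearMap.BilinForm.orthogonal B L = L := by
    have hle : L ≤ LinearMap.BilinForm.orthogonal B L := fun v hv w hw => hL w hw v hv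
    refine (Submodule.eq_of_le_of_finrank_eq hle ?_).symm
    rw [LinearMap.BilinForm.finrank_orthogonal hnd, hfin, finrank_real_of_complex]
    omega
  rw [← h1]
  intro v hv
  change B v u = 0
  rw [← hB.neg, hu v hv, neg_zero]

/-- An orthonormal frame of a Lagrangian subspace `W` that splits along another Lagrangian subspace
`L` into a part of `L` and a part orthogonal to `L` can be turned into an orthonormal frame of
`L`. -/
theorem exists_frame_of_lagrangian [FiniteDimensional ℂ V] {n : ℕ}
    {B : V →ₗ[ℝ] V →ₗ[ℝ] ℝ} (hB : B.IsAlt)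
    (hII : ∀ u v, B (Complex.I • u) (Complex.I • v) = B u v)
    (hpos : ∀ v, v ≠ 0 → 0 < B v (Complex.I • v)) (hn : Module.finrank ℂ V = n)
    {a : V [⋀^Fin n]→ₗ[ℝ] ℂ} (ha : ∀ (v : Fin n → V) (i : Fin n),
      a (Function.update v i (Complex.I • v i)) = Complex.I * a v)
    {L P W : Submodule ℝ V} (hL : ∀ u ∈ L, ∀ v ∈ L, B u v = 0) (hLn : Module.finrank ℝ L = n)
    (hW : ∀ u ∈ W, ∀ v ∈ W, B u v = 0) (hWn : Module.finrank ℝ W = n) (hPL : P ≤ L) (hPW : P ≤ W)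
    (hsplit : ∀ w ∈ W, ∃ u ∈ P, ∀ t ∈ L, B (w - u) (Complex.I • t) = 0)
    {m : ℕ} (hm : m + Module.finrank ℝ P = n) {z : Fin n → V} (hzW : ∀ i, z i ∈ W)
    (hz : ∀ i j, B (z i) (Complex.I • z j) = if i = j then 1 else 0) :
    ∃ y : Fin n → V, (∀ i, y i ∈ L) ∧
      (∀ i j, B (y i) (Complex.I • y j) = if i = j then 1 else 0) ∧
      a y = (-Complex.I) ^ m * a z := by
  have : FiniteDimensional ℝ V := FiniteDimensional.complexToReal V
  -- The part of W that is metrically normal to L; the real inner product is B(u, √-1 v).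
  let N : Submodule ℝ W :=
    { carrier := {w | ∀ t ∈ L, B w (Complex.I • t) = 0}
      zero_mem' := fun t _ => by simp
      add_mem' := fun {x y} hx hy t ht => by simp [hx t ht, hy t ht]
      smul_mem' := fun r x hx t ht => by simp [hx t ht] }
  let Q : Submodule ℝ W := P.comap W.subtype
  have hcompl : IsCompl Q N := by
    refine IsCompl.of_eq ?_ ?_
    · rw [Submodule.eq_bot_iff]
      rintro ⟨w, hw⟩ ⟨h1, h2⟩
      by_contra h
      exact (hpos w fun h3 => h (Subtype.ext h3)).ne' (h2 w (hPL h1))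
    · rw [eq_top_iff]
      rintro ⟨w, hw⟩ -
      obtain ⟨u, hu, hut⟩ := hsplit w hw
      refine Submodule.mem_sup.2 ⟨⟨u, hPW hu⟩, hu, ⟨w - u, W.sub_mem hw (hPW hu)⟩, hut, ?_⟩
      exact Subtype.ext (by simp)
  set π : W →ₗ[ℝ] W := Q.projection N hcompl with hπ
  have hπP : ∀ w, (π w : V) ∈ P := fun w => Submodule.projection_apply_mem hcompl w
  have hπN : ∀ w, w - π w ∈ N := by
    intro w
    rw [← Submodule.projection_apply_eq_zero_iff hcompl, map_sub, ← hπ]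
    rw [show π (π w) = π w from
      Submodule.projection_apply_of_mem_left hcompl (Submodule.projection_apply_mem hcompl w),
      sub_self]
  -- The identity on P and multiplication by -√-1 on N.
  let A : W →ₗ[ℝ] V := W.subtype ∘ₗ π -
    ((Complex.I • LinearMap.id : V →ₗ[ℂ] V).restrictScalars ℝ) ∘ₗ W.subtype ∘ₗ (LinearMap.id - π)
  have hA : ∀ w, A w = (π w : V) - Complex.I • ((w - π w : W) : V) := fun w => rfl
  -- For w normal to L, √-1 w is B-orthogonal to L, hence in L.
  have hNL : ∀ w ∈ N, Complex.I • (w : V) ∈ L := by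
    intro w hw
    refine mem_of_isotropic_of_finrank hB hpos hL (hLn.trans hn.symm) fun t ht => ?_
    have h1 := hw t ht
    rw [← hII, smul_smul, Complex.I_mul_I, neg_one_smul, map_neg, neg_eq_zero] at h1
    exact h1
  have hAL : ∀ w, A w ∈ L := fun w => L.sub_mem (hPL (hπP w)) (hNL _ (hπN w))
  -- A is an isometry: P and N are orthogonal because P lies in L, and the new mixed terms pair P
  -- with N under B itself, which vanishes as W is isotropic.
  have hAA : ∀ w w', B (A w) (Complex.I • A w') = B (w : V) (Complex.I • (w' : V)) := by
    intro w w'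
    obtain ⟨v, hv⟩ : ∃ v, v = w - π w := ⟨_, rfl⟩
    obtain ⟨v', hv'⟩ : ∃ v', v' = w' - π w' := ⟨_, rfl⟩
    have hvN : v ∈ N := hv ▸ hπN w
    have hvN' : v' ∈ N := hv' ▸ hπN w'
    have e : (w : V) = π w + v := by rw [hv]; simp
    have e' : (w' : V) = π w' + v' := by rw [hv']; simp
    rw [hA, hA, ← hv, ← hv', e, e']
    have h1 : B (π w) (v' : V) = 0 := hW _ (π w).2 _ v'.2
    have h2 : B (v : V) (π w') = 0 := hW _ v.2 _ (π w').2
    have h3 : B (v : V) (Complex.I • (π w' : V)) = 0 := hvN _ (hPL (hπP w'))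
    have h4 : B (π w) (Complex.I • (v' : V)) = 0 := by
      rw [← hII, smul_smul, Complex.I_mul_I, neg_one_smul, map_neg, hB.neg]
      exact hvN' _ (hPL (hπP w))
    have h5 : B (Complex.I • (v : V)) (Complex.I • (π w' : V)) = 0 := by rw [hII, h2]
    have h6 : B (Complex.I • (v : V)) (v' : V) = - B (v : V) (Complex.I • (v' : V)) := by
      rw [← hII (v : V), smul_smul, Complex.I_mul_I, neg_one_smul, map_neg, neg_neg]
    simp only [map_sub, map_add, LinearMap.sub_apply, LinearMap.add_apply, smul_sub, smul_add,
      smul_smul, Complex.I_mul_I, neg_one_smul, map_neg, h1, h3, h4, h5, h6]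
    ring
  obtain ⟨b, hb⟩ := exists_complex_alternatingMap a ha
  let e : Module.Basis (Fin (Module.finrank ℝ Q) ⊕ Fin (Module.finrank ℝ N)) ℝ W :=
    ((Module.finBasis ℝ Q).prod (Module.finBasis ℝ N)).map (Submodule.prodEquivOfIsCompl Q N hcompl)
  let κ : Fin (Module.finrank ℝ Q) ⊕ Fin (Module.finrank ℝ N) → ℂ :=
    Sum.elim (fun _ => 1) (fun _ => -Complex.I)
  have hAe : ∀ j, A (e j) = κ j • (e j : V) := by
    rintro (j | j)
    · have h1 : e (Sum.inl j) = (Module.finBasis ℝ Q j : W) := by simp [e]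
      have h2 : π (e (Sum.inl j)) = e (Sum.inl j) :=
        Submodule.projection_apply_of_mem_left hcompl (by rw [h1]; exact Subtype.property _)
      rw [hA, h2]
      simp [κ]
    · have h1 : e (Sum.inr j) = (Module.finBasis ℝ N j : W) := by simp [e]
      have h2 : π (e (Sum.inr j)) = 0 :=
        (Submodule.projection_apply_eq_zero_iff hcompl).2 (by rw [h1]; exact Subtype.property _)
      rw [hA, h2]
      simp [κ]
  have hQ : Module.finrank ℝ Q = Module.finrank ℝ P :=
    (Submodule.comapSubtypeEquivOfLe hPW).finrank_eq
  have hQN : Module.finrank ℝ Q + Module.finrank ℝ N = n := by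
    rw [Submodule.finrank_add_eq_of_isCompl hcompl, hWn]
  have hNm : Module.finrank ℝ N = m := by omega
  -- In a basis adapted to P ⊕ N the map A is diagonal with entries `κ`. An injective n-tuple of
  -- basis indices is a bijection, so complex multilinearity extracts each entry exactly once.
  have hext : a.compLinearMap A = (-Complex.I) ^ m • a.compLinearMap W.subtype := by
    refine Module.Basis.ext_alternating e fun v hv => ?_
    have hbij : Function.Bijective v :=
      (Fintype.bijective_iff_injective_and_card v).2 ⟨hv, by simp [hQN]⟩
    simp only [AlternatingMap.compLinearMap_apply, AlternatingMap.smul_apply, smul_eq_mul,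
      Submodule.subtype_apply, hAe]
    rw [← hb, ← hb, AlternatingMap.map_smul_univ, smul_eq_mul,
      Function.Bijective.prod_comp hbij κ, Fintype.prod_sum_type]
    simp [κ, hNm]
  refine ⟨fun i => A ⟨z i, hzW i⟩, fun i => hAL _, fun i j => ?_, ?_⟩
  · rw [hAA]
    exact hz i j
  · exact DFunLike.congr_fun hext fun i => (⟨z i, hzW i⟩ : W)

end LagrangianLinearAlgebra

/-! ### Tangent spaces of nested submanifolds -/

section Submanifolds

variable {E : Type*} [NormedAddCommGroup E] [NormedSpace ℂ E]
  {M : Type*} [TopologicalSpace M] [ChartedSpace E M]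

/-- Since `V` and `L` carry the subspace topology, the inclusion of `V` in `L` is continuous and
agrees locally with a smooth retraction of `M` to `L` restricted to `V`. It is therefore
differentiable, and the chain rule applies. -/
theorem tangentSubspace_mono [FiniteDimensional ℝ E]
    {EL : Type*} [NormedAddCommGroup EL] [NormedSpace ℝ EL] [FiniteDimensional ℝ EL]
    {L : Set M} [ChartedSpace EL L] [IsManifold 𝓘(ℝ, EL) ∞ L]
    {EV : Type*} [NormedAddCommGroup EV] [NormedSpace ℝ EV]
    {V : Set M} [ChartedSpace EV V]
    (hL : IsSmoothImmersion 𝓘(ℝ, EL) 𝓘(ℝ, E) (Subtype.val : L → M))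
    (hV : ContMDiff 𝓘(ℝ, EV) 𝓘(ℝ, E) ∞ (Subtype.val : V → M)) (hVL : V ⊆ L) (p : V) :
    tangentSubspace (E := E) EV V p ≤ tangentSubspace (E := E) EL L (Set.inclusion hVL p) := by
  obtain ⟨r, hr, hrl⟩ := (hL.1 (Set.inclusion hVL p)).exists_local_retraction (hL.2 _)
  have hv : MDifferentiableAt 𝓘(ℝ, EV) 𝓘(ℝ, E) (Subtype.val : V → M) p :=
    hV.mdifferentiableAt (by simp)
  have h1 : MDifferentiableAt 𝓘(ℝ, EV) 𝓘(ℝ, EL) (Set.inclusion hVL) p := by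
    have h2 : MDifferentiableAt 𝓘(ℝ, EV) 𝓘(ℝ, EL) (r ∘ (Subtype.val : V → M)) p :=
      (hr.mdifferentiableAt (by simp)).comp p hv
    refine h2.congr_of_eventuallyEq ?_
    filter_upwards [(continuous_inclusion hVL).continuousAt.eventually hrl] with y hy
    exact hy.symm
  rintro _ ⟨v, rfl⟩
  refine ⟨mfderiv 𝓘(ℝ, EV) 𝓘(ℝ, EL) (Set.inclusion hVL) p v, ?_⟩
  exact (mfderiv_comp_apply p ((hL.1 _).mdifferentiableAt (by simp)) h1 v).symm

end Submanifolds

/-! ### The tangent spaces of the orbit map -/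

section OrbitMap

variable {E : Type*} [NormedAddCommGroup E] [NormedSpace ℂ E]
  {M : Type*} [TopologicalSpace M] [ChartedSpace E M]
  {EH : Type*} [NormedAddCommGroup EH] [NormedSpace ℝ EH]
  {H : Type*} [TopologicalSpace H] [ChartedSpace EH H] [Group H]
  [MulAction H M]
  {EV : Type*} [NormedAddCommGroup EV] [NormedSpace ℝ EV]
  {V : Set M} [ChartedSpace EV V]

variable (EH H) in
/-- The sum of the infinitesimal action and the differential of the inclusion of a submanifold. -/
noncomputable def orbitTangentMap (p : V) : EH × EV →L[ℝ] E :=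
  ContinuousLinearMap.coprod (R := ℝ) (M₁ := EH) (M₂ := EV) (M := E)
    (mfderiv 𝓘(ℝ, EH) 𝓘(ℝ, E) (fun h : H => h • (p : M)) 1)
    (mfderiv 𝓘(ℝ, EV) 𝓘(ℝ, E) (Subtype.val : V → M) p)

theorem orbitTangentMap_apply (p : V) (ξ : GroupLieAlgebra 𝓘(ℝ, EH) H)
    (v : TangentSpace 𝓘(ℝ, EV) p) {a b : E} (ha : a = fundamentalVector ξ (p : M))
    (hb : b = mfderiv 𝓘(ℝ, EV) 𝓘(ℝ, E) (Subtype.val : V → M) p v) :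
    orbitTangentMap (E := E) (EV := EV) EH H p (ξ, v) = a + b := by
  subst ha hb
  rfl

variable (EH H EV) in
/-- The sum of the tangent spaces of the orbit through `p` and of the submanifold. -/
noncomputable def orbitTangentSubspace (p : V) : Submodule ℝ E :=
  LinearMap.range (orbitTangentMap (EV := EV) EH H p).toLinearMap

/-- By the moment map equation, ω(ξ^#, ·) is minus the derivative of ⟨μ, ξ⟩, which is constant along
`V` and, as `c` is fixed by the coadjoint action, along the orbit of p. The remaining pairing,
within the tangent space of `V`, is `hVω`. -/
theorem omega_eq_zero_of_mem_orbitTangentSubspace [IsManifold 𝓘(ℝ, E) ∞ M]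
    [LieGroup 𝓘(ℝ, EH) ∞ H] [ContMDiffSMul 𝓘(ℝ, EH) 𝓘(ℝ, E) ∞ H M]
    {n : ℕ} (C : CalabiYau E M n)
    {μ : M → Module.Dual ℝ (GroupLieAlgebra 𝓘(ℝ, EH) H)} (hμ : C.IsMomentMap μ)
    {c : Module.Dual ℝ (GroupLieAlgebra 𝓘(ℝ, EH) H)} (hc : c ∈ coadjointCenter EH H)
    (hV : ContMDiff 𝓘(ℝ, EV) 𝓘(ℝ, E) ∞ (Subtype.val : V → M)) (hVμ : ∀ p ∈ V, μ p = c) (p : V)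
    (hVω : ∀ u ∈ tangentSubspace (E := E) EV V p, ∀ v ∈ tangentSubspace (E := E) EV V p,
      C.omega p ![u, v] = 0) {u v : E} (hu : u ∈ orbitTangentSubspace EH H EV p)
    (hv : v ∈ orbitTangentSubspace EH H EV p) :
    bilinOfTwoForm (V := E) (C.omega p).toAlternatingMap u v = 0 := by
  obtain ⟨B, hB⟩ : ∃ B : E →ₗ[ℝ] E →ₗ[ℝ] ℝ,
    B = bilinOfTwoForm (V := E) (C.omega p).toAlternatingMap := ⟨_, rfl⟩
  have hBω : ∀ u v : E, B u v = C.omega p ![u, v] := fun u v => by rw [hB]; rfl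
  have hBa : B.IsAlt := hB ▸ bilinOfTwoForm_self _
  obtain ⟨⟨ξ, x⟩, rfl⟩ := hu
  obtain ⟨⟨η, y⟩, rfl⟩ := hv
  have hmd : ∀ ξ : GroupLieAlgebra 𝓘(ℝ, EH) H,
      MDifferentiableAt 𝓘(ℝ, E) 𝓘(ℝ, ℝ) (fun q => μ q ξ) p := fun ξ =>
    (hμ.smooth ξ).mdifferentiableAt (by simp)
  have h1 : ∀ (ξ : GroupLieAlgebra 𝓘(ℝ, EH) H) (y : TangentSpace 𝓘(ℝ, EV) p) {a b : E},
      a = fundamentalVector ξ (p : M) →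
      b = mfderiv 𝓘(ℝ, EV) 𝓘(ℝ, E) (Subtype.val : V → M) p y → B a b = 0 := by
    rintro ξ y a b rfl rfl
    have h2 := mfderiv_comp_apply p (hmd ξ) (hV.mdifferentiableAt (by simp)) y
    have h3 : (fun q => μ q ξ) ∘ (Subtype.val : V → M) = fun _ => c ξ := by
      ext q
      simp [hVμ q q.2]
    rw [h3, mfderiv_const] at h2
    have h4 := h2.trans (hμ.deriv_eq ξ p _)
    exact (hBω _ _).trans (neg_eq_zero.1 h4.symm)
  have h3 : ∀ (h : H) (ξ : GroupLieAlgebra 𝓘(ℝ, EH) H), μ (h • (p : M)) ξ = c ξ := by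
    intro h ξ
    rw [hμ.equivariant, hVμ p p.2, hc]
  have h2 : ∀ {a b : E}, a = fundamentalVector (H := H) ξ (p : M) →
      b = fundamentalVector (H := H) η (p : M) →
      B a b = 0 := by
    rintro a b rfl rfl
    have h2 := mfderiv_comp_apply_of_eq (x := (1 : H)) (y := (p : M)) (hmd ξ)
      (mdifferentiableAt_orbit (E := E) (EH := EH) (1 : H) (p : M)) (one_smul _ _) η
    have h3 : (fun q => μ q ξ) ∘ (fun h : H => h • (p : M)) = fun _ => c ξ := by
      ext q
      exact h3 q ξ
    rw [h3, mfderiv_const] at h2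
    have h4 := h2.trans (hμ.deriv_eq ξ p _)
    exact (hBω _ _).trans (neg_eq_zero.1 h4.symm)
  obtain ⟨a, ha⟩ : ∃ a : E, a = fundamentalVector (H := H) ξ (p : M) := ⟨_, rfl⟩
  obtain ⟨a', ha'⟩ : ∃ a : E, a = fundamentalVector (H := H) η (p : M) := ⟨_, rfl⟩
  obtain ⟨b, hb⟩ : ∃ b : E, b = mfderiv 𝓘(ℝ, EV) 𝓘(ℝ, E) (Subtype.val : V → M) p x := ⟨_, rfl⟩
  obtain ⟨b', hb'⟩ : ∃ b : E, b = mfderiv 𝓘(ℝ, EV) 𝓘(ℝ, E) (Subtype.val : V → M) p y := ⟨_, rfl⟩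
  have h3 : B b b' = 0 := (hBω b b').trans (hVω b ⟨x, hb.symm⟩ b' ⟨y, hb'.symm⟩)
  rw [← hB]
  change B (orbitTangentMap (E := E) (EV := EV) EH H p (ξ, x))
    (orbitTangentMap (E := E) (EV := EV) EH H p (η, y)) = 0
  rw [orbitTangentMap_apply p ξ x ha hb, orbitTangentMap_apply p η y ha' hb', map_add, map_add,
    LinearMap.add_apply, LinearMap.add_apply, h1 ξ y ha hb', h2 ha ha', ← hBa.neg a' b,
    h1 η x ha' hb, h3]
  simp

variable [LieGroup 𝓘(ℝ, EH) ∞ H]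
  [ContMDiffSMul 𝓘(ℝ, EH) 𝓘(ℝ, E) ∞ H M]
  {K : Subgroup H} (hK : ∀ p ∈ V, MulAction.stabilizer H p = K)
  {EQ : Type*} [NormedAddCommGroup EQ] [NormedSpace ℝ EQ] [FiniteDimensional ℝ EQ]
  [ChartedSpace EQ (H ⧸ K)]

theorem map_orbitTangentSubspace
    (hV : ContMDiff 𝓘(ℝ, EV) 𝓘(ℝ, E) ∞ (Subtype.val : V → M))
    (hQ : IsSmoothSubmersion 𝓘(ℝ, EH) 𝓘(ℝ, EQ) (QuotientGroup.mk : H → H ⧸ K))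
    (h : H) (p : V) :
    (orbitTangentSubspace (E := E) EH H EV p).map
        (mfderiv 𝓘(ℝ, E) 𝓘(ℝ, E) (fun q : M => h • q) (p : M) : E →L[ℝ] E).toLinearMap =
      LinearMap.range (mfderiv (𝓘(ℝ, EQ).prod 𝓘(ℝ, EV)) 𝓘(ℝ, E) (orbitMap hK)
        ((QuotientGroup.mk h : H ⧸ K), p) : EQ × EV →L[ℝ] E).toLinearMap := by
  apply le_antisymm
  · rintro _ ⟨w, hw, rfl⟩
    obtain ⟨⟨ξ, v⟩, rfl⟩ := hw
    exact ⟨_, mfderiv_orbitMap (E := E) hK hV hQ h p ξ v⟩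
  · rintro _ ⟨⟨X, v⟩, rfl⟩
    obtain ⟨X', rfl⟩ := hQ.2 h X
    obtain ⟨ξ, rfl⟩ := mulInvariantVectorField_surjective h X'
    exact ⟨_, ⟨(ξ, v), rfl⟩, (mfderiv_orbitMap (E := E) hK hV hQ h p ξ v).symm⟩

variable [IsManifold 𝓘(ℝ, E) ∞ M] [CompleteSpace EH]

/-- A kernel vector, lifted to (ξ, v), satisfies ξ^# + v = 0 because translation by h is injective
on tangent vectors. Then `htrans` gives ξ^# = 0 and so v = 0, while ξ projects to zero in `H ⧸ K`.
-/
theorem mfderiv_orbitMap_injective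
    (hV : IsSmoothImmersion 𝓘(ℝ, EV) 𝓘(ℝ, E) (Subtype.val : V → M))
    (hQ : IsSmoothSubmersion 𝓘(ℝ, EH) 𝓘(ℝ, EQ) (QuotientGroup.mk : H → H ⧸ K))
    (h : H) (p : V)
    (htrans : ∀ ξ : GroupLieAlgebra 𝓘(ℝ, EH) H,
      fundamentalVector ξ (p : M) ∈ tangentSubspace (E := E) EV V p →
        fundamentalVector (E := E) ξ (p : M) = 0) :
    Function.Injective (mfderiv (𝓘(ℝ, EQ).prod 𝓘(ℝ, EV)) 𝓘(ℝ, E) (orbitMap hK)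
      ((QuotientGroup.mk h : H ⧸ K), p)) := by
  refine (injective_iff_map_eq_zero _).2 ?_
  rintro ⟨X, v⟩ hX
  obtain ⟨X', rfl⟩ := hQ.2 h X
  obtain ⟨ξ, rfl⟩ := mulInvariantVectorField_surjective h X'
  have h1 := (mfderiv_orbitMap hK hV.1 hQ h p ξ v).symm.trans hX
  have h2 := mfderiv_smul_injective EH h (p : M) (h1.trans (map_zero _).symm)
  have h3 : fundamentalVector (E := E) ξ (p : M) = 0 :=
    htrans ξ ⟨-v, (map_neg (mfderiv 𝓘(ℝ, EV) 𝓘(ℝ, E) (Subtype.val : V → M) p) v).trans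
      (eq_neg_of_add_eq_zero_left h2).symm⟩
  have h4 : v = 0 := hV.2 p ((neg_eq_zero.1
    ((eq_neg_of_add_eq_zero_left h2).symm.trans h3)).trans (map_zero _).symm)
  have h5 := mfderiv_mk_eq_zero (hK p p.2) h (hQ.1.mdifferentiableAt (by simp)) h3
  exact Prod.ext h5 h4

/-- Compare with the injective differential of the orbit map at h = 1, whose domain has the
dimension on the right. -/
theorem finrank_orbitTangentSubspace [FiniteDimensional ℝ EV]
    (hK : ∀ p ∈ V, MulAction.stabilizer H p = K)
    (hV : IsSmoothImmersion 𝓘(ℝ, EV) 𝓘(ℝ, E) (Subtype.val : V → M))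
    (hQ : IsSmoothSubmersion 𝓘(ℝ, EH) 𝓘(ℝ, EQ) (QuotientGroup.mk : H → H ⧸ K)) (p : V)
    (htrans : ∀ ξ : GroupLieAlgebra 𝓘(ℝ, EH) H,
      fundamentalVector ξ (p : M) ∈ tangentSubspace (E := E) EV V p →
        fundamentalVector (E := E) ξ (p : M) = 0) :
    Module.finrank ℝ (orbitTangentSubspace (E := E) EH H EV p) =
      Module.finrank ℝ EQ + Module.finrank ℝ EV := by
  have h1 := map_orbitTangentSubspace hK hV.1 hQ 1 p
  obtain ⟨d, T, hd, hT, hW⟩ : ∃ (d : EQ × EV →ₗ[ℝ] E) (T : E →ₗ[ℝ] E), Function.Injective d ∧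
      Function.Injective T ∧ (orbitTangentSubspace (E := E) EH H EV p).map T = LinearMap.range d :=
    ⟨_, _, mfderiv_orbitMap_injective hK hV hQ 1 p htrans,
      mfderiv_smul_injective EH (1 : H) (p : M), h1⟩
  rw [← Module.finrank_prod, ← LinearMap.finrank_range_of_inj hd, ← hW]
  exact (Submodule.equivMapOfInjective T hT _).finrank_eq

end OrbitMap

theorem finrank_tangentSubspace {E : Type*} [NormedAddCommGroup E] [NormedSpace ℂ E]
    {M : Type*} [TopologicalSpace M] [ChartedSpace E M]
    {ES : Type*} [NormedAddCommGroup ES] [NormedSpace ℝ ES] {S : Set M} [ChartedSpace ES S]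
    (hS : IsSmoothImmersion 𝓘(ℝ, ES) 𝓘(ℝ, E) (Subtype.val : S → M)) (p : S) :
    Module.finrank ℝ (tangentSubspace (E := E) ES S p) = Module.finrank ℝ ES :=
  LinearMap.finrank_range_of_inj (hS.2 p)

theorem exp_I_mul_add_half_pi (θ : ℝ) (m : ℕ) :
    Complex.exp (Complex.I * ((θ + m * (Real.pi / 2) : ℝ) : ℂ)) =
      Complex.I ^ m * Complex.exp (Complex.I * θ) := by
  push_cast
  rw [mul_add, Complex.exp_add, mul_comm (Complex.exp _)]
  congr 1
  rw [show Complex.I * ((m : ℂ) * (Real.pi / 2)) = m * (Real.pi / 2 * Complex.I) by ring,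
    Complex.exp_nat_mul, Complex.exp_pi_div_two_mul_I]

theorem omega_eq_zero_of_mem_tangentSubspace {E : Type*} [NormedAddCommGroup E] [NormedSpace ℂ E]
    {M : Type*} [TopologicalSpace M] [ChartedSpace E M] {n : ℕ} (C : CalabiYau E M n)
    {EL : Type*} [NormedAddCommGroup EL] [NormedSpace ℝ EL] {L : Set M} [ChartedSpace EL L]
    (hL : C.IsLagrangianImmersion 𝓘(ℝ, EL) (Subtype.val : L → M)) (x : L)
    {u v : TangentSpace 𝓘(ℝ, E) (x : M)} (hu : u ∈ tangentSubspace (E := E) EL L x)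
    (hv : v ∈ tangentSubspace (E := E) EL L x) : C.omega (x : M) ![u, v] = 0 := by
  obtain ⟨u, rfl⟩ := hu
  obtain ⟨v, rfl⟩ := hv
  exact hL.2.2 x u v

/-! ### The Lagrangian angle along the submanifold -/

section PhaseOfOrbit

variable {E : Type*} [NormedAddCommGroup E] [NormedSpace ℂ E] [FiniteDimensional ℂ E]
  {M : Type*} [TopologicalSpace M] [ChartedSpace E M]
  {n : ℕ} (C : CalabiYau E M n)
  {EH : Type*} [NormedAddCommGroup EH] [NormedSpace ℝ EH]
  {H : Type*} [TopologicalSpace H] [ChartedSpace EH H] [Group H] [MulAction H M]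
  {EL : Type*} [NormedAddCommGroup EL] [NormedSpace ℝ EL] [FiniteDimensional ℝ EL]
  {L : Set M} [ChartedSpace EL L] [IsManifold 𝓘(ℝ, EL) ∞ L]
  {EV : Type*} [NormedAddCommGroup EV] [NormedSpace ℝ EV]
  {V : Set M} [ChartedSpace EV V]

/-- Turning an orthonormal frame of W into one of the tangent space of `L` costs (-√-1)^m, where m
counts the directions normal to `L`; undoing it adds a quarter turn to θ for each of them. -/
theorem Omega_apply_of_orbitTangentSubspace
    (hL : C.IsLagrangianImmersion 𝓘(ℝ, EL) (Subtype.val : L → M))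
    (hV : IsSmoothImmersion 𝓘(ℝ, EV) 𝓘(ℝ, E) (Subtype.val : V → M)) (hVL : V ⊆ L) (p : V)
    {θ : ℝ} (hθ : C.IsLagrangianAngleAt 𝓘(ℝ, EL) (Subtype.val : L → M) (Set.inclusion hVL p) θ)
    (hperp : ∀ ξ : GroupLieAlgebra 𝓘(ℝ, EH) H, fundamentalVector ξ (p : M) ∈
      C.normalSubspace EL L (Set.inclusion hVL p) ⊔ tangentSubspace EV V p)
    (hW : ∀ u ∈ orbitTangentSubspace (E := E) EH H EV p,
      ∀ v ∈ orbitTangentSubspace (E := E) EH H EV p,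
      bilinOfTwoForm (V := E) (C.omega p).toAlternatingMap u v = 0)
    (hWn : Module.finrank ℝ (orbitTangentSubspace (E := E) EH H EV p) = n)
    {m : ℕ} (hm : m + Module.finrank ℝ EV = n) {z : Fin n → TangentSpace 𝓘(ℝ, E) (p : M)}
    (hzW : ∀ i, z i ∈ orbitTangentSubspace (E := E) EH H EV p)
    (hz : ∀ i j, C.metric (p : M) (z i) (z j) = if i = j then 1 else 0) :
    C.Omega (p : M) z = Complex.exp (Complex.I * ((θ + m * (Real.pi / 2) : ℝ) : ℂ)) ∨
    C.Omega (p : M) z = -Complex.exp (Complex.I * ((θ + m * (Real.pi / 2) : ℝ) : ℂ)) := by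
  have : FiniteDimensional ℝ E := FiniteDimensional.complexToReal E
  set B : E →ₗ[ℝ] E →ₗ[ℝ] ℝ := bilinOfTwoForm (V := E) (C.omega p).toAlternatingMap with hB
  have hPL := tangentSubspace_mono hL.1 hV.1 hVL p
  obtain ⟨TL, hTL⟩ : ∃ TL : Submodule ℝ E,
    TL = tangentSubspace (E := E) EL L (Set.inclusion hVL p) := ⟨_, rfl⟩
  obtain ⟨TV, hTV⟩ : ∃ TV : Submodule ℝ E, TV = tangentSubspace (E := E) EV V p := ⟨_, rfl⟩
  -- Only ξ^# has to be split, by `hperp`; its tangential part is absorbed into the vector along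
  -- `V`.
  have hsplit : ∀ w ∈ orbitTangentSubspace (E := E) EH H EV p,
      ∃ u ∈ TV, ∀ t ∈ TL, B (w - u) (Complex.I • t) = 0 := by
    rintro _ ⟨⟨ξ, v⟩, rfl⟩
    obtain ⟨a, b, ha, hb, hab⟩ : ∃ a b : E, (∀ t ∈ TL, B a (Complex.I • t) = 0) ∧ b ∈ TV ∧
        a + b = fundamentalVector (H := H) ξ (p : M) := by
      obtain ⟨a, ha, b, hb, hab⟩ := Submodule.mem_sup.1 (hperp ξ)
      subst hTL hTV
      exact ⟨a, b, ha, hb, hab⟩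
    obtain ⟨b', hb'⟩ : ∃ b' : E, b' = mfderiv 𝓘(ℝ, EV) 𝓘(ℝ, E) (Subtype.val : V → M) p v :=
      ⟨_, rfl⟩
    refine ⟨b + b', TV.add_mem hb (hTV ▸ ⟨v, hb'.symm⟩), fun t ht => ?_⟩
    change B (orbitTangentMap (E := E) (EV := EV) EH H p (ξ, v) - (b + b')) (Complex.I • t) = 0
    rw [orbitTangentMap_apply p ξ v hab hb', show a + b + b' - (b + b') = a by abel]
    exact ha t ht
  subst hTL hTV
  obtain ⟨y, hyL, hy, hyz⟩ := exists_frame_of_lagrangian (V := E) (B := B)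
    (a := (C.Omega p).toAlternatingMap)
    (L := tangentSubspace (E := E) EL L (Set.inclusion hVL p))
    (P := tangentSubspace (E := E) EV V p)
    (W := orbitTangentSubspace (E := E) EH H EV p) (m := m) (z := z)
    (bilinOfTwoForm_self _) (C.omega_I_I p) (C.omega_pos p) C.finrank_eq (C.Omega_type p)
    (fun u hu v hv => omega_eq_zero_of_mem_tangentSubspace C hL _ hu hv)
    ((finrank_tangentSubspace hL.1 _).trans hL.2.1) hW hWn hPL
    (by
      rintro _ ⟨v, rfl⟩
      exact ⟨(0, v), (orbitTangentMap_apply (E := E) (H := H) p 0 v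
        (map_zero (mfderiv 𝓘(ℝ, EH) 𝓘(ℝ, E) (fun h : H => h • (p : M)) 1)).symm rfl).trans
          (zero_add _)⟩)
    hsplit (hm ▸ congrArg (m + ·) (finrank_tangentSubspace hV p)) hzW hz
  choose l hl using hyL
  have h1 : C.Omega (p : M) z = Complex.I ^ m * C.Omega (p : M) y := by
    refine Eq.trans ?_ (congrArg (Complex.I ^ m * ·) hyz.symm)
    change C.Omega (p : M) z = Complex.I ^ m * ((-Complex.I) ^ m * C.Omega (p : M) z)
    rw [← mul_assoc, ← mul_pow]
    simp
  have h2 := hθ l (by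
    intro i j
    refine Eq.trans ?_ (hy i j)
    exact congrArg₂ (fun u v : E => B u (Complex.I • v)) (hl i) (hl j))
  have h3 : C.Omega ((Set.inclusion hVL p : L) : M) (fun i => mfderiv 𝓘(ℝ, EL) 𝓘(ℝ, E)
      (Subtype.val : L → M) (Set.inclusion hVL p) (l i)) = C.Omega (p : M) y :=
    form_congr_point C.Omega rfl hl
  rw [h3] at h2
  rw [h1, exp_I_mul_add_half_pi]
  rcases h2 with h2 | h2
  · exact Or.inl (by rw [h2])
  · exact Or.inr (by rw [h2, mul_neg])

end PhaseOfOrbit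

/-! ### Invariance of the metric and the special Lagrangian immersion -/

section SmulForms

variable {E : Type*} [NormedAddCommGroup E] [NormedSpace ℂ E]
  {M : Type*} [TopologicalSpace M] [ChartedSpace E M] [IsManifold 𝓘(ℝ, E) ∞ M]
  {n : ℕ} (C : CalabiYau E M n)
  {EH : Type*} [NormedAddCommGroup EH] [NormedSpace ℝ EH]
  {H : Type*} [TopologicalSpace H] [PreconnectedSpace H] [ChartedSpace EH H] [Group H]
  [LieGroup 𝓘(ℝ, EH) ∞ H] [MulAction H M] [ContMDiffSMul 𝓘(ℝ, EH) 𝓘(ℝ, E) ∞ H M]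
  {μ : M → Module.Dual ℝ (GroupLieAlgebra 𝓘(ℝ, EH) H)}

theorem omega_smul_pair (hμ : C.IsMomentMap μ) (h : H) (p : M) (u v : TangentSpace 𝓘(ℝ, E) p) :
    C.omega (h • p) ![mfderiv 𝓘(ℝ, E) 𝓘(ℝ, E) (fun q : M => h • q) p u,
      mfderiv 𝓘(ℝ, E) 𝓘(ℝ, E) (fun q : M => h • q) p v] = C.omega p ![u, v] := by
  refine Eq.trans (form_congr_point C.omega rfl fun i => ?_) (omega_smul C hμ h p ![u, v])
  fin_cases i <;> rfl

theorem metric_smul (hI : PreservesComplexStructure E M H) (hμ : C.IsMomentMap μ) (h : H) (p : M)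
    (u v : TangentSpace 𝓘(ℝ, E) p) :
    C.metric (h • p) (mfderiv 𝓘(ℝ, E) 𝓘(ℝ, E) (fun q : M => h • q) p u)
      (mfderiv 𝓘(ℝ, E) 𝓘(ℝ, E) (fun q : M => h • q) p v) = C.metric p u v := by
  refine Eq.trans (form_congr_point C.omega rfl fun i => ?_)
    (omega_smul_pair C hμ h p u (complexStructure p v))
  fin_cases i
  · rfl
  · exact (hI h p v).symm

end SmulForms

theorem corollary4p8
    {n : ℕ}
    -- the connected Calabi-Yau manifold
    {E : Type*} [NormedAddCommGroup E] [NormedSpace ℂ E] [FiniteDimensional ℂ E]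
    {M : Type*} [TopologicalSpace M] [T2Space M] [ConnectedSpace M] [ChartedSpace E M]
    [IsManifold 𝓘(ℂ, E) ω M] (C : CalabiYau E M n)
    -- the connected Lie group and its smooth action
    {EH : Type*} [NormedAddCommGroup EH] [NormedSpace ℝ EH] [FiniteDimensional ℝ EH]
    {H : Type*} [TopologicalSpace H] [ConnectedSpace H] [ChartedSpace EH H] [Group H]
    [LieGroup 𝓘(ℝ, EH) ∞ H] [MulAction H M] [ContMDiffSMul 𝓘(ℝ, EH) 𝓘(ℝ, E) ∞ H M]
    (hI : PreservesComplexStructure E M H)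
    (μ : M → Module.Dual ℝ (GroupLieAlgebra 𝓘(ℝ, EH) H)) (hμ : C.IsMomentMap μ)
    -- the Lagrangian submanifold and its Lagrangian angle
    {EL : Type*} [NormedAddCommGroup EL] [NormedSpace ℝ EL] [FiniteDimensional ℝ EL]
    (L : Set M) [ChartedSpace EL L] [IsManifold 𝓘(ℝ, EL) ∞ L]
    (hL : C.IsLagrangianImmersion 𝓘(ℝ, EL) (Subtype.val : L → M))
    (θ : L → ℝ) (hθ : ∀ x : L, C.IsLagrangianAngleAt 𝓘(ℝ, EL) (Subtype.val : L → M) x (θ x))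
    -- the submanifold of the level set
    (c : Module.Dual ℝ (GroupLieAlgebra 𝓘(ℝ, EH) H))
    {EV : Type*} [NormedAddCommGroup EV] [NormedSpace ℝ EV] [FiniteDimensional ℝ EV]
    (V : Set M) [ChartedSpace EV V] [IsManifold 𝓘(ℝ, EV) ∞ V]
    (hV : IsSmoothImmersion 𝓘(ℝ, EV) 𝓘(ℝ, E) (Subtype.val : V → M))
    (hVμ : ∀ p ∈ V, μ p = c) (hVL : V ⊆ L)
    -- the isotropy subgroup, and the homogeneous space with its standard smooth structure,
    -- the one for which the projection is a submersion
    (K : Subgroup H) (hK : ∀ p ∈ V, MulAction.stabilizer H p = K)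
    {EQ : Type*} [NormedAddCommGroup EQ] [NormedSpace ℝ EQ] [FiniteDimensional ℝ EQ]
    [ChartedSpace EQ (H ⧸ K)] [IsManifold 𝓘(ℝ, EQ) ∞ (H ⧸ K)]
    (hQ : IsSmoothSubmersion 𝓘(ℝ, EH) 𝓘(ℝ, EQ) (QuotientGroup.mk : H → H ⧸ K))
    (hc : c ∈ coadjointCenter EH H)
    (hdim : Module.finrank ℝ EQ + Module.finrank ℝ EV = n)
    -- the generalised perpendicularity along the submanifold
    (hperp : ∀ (p : M) (hp : p ∈ V) (ξ : GroupLieAlgebra 𝓘(ℝ, EH) H),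
      fundamentalVector ξ p ∈ C.normalSubspace EL L ⟨p, hVL hp⟩ ⊔ tangentSubspace EV V ⟨p, hp⟩)
    (htrans : ∀ (p : M) (hp : p ∈ V) (ξ : GroupLieAlgebra 𝓘(ℝ, EH) H),
      fundamentalVector ξ p ∈ tangentSubspace (E := E) EV V ⟨p, hp⟩ →
        fundamentalVector (E := E) ξ p = 0)
    -- constant angle along the submanifold, and vanishing phase functional
    (hconst : ∃ θ₀ : ℝ, ∀ (p : M) (hp : p ∈ V), θ ⟨p, hVL hp⟩ = θ₀)
    (ha : C.phaseFunctional EH H = 0) :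
    C.IsSpecialLagrangianImmersion (𝓘(ℝ, EQ).prod 𝓘(ℝ, EV)) (orbitMap hK) := by
  have : IsManifold 𝓘(ℝ, E) ∞ M := isManifold_real_of_complex
  have : FiniteDimensional ℝ E := FiniteDimensional.complexToReal E
  have : CompleteSpace EH := FiniteDimensional.complete ℝ EH
  obtain ⟨θ₀, hθ₀⟩ := hconst
  -- Every tangent vector of the orbit map at (hK, p) is a translate by h of a vector at p, so
  -- frames can be moved back to `V`.
  have hlift : ∀ (h : H) (p : V) (w : TangentSpace (𝓘(ℝ, EQ).prod 𝓘(ℝ, EV))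
      ((QuotientGroup.mk h : H ⧸ K), p)), ∃ u : TangentSpace 𝓘(ℝ, E) (p : M),
      u ∈ orbitTangentSubspace (E := E) EH H EV p ∧
      mfderiv 𝓘(ℝ, E) 𝓘(ℝ, E) (fun q : M => h • q) (p : M) u =
        mfderiv (𝓘(ℝ, EQ).prod 𝓘(ℝ, EV)) 𝓘(ℝ, E) (orbitMap hK)
          ((QuotientGroup.mk h : H ⧸ K), p) w := by
    intro h p w
    obtain ⟨u, hu, huw⟩ := (map_orbitTangentSubspace (E := E) (EH := EH) hK hV.1 hQ h p).ge ⟨w, rfl⟩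
    exact ⟨u, hu, huw⟩
  have hVω : ∀ (p : V), ∀ u ∈ tangentSubspace (E := E) EV V p,
      ∀ v ∈ tangentSubspace (E := E) EV V p, C.omega p ![u, v] = 0 := fun p u hu v hv =>
    omega_eq_zero_of_mem_tangentSubspace C hL (Set.inclusion hVL p)
      (tangentSubspace_mono hL.1 hV.1 hVL p hu) (tangentSubspace_mono hL.1 hV.1 hVL p hv)
  have hW : ∀ (p : V), ∀ u ∈ orbitTangentSubspace (E := E) EH H EV p,
      ∀ v ∈ orbitTangentSubspace (E := E) EH H EV p,
      bilinOfTwoForm (V := E) (C.omega p).toAlternatingMap u v = 0 := fun p u hu v hv =>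
    omega_eq_zero_of_mem_orbitTangentSubspace C hμ hc hV.1 hVμ p (hVω p) hu hv
  -- The constant angle: the part of each tangent space normal to `L` has dimension n - dim V =
  -- dim(H/K), and each such direction adds π/2.
  refine ⟨⟨⟨contMDiff_orbitMap hK hV.1 hQ, ?_⟩, ?_, ?_⟩,
    θ₀ + Module.finrank ℝ EQ * (Real.pi / 2), ?_⟩
  · rintro ⟨x, p⟩
    obtain ⟨h, rfl⟩ := QuotientGroup.mk_surjective x
    exact mfderiv_orbitMap_injective hK hV hQ h p (htrans p p.2)
  · rw [Module.finrank_prod, hdim]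
  · rintro ⟨x, p⟩ w w'
    obtain ⟨h, rfl⟩ := QuotientGroup.mk_surjective x
    obtain ⟨u, hu, huw⟩ := hlift h p w
    obtain ⟨u', hu', huw'⟩ := hlift h p w'
    rw [← huw, ← huw']
    exact (omega_smul_pair C hμ h p u u').trans (hW p u hu u' hu')
  · rintro ⟨x, p⟩ e he
    obtain ⟨h, rfl⟩ := QuotientGroup.mk_surjective x
    choose u hu hue using fun i => hlift h p (e i)
    have h1 := Omega_apply_of_orbitTangentSubspace C hL hV hVL p
      (show C.IsLagrangianAngleAt 𝓘(ℝ, EL) (Subtype.val : L → M) (Set.inclusion hVL p) θ₀ from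
        hθ₀ p p.2 ▸ hθ (Set.inclusion hVL p))
      (hperp p p.2) (hW p) ((finrank_orbitTangentSubspace hK hV hQ p (htrans p p.2)).trans hdim)
      hdim hu (fun i j => by
        refine (metric_smul C hI hμ h p (u i) (u j)).symm.trans ?_
        rw [hue, hue]
        exact he i j)
    have h2 := Omega_smul C hI hμ ha h p u
    simp only [hue] at h2
    rw [← h2] at h1
    exact h1
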